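/- **Notation.** For an open set $\Omega\subset\mathbb R^2$, $m\in\mathbb N_0$, $\alpha\in[0,1]$, let $C^{m,\alpha}(\Omega)$ be the space of functions $f:\Omega\to\mathbb C$ whose partial derivatives up to order $m$ exist, are continuous and extend continuously to $\overline\Omega$, and for which $$\|f\|_{C^{m,\alpha}(\Omega)}=\sum_{|k|\le m}\sup_{\Omega}|\partial^k f|+\sum_{|k|=m}\sup_{x\ne y\in\Omega}\frac{|\partial^kf(x)-\partial^kf(y)|}{|x-y|^\alpha}<\infty$$ (the second sum being omitted if $\alpha=0$). Let $w(t)=\sqrt{1-t^2}$, let $T_n$, $U_n$ ($n\ge0$) be the Chebyshev polynomials of the first and second kind, normalized to be orthonormal in $L^2((-1,1),w^{-1}dt)$ and $L^2((-1,1),w\,dt)$ respectively, and let $\widehat e_n(\theta)=e^{in\theta}/\sqrt{2\pi}$. For $s\in\mathbb R$, the spaces $T^s,W^s,U^s,Y^s$ over $(-1,1)$ consist of the distributions $u$ (linear functionals on the span of the respective functions below) with $$\|u\|^2=\sum_{n\ge0}(1+n^2)^s|c_n|^2<\infty ,$$ where $c_n=\langle u,T_n\rangle$ for $T^s$, $c_n=\langle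 u,T_nw^{-1}\rangle$ for $W^s$, $c_n=\langle u,U_n\rangle$ for $U^s$, $c_n=\langle u,U_nw\rangle$ for $Y^s$, and $\langle u,v\rangle=\int_{-1}^1uv\,dt$ for functions. Likewise $H^s$ is the space of $2\pi$-periodic distributions with $\|u\|^2=\sum_{n\in\mathbb Z}(1+n^2)^s|\langle u,\widehat e_{-n}\rangle|^2<\infty$, where $\langle u,v\rangle=\int_{-\pi}^{\pi}uv\,d\theta$ for functions. That an integral operator belongs to $\mathcal L(X,Z)$, for two of these spaces, means that there is a bounded operator $X\to Z$ which is given by the integral on all integrable functions in $X$. **Statement.** Let $m\in\mathbb N_0$, $\alpha\in[0,1]$ and $s\in\mathbb R$ be such that either $s>-\tfrac12$ and $s+\tfrac32<m+\alpha$, or $s\le-\tfrac12$ and $-s+\tfrac12<m+\alpha$. There is a constant $C$, depending only on $m,\alpha,s$, such that the following holds for every $f\in C^{m,\alpha}((-1,1)\times(-1,1))$. Extend $f$ continuously to the closed square and put $$\sigma(\theta,\phi)=f(\cos\theta,\cos\phi),\qquad \varphi(\theta,\phi)=f(\cos\theta,\cos\phi)\sin\theta\sin\phi .$$ 1. $\sigma,\varphi\in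 C^{m,\alpha}((-\pi,\pi)^2)$, and the operators $R_f^{\mathcal N}u(\theta)=\frac12\int_{-\pi}^{\pi}\sigma(\theta,\phi)u(\phi)\,d\phi$ and $R_f^{\mathcal Z}u(\theta)=\frac12\int_{-\pi}^{\pi}\varphi(\theta,\phi)u(\phi)\,d\phi$ belong to $\mathcal L(H^s,H^{s+1})$, are compact, and have norms at most $C\|\sigma\|_{C^{m,\alpha}((-\pi,\pi)^2)}$ and $C\|\varphi\|_{C^{m,\alpha}((-\pi,\pi)^2)}$ respectively. 2. The operator $R_fu(t)=\int_{-1}^1f(t,\tau)u(\tau)\,d\tau$ belongs to $\mathcal L(T^s,W^{s+1})$ and to $\mathcal L(U^s,Y^{s+1})$, is compact in both cases, and both norms are at most $C\|f\|_{C^{m,\alpha}((-1,1)^2)}$. 3. The operator $L_fu(t)=\int_{-1}^1\log|t-\tau|\,f(t,\tau)u(\tau)\,d\tau$ belongs to $\mathcal L(T^s,W^{s+1})$ and to $\mathcal L(U^s,Y^{s+1})$, and both norms are at most $C\|f\|_{C^{m,\alpha}((-1,1)^2)}$. 4. The operator $S_fu(t)=\int_{-1}^1\log|t-\tau|\,(t-\tau)^2f(t,\tau)u(\tau)\,d\tau$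 belongs to $\mathcal L(T^s,W^{s+1})$ and to $\mathcal L(U^s,Y^{s+1})$, is compact in both cases, and both norms are at most $C\|f\|_{C^{m,\alpha}((-1,1)^2)}$. -/

import Mathlib

open Set MeasureTheory
open scoped ENNReal NNReal

noncomputable section

/-! ### Hölder spaces of functions of two variables -/

/-- The partial derivative `∂₁^{k₁} ∂₂^{k₂} f` at `x`. -/
def partialDeriv (k : ℕ × ℕ) (f : ℝ × ℝ → ℂ) (x : ℝ × ℝ) : ℂ :=
  iteratedDeriv k.1 (fun t => iteratedDeriv k.2 (fun τ => f (t, τ)) x.2) x.1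

/-- The Euclidean distance in the plane (the norm of `ℝ × ℝ` in Mathlib is the maximum norm). -/
def planeDist (x y : ℝ × ℝ) : ℝ :=
  Real.sqrt ((x.1 - y.1) ^ 2 + (x.2 - y.2) ^ 2)

/-- The norm of `C^{m,α}(Ω, ℂ)`, for `Ω` open in the plane: the sum of the suprema of all partial
derivatives of order at most `m`, plus, for `α ≠ 0`, the `α`-Hölder seminorms of those of
order `m`. -/
def holderNorm (m : ℕ) (α : ℝ) (Ω : Set (ℝ × ℝ)) (f : ℝ × ℝ → ℂ) : ℝ≥0∞ :=
  (∑ j ∈ Finset.range (m + 1), ∑ k ∈ Finset.HasAntidiagonal.antidiagonal j,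
      ⨆ x ∈ Ω, ‖partialDeriv k f x‖ₑ) +
    if α = 0 then 0 else
      ∑ k ∈ Finset.HasAntidiagonal.antidiagonal m, ⨆ x ∈ Ω, ⨆ y ∈ Ω, ⨆ _ : x ≠ y,
        ‖partialDeriv k f x - partialDeriv k f y‖ₑ / ENNReal.ofReal (planeDist x y ^ α)

/-- Membership in `C^{m,α}(Ω, ℂ)`, for `Ω` open in the plane: `f` is `m` times continuously
differentiable in `Ω`, its derivatives up to order `m` extend continuously to the closure,
and the norm is finite. -/
def InHolder (m : ℕ) (α : ℝ) (Ω : Set (ℝ × ℝ)) (f : ℝ × ℝ → ℂ) : Prop :=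
  ContDiffOn ℝ m f Ω ∧
  (∀ k : ℕ × ℕ, k.1 + k.2 ≤ m →
    ∃ g : ℝ × ℝ → ℂ, ContinuousOn g (closure Ω) ∧ EqOn (partialDeriv k f) g Ω) ∧
  holderNorm m α Ω f < ⊤

/-! ### Distributions and the spaces of Sobolev type given by a family of functions -/

/-- The space of test functions spanned by a family of functions. -/
abbrev TestSpace {ι : Type} (b : ι → ℝ → ℂ) : Submodule ℂ (ℝ → ℂ) :=
  Submodule.span ℂ (range b)

/-- Distributions: linear functionals on the test functions spanned by the family `b`. Such
a functional is the same thing as the family of its values on `b`. -/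
abbrev DistribOn {ι : Type} (b : ι → ℝ → ℂ) : Type :=
  Module.Dual ℂ (TestSpace b)

/-- The family of coefficients `u_n = ⟨u, b_n⟩` of a distribution. -/
def coeff {ι : Type} (b : ι → ℝ → ℂ) : DistribOn b →ₗ[ℂ] (ι → ℂ) where
  toFun u n := u ⟨b n, Submodule.subset_span (mem_range_self n)⟩
  map_add' _ _ := rfl
  map_smul' _ _ := rfl

theorem coeff_injective {ι : Type} (b : ι → ℝ → ℂ) : Function.Injective (coeff b) := by
  intro u v h
  ext ⟨φ, hφ⟩
  induction hφ using Submodule.span_induction with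
  | mem x hx =>
    obtain ⟨n, rfl⟩ := hx
    exact congrFun h n
  | zero =>
    have h0 : (⟨0, Submodule.zero_mem _⟩ : TestSpace b) = 0 := rfl
    rw [h0, map_zero, map_zero]
  | add x y hx hy h1 h2 =>
    have h0 : (⟨x + y, Submodule.add_mem _ hx hy⟩ : TestSpace b) = ⟨x, hx⟩ + ⟨y, hy⟩ := rfl
    rw [h0, map_add, map_add, h1, h2]
  | smul a x hx h1 =>
    have h0 : (⟨a • x, Submodule.smul_mem _ a hx⟩ : TestSpace b) = a • ⟨x, hx⟩ := rfl
    rw [h0, map_smul, map_smul, h1]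

/-- The coefficients of `u`, multiplied by `(1 + d_n²)^{s/2}`. -/
def weightedCoeff {ι : Type} (b : ι → ℝ → ℂ) (d : ι → ℝ) (s : ℝ) : DistribOn b →ₗ[ℂ] (ι → ℂ) where
  toFun u n := (((1 + d n ^ 2) ^ (s / 2) : ℝ) : ℂ) * coeff b u n
  map_add' u v := by
    ext n
    simp only [map_add, Pi.add_apply, mul_add]
  map_smul' a u := by
    ext n
    simp only [map_smul, Pi.smul_apply, smul_eq_mul, RingHom.id_apply]
    ring

/-- The space of the distributions `u` with `‖u‖² = ∑_n (1 + d_n²)^s |u_n|² < ∞`. -/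
def sobolev {ι : Type} (b : ι → ℝ → ℂ) (d : ι → ℝ) (s : ℝ) : Submodule ℂ (DistribOn b) where
  carrier := {u | Memℓp (weightedCoeff b d s u) 2}
  add_mem' {u v} hu hv := by
    simp only [mem_ofPred_eq, map_add] at *
    exact hu.add hv
  zero_mem' := by
    simp only [mem_ofPred_eq, map_zero]
    exact zero_memℓp
  smul_mem' a u hu := by
    simp only [mem_ofPred_eq, map_smul] at *
    exact hu.const_smul a

/-- The isometric map of `sobolev b d s` to `ℓ²` that defines the norm. -/
def sobolevToLp {ι : Type} (b : ι → ℝ → ℂ) (d : ι → ℝ) (s : ℝ) :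
    sobolev b d s →ₗ[ℂ] lp (fun _ : ι => ℂ) 2 where
  toFun u := ⟨weightedCoeff b d s u.1, u.2⟩
  map_add' u v := Subtype.ext (map_add (weightedCoeff b d s) u.1 v.1)
  map_smul' a u := Subtype.ext (map_smul (weightedCoeff b d s) a u.1)

theorem sobolevToLp_injective {ι : Type} (b : ι → ℝ → ℂ) (d : ι → ℝ) (s : ℝ) :
    Function.Injective (sobolevToLp b d s) := by
  intro u v h
  apply Subtype.ext
  apply coeff_injective b
  ext n
  have h1 : weightedCoeff b d s u.1 n = weightedCoeff b d s v.1 n :=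
    congrFun (congrArg Subtype.val h) n
  have h2 : (((1 + d n ^ 2) ^ (s / 2) : ℝ) : ℂ) ≠ 0 := by
    have h3 : (0 : ℝ) < (1 + d n ^ 2) ^ (s / 2) := by positivity
    exact_mod_cast h3.ne'
  exact mul_left_cancel₀ h2 h1

instance {ι : Type} (b : ι → ℝ → ℂ) (d : ι → ℝ) (s : ℝ) :
    NormedAddCommGroup (sobolev b d s) :=
  NormedAddCommGroup.induced _ _ (sobolevToLp b d s) (sobolevToLp_injective b d s)

instance {ι : Type} (b : ι → ℝ → ℂ) (d : ι → ℝ) (s : ℝ) :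
    NormedSpace ℂ (sobolev b d s) :=
  NormedSpace.induced ℂ _ _ (sobolevToLp b d s)

theorem sobolev_norm_sq {ι : Type} (b : ι → ℝ → ℂ) (d : ι → ℝ) (s : ℝ) (u : sobolev b d s) :
    HasSum (fun n => (1 + d n ^ 2) ^ s * ‖coeff b u.1 n‖ ^ 2) (‖u‖ ^ 2) := by
  have h := lp.hasSum_norm (p := 2) (by norm_num) (sobolevToLp b d s u)
  have h1 : ‖u‖ = ‖sobolevToLp b d s u‖ := rfl
  rw [h1]
  convert h using 1
  · ext n
    have h2 : (sobolevToLp b d s u : ι → ℂ) n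
        = (((1 + d n ^ 2) ^ (s / 2) : ℝ) : ℂ) * coeff b u.1 n := rfl
    have h3 : (0 : ℝ) ≤ (1 + d n ^ 2) ^ (s / 2) := by positivity
    rw [h2, norm_mul, Complex.norm_real, Real.norm_of_nonneg h3]
    simp only [ENNReal.toReal_ofNat, Real.rpow_ofNat]
    have h4 : ((1 + d n ^ 2) ^ (s / 2)) ^ 2 = (1 + d n ^ 2) ^ s := by
      rw [← Real.rpow_mul_natCast (by positivity)]
      congr 1
      push_cast
      ring
    rw [mul_pow, h4]
  · simp

/-! ### The periodic and the Chebyshev families -/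

/-- The weight `w(t) = √(1 - t²)`. -/
def chebWeight (t : ℝ) : ℝ := Real.sqrt (1 - t ^ 2)

/-- The Chebyshev polynomials of the first kind, orthonormal for `w⁻¹ dt` on `(-1, 1)`. -/
def chebT (n : ℕ) (t : ℝ) : ℝ :=
  (if n = 0 then Real.sqrt (1 / Real.pi) else Real.sqrt (2 / Real.pi)) *
    (Polynomial.Chebyshev.T ℝ n).eval t

/-- The Chebyshev polynomials of the second kind, orthonormal for `w dt` on `(-1, 1)`. -/
def chebU (n : ℕ) (t : ℝ) : ℝ :=
  Real.sqrt (2 / Real.pi) * (Polynomial.Chebyshev.U ℝ n).eval t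

/-- The functions `e^{i n θ} / √(2π)`. -/
def fourierFun (n : ℤ) (θ : ℝ) : ℂ :=
  Complex.exp (Complex.I * n * θ) / Real.sqrt (2 * Real.pi)

/-- The family against which the coefficients of the periodic Sobolev space `H^s` are taken. -/
def famH (n : ℤ) (θ : ℝ) : ℂ := fourierFun (-n) θ

/-- The family against which the coefficients of `T^s` are taken. -/
def famT (n : ℕ) (t : ℝ) : ℂ := (chebT n t : ℂ)

/-- The family against which the coefficients of `W^s` are taken. -/
def famW (n : ℕ) (t : ℝ) : ℂ := ((chebT n t * (chebWeight t)⁻¹ : ℝ) : ℂ)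

/-- The family against which the coefficients of `U^s` are taken. -/
def famU (n : ℕ) (t : ℝ) : ℂ := (chebU n t : ℂ)

/-- The family against which the coefficients of `Y^s` are taken. -/
def famY (n : ℕ) (t : ℝ) : ℂ := ((chebU n t * chebWeight t : ℝ) : ℂ)

/-- The periodic Sobolev space `H^s[-π, π]`. -/
abbrev SpaceH (s : ℝ) : Submodule ℂ (DistribOn famH) := sobolev famH (fun n => (n : ℝ)) s

/-- The space `T^s` over `(-1, 1)`. -/
abbrev SpaceT (s : ℝ) : Submodule ℂ (DistribOn famT) := sobolev famT (fun n => (n : ℝ)) s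

/-- The space `W^s` over `(-1, 1)`. -/
abbrev SpaceW (s : ℝ) : Submodule ℂ (DistribOn famW) := sobolev famW (fun n => (n : ℝ)) s

/-- The space `U^s` over `(-1, 1)`. -/
abbrev SpaceU (s : ℝ) : Submodule ℂ (DistribOn famU) := sobolev famU (fun n => (n : ℝ)) s

/-- The space `Y^s` over `(-1, 1)`. -/
abbrev SpaceY (s : ℝ) : Submodule ℂ (DistribOn famY) := sobolev famY (fun n => (n : ℝ)) s

/-! ### Integral operators -/

/-- The distribution `U` is the function `u` on `I`, acting on test functions by integration. -/
def Represents {ι : Type} {b : ι → ℝ → ℂ} (I : Set ℝ) (u : ℝ → ℂ) (U : DistribOn b) : Prop :=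
  ∀ φ : TestSpace b,
    IntegrableOn (fun t => u t * φ.1 t) I ∧ U φ = ∫ t in I, u t * φ.1 t

/-- The bounded operator `A` is the integral operator `u ↦ ∫_I κ(·, τ) u(τ) dτ`: it is given by
this integral on all integrable functions in its domain (these are dense in the spaces used
here, so that `A` is determined by the kernel). -/
def IsIntegralOp {ι ι' : Type} {b : ι → ℝ → ℂ} {b' : ι' → ℝ → ℂ} {d : ι → ℝ} {d' : ι' → ℝ}
    {s s' : ℝ} (I : Set ℝ) (κ : ℝ → ℝ → ℂ) (A : sobolev b d s →L[ℂ] sobolev b' d' s') : Prop :=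
  ∀ (u : ℝ → ℂ) (U : sobolev b d s), IntegrableOn u I → Represents I u U.1 →
    (∀ᵐ t ∂(volume.restrict I), IntegrableOn (fun τ => κ t τ * u τ) I) ∧
    Represents I (fun t => ∫ τ in I, κ t τ * u τ) (A U).1

/-- The interval `(-1, 1)`. -/
def arcI : Set ℝ := Ioo (-1) 1

/-- The interval `(-π, π)`. -/
def periodI : Set ℝ := Ioo (-Real.pi) Real.pi

/-- The kernel of `R_f`. -/
def kerR (f : ℝ × ℝ → ℂ) (t τ : ℝ) : ℂ := f (t, τ)

/-- The kernel of `L_f`. -/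
def kerL (f : ℝ × ℝ → ℂ) (t τ : ℝ) : ℂ := (Real.log |t - τ| : ℂ) * f (t, τ)

/-- The kernel of `S_f`. -/
def kerS (f : ℝ × ℝ → ℂ) (t τ : ℝ) : ℂ :=
  (Real.log |t - τ| : ℂ) * ((t - τ : ℝ) : ℂ) ^ 2 * f (t, τ)

/-- The function `σ(θ, φ) = f(cos θ, cos φ)`, where `f`, given on the open square, is extended
by continuity to the closed square. -/
def sigmaFun (f : ℝ × ℝ → ℂ) (x : ℝ × ℝ) : ℂ :=
  extendFrom (arcI ×ˢ arcI) f (Real.cos x.1, Real.cos x.2)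

/-- The function `φ(θ, φ) = f(cos θ, cos φ) sin θ sin φ`. -/
def phiFun (f : ℝ × ℝ → ℂ) (x : ℝ × ℝ) : ℂ :=
  sigmaFun f x * Real.sin x.1 * Real.sin x.2

/-- The kernel `f(cos θ, cos φ) / 2` of the periodic operator `R_f^N`. -/
def kerRN (f : ℝ × ℝ → ℂ) (θ φ : ℝ) : ℂ := 1 / 2 * sigmaFun f (θ, φ)

/-- The kernel `f(cos θ, cos φ) sin θ sin φ / 2` of the periodic operator `R_f^Z`. -/
def kerRZ (f : ℝ × ℝ → ℂ) (θ φ : ℝ) : ℂ := 1 / 2 * phiFun f (θ, φ)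

end

/-! Under t = cos θ the spaces over the interval become periodic. The Jacobian sin θ turns the
pairings of u with `T_n` into the Fourier coefficients of the even function u(cos φ)|sin φ|. In the
pairings with `T_n w⁻¹` the weight cancels the Jacobian, so these are the Fourier coefficients of
v(cos θ) itself (`fourierInt_evenLift`, `coeff_famW_of_even`). Since cos θ - cos φ = -2 sin((θ+φ)/2)
sin((θ-φ)/2), the logarithm of its modulus is the sum of one convolution kernel taken at θ - φ and
at θ + φ. Hence `R_f`, `L_f`, `S_f` all come from periodic operators with kernel a(θ-φ)Φ(θ,φ),
folded from (-π,π) to (0,π). Here a is 1, log(√2|sin(x/2)|) or 4 sin²(x/2) log(√2|sin(x/2)|), and Φ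
is σ/2, σ or sin²((θ+φ)/2)σ. In the two periodic operators of the first part a = 1.

The Fourier coefficients `a_j` are O(1/⟨j⟩), with ⟨j⟩ = (1+j²)^{1/2}. The matrix of the periodic
operator has the entries Σ_j a_j Φ̂(k-j, j-n). Put R = 1 + |k-j| + |j-n| and μ = max(s, 0, -s-1).
The factor ⟨k⟩^{s+1}⟨n⟩^{-s} that conjugates H^s → H^{s+1} to ℓ² is at most (2R)^μ(⟨j⟩ + R)
(`jap_mul_jap_le`). Where R ≤ ⟨j⟩, the decay of `a_j` absorbs ⟨j⟩, and each frequency of Φ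
contributes a weighted shift of norm O(|Φ̂|R^μ). Where R > ⟨j⟩, each j contributes a Hilbert–Schmidt
matrix of norm O(⟨j⟩^{-1-ε}). Both series of operators converge in norm if Σ R^{2τ}|Φ̂|² < ∞ with τ
= μ + 1 + ε. The far part is always compact; the near part is compact if Σ|a_j|²⟨j⟩² < ∞. That holds
for a = 1 and for the kernel of `S_f`, and fails for the logarithm. This is
`exists_matrix_operator`.

The weighted ℓ² bound holds for every τ < m + α by Parseval, and by Bernstein's dyadic argument for
the fractional part of the smoothness (`sum_abs_rpow_fourierInt_le`, `summable_fourierInt₂`). That σ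
inherits the class of f needs care where a cosine is ±1, because f is differentiable only inside the
square; there the derivatives are recovered from the fundamental theorem of calculus
(`exists_cosJet`).

The pair U^s, Y^{s+1} follows from T^s, W^{s+1}: by 2T_n = U_n - U_{n-2} and 2(1-t²)U_n = T_n -
T_{n+2}, restriction of functionals is bounded from U^s to T^s and from W^{s+1} to Y^{s+1}, and it
does not change which function a distribution represents. -/

/-! ### Operators on `ℓ²` -/

/-- The complex Hilbert space `ℓ²(ι)`. -/
abbrev EllTwo (ι : Type) : Type := lp (fun _ : ι => ℂ) 2

theorem EllTwo.sum_sq_le {ι : Type} (c : EllTwo ι) (F : Finset ι) :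
    ∑ i ∈ F, ‖c i‖ ^ 2 ≤ ‖c‖ ^ 2 := by
  have h := lp.sum_rpow_le_norm_rpow (p := 2) (by norm_num) c F
  simpa using h

theorem EllTwo.exists_of_sum_sq_le {ι : Type} (f : ι → ℂ) (M : ℝ) (hM : 0 ≤ M)
    (h : ∀ F : Finset ι, ∑ i ∈ F, ‖f i‖ ^ 2 ≤ M ^ 2) :
    ∃ c : EllTwo ι, (∀ i, c i = f i) ∧ ‖c‖ ≤ M := by
  have hf : Memℓp f 2 := memℓp_gen' (C := M ^ 2) (by simpa using h)
  refine ⟨⟨f, hf⟩, fun _ => rfl, ?_⟩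
  exact lp.norm_le_of_forall_sum_le (p := 2) (by norm_num) hM (by simpa using h)

/-- A linear map into sequences which satisfies an `ℓ²` bound is a bounded operator to `ℓ²`. -/
theorem EllTwo.exists_clm {ι : Type} {E : Type*} [NormedAddCommGroup E] [NormedSpace ℂ E]
    (Φ : E →ₗ[ℂ] (ι → ℂ)) (B : ℝ) (hB : 0 ≤ B)
    (h : ∀ c (F : Finset ι), ∑ i ∈ F, ‖Φ c i‖ ^ 2 ≤ (B * ‖c‖) ^ 2) :
    ∃ T : E →L[ℂ] EllTwo ι, (∀ c i, T c i = Φ c i) ∧ ‖T‖ ≤ B := by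
  choose g hg hgn using fun c =>
    EllTwo.exists_of_sum_sq_le (Φ c) (B * ‖c‖) (by positivity) (h c)
  let T : E →ₗ[ℂ] EllTwo ι :=
    { toFun := g
      map_add' := fun x y => by
        ext i
        rw [lp.coeFn_add, Pi.add_apply, hg, hg, hg, map_add, Pi.add_apply]
      map_smul' := fun a x => by
        ext i
        rw [lp.coeFn_smul, Pi.smul_apply, hg, hg, map_smul, Pi.smul_apply]
        rfl }
  exact ⟨T.mkContinuous B hgn, fun c i => hg c i, T.mkContinuous_norm_le hB hgn⟩

/-- Composition with a map, followed by multiplication with a bounded weight. -/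
theorem EllTwo.exists_weightedComp {ι ι' : Type} (ω : ι → ℂ) (ρ : ι → ι')
    (hρ : InjOn ρ {i | ω i ≠ 0}) (B : ℝ) (hB : 0 ≤ B) (hω : ∀ i, ‖ω i‖ ≤ B) :
    ∃ T : EllTwo ι' →L[ℂ] EllTwo ι, (∀ c i, T c i = ω i * c (ρ i)) ∧ ‖T‖ ≤ B := by
  classical
  let Φ : EllTwo ι' →ₗ[ℂ] (ι → ℂ) :=
    { toFun := fun c i => ω i * c (ρ i)
      map_add' := fun x y => by
        ext i
        simp only [lp.coeFn_add, Pi.add_apply, mul_add]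
      map_smul' := fun a x => by
        ext i
        simp only [lp.coeFn_smul, Pi.smul_apply, smul_eq_mul, RingHom.id_apply]
        ring }
  refine EllTwo.exists_clm Φ B hB fun c F => ?_
  -- Only indices with nonzero weight contribute, and on these `ρ` is injective, so no coordinate of
  -- `c` is counted twice.
  have h1 : ∑ i ∈ F, ‖Φ c i‖ ^ 2 = ∑ i ∈ F.filter (fun i => ω i ≠ 0), ‖Φ c i‖ ^ 2 := by
    symm
    apply Finset.sum_filter_of_ne
    intro i _ hi h0
    apply hi
    simp [Φ, h0]
  have h2 : ∑ i ∈ F.filter (fun i => ω i ≠ 0), ‖Φ c i‖ ^ 2 ≤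
      ∑ i ∈ F.filter (fun i => ω i ≠ 0), B ^ 2 * ‖c (ρ i)‖ ^ 2 := by
    refine Finset.sum_le_sum fun i _ => ?_
    simp only [Φ, LinearMap.coe_mk, AddHom.coe_mk, norm_mul, mul_pow]
    gcongr
    exact hω i
  have h3 : ∑ i ∈ F.filter (fun i => ω i ≠ 0), ‖c (ρ i)‖ ^ 2 =
      ∑ j ∈ (F.filter (fun i => ω i ≠ 0)).image ρ, ‖c j‖ ^ 2 := by
    rw [Finset.sum_image]
    intro i hi j hj hij
    exact hρ (by simpa using (Finset.mem_filter.1 hi).2) (by simpa using (Finset.mem_filter.1 hj).2)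
      hij
  rw [h1]
  refine h2.trans ?_
  rw [← Finset.mul_sum, h3, mul_pow]
  gcongr
  exact EllTwo.sum_sq_le c _

/-- A square summable matrix defines a compact operator. -/
theorem EllTwo.exists_hilbertSchmidt {ι ι' : Type} (H : ι → ι' → ℂ) (M : ℝ) (hM : 0 ≤ M)
    (hs : Summable fun x : ι × ι' => ‖H x.1 x.2‖ ^ 2)
    (hle : ∑' x : ι × ι', ‖H x.1 x.2‖ ^ 2 ≤ M ^ 2) :
    ∃ T : EllTwo ι' →L[ℂ] EllTwo ι, (∀ c k, HasSum (fun n => H k n * c n) (T c k)) ∧ ‖T‖ ≤ M ∧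
      IsCompactOperator T := by
  classical
  have hrow : ∀ k, Summable fun n => ‖H k n‖ ^ 2 := fun k => hs.prod_factor k
  have hcol : Summable fun k => ∑' n, ‖H k n‖ ^ 2 := hs.prod
  have hnn : ∀ k, 0 ≤ ∑' n, ‖H k n‖ ^ 2 := fun k => tsum_nonneg fun n => by positivity
  have hex : ∀ k, ∃ r : EllTwo ι', (∀ n, r n = star (H k n)) ∧
      ‖r‖ ≤ Real.sqrt (∑' n, ‖H k n‖ ^ 2) := fun k =>
    EllTwo.exists_of_sum_sq_le _ _ (Real.sqrt_nonneg _) fun F => by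
      rw [Real.sq_sqrt (hnn k)]
      simp only [norm_star]
      exact (hrow k).sum_le_tsum F fun n _ => by positivity
  choose r hr hrn using hex
  let φ : ι → (EllTwo ι' →L[ℂ] ℂ) := fun k => innerSL ℂ (r k)
  have hφ : ∀ c k, HasSum (fun n => H k n * c n) (φ k c) := fun c k => by
    have h := lp.hasSum_inner (𝕜 := ℂ) (r k) c
    have h2 : (fun n => H k n * c n) = fun n => inner ℂ (r k n) (c n) := by
      funext n
      rw [hr, RCLike.inner_apply]
      simp [mul_comm]
    rw [h2]
    exact h
  have hφn : ∀ c k, ‖φ k c‖ ^ 2 ≤ (∑' n, ‖H k n‖ ^ 2) * ‖c‖ ^ 2 := fun c k => by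
    have h1 : ‖φ k c‖ ≤ ‖r k‖ * ‖c‖ := norm_inner_le_norm (𝕜 := ℂ) (r k) c
    calc ‖φ k c‖ ^ 2 ≤ (Real.sqrt (∑' n, ‖H k n‖ ^ 2) * ‖c‖) ^ 2 := by
          gcongr
          exact h1.trans (by gcongr; exact hrn k)
      _ = _ := by rw [mul_pow, Real.sq_sqrt (hnn k)]
  -- Keeping only the rows in `S` treats two things at once: `univ` gives the operator, and the
  -- complement of a finite set gives the error of a finite rank truncation, with norm at most the
  -- root of a tail of a convergent series.
  let Φ : Set ι → (EllTwo ι' →ₗ[ℂ] (ι → ℂ)) := fun S =>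
    { toFun := fun c k => S.indicator (fun k => φ k c) k
      map_add' := fun x y => by
        ext k
        by_cases hk : k ∈ S <;> simp [hk]
      map_smul' := fun a x => by
        ext k
        by_cases hk : k ∈ S <;> simp [hk] }
  have htot : ∀ S : Set ι, ∀ c (F : Finset ι), ∑ k ∈ F, ‖Φ S c k‖ ^ 2 ≤
      (Real.sqrt (∑' k : S, ∑' n, ‖H k n‖ ^ 2) * ‖c‖) ^ 2 := by
    intro S c F
    have h1 : ∀ k, ‖Φ S c k‖ ^ 2 ≤ S.indicator (fun k => ∑' n, ‖H k n‖ ^ 2) k * ‖c‖ ^ 2 := by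
      intro k
      by_cases hk : k ∈ S
      · simpa [Φ, hk] using hφn c k
      · simp [Φ, hk]
    rw [mul_pow, Real.sq_sqrt (tsum_nonneg fun k : S => hnn k), tsum_subtype S
      (fun k => ∑' n, ‖H k n‖ ^ 2)]
    refine (Finset.sum_le_sum fun k _ => h1 k).trans ?_
    rw [← Finset.sum_mul]
    gcongr
    exact (hcol.indicator S).sum_le_tsum F fun k _ => indicator_nonneg (fun k _ => hnn k) k
  have hT := fun S => EllTwo.exists_clm (Φ S) _ (Real.sqrt_nonneg _) (htot S)
  choose T hT1 hT2 using hT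
  have happ : ∀ c k, T univ c k = φ k c := fun c k => by simp [hT1, Φ]
  refine ⟨T univ, fun c k => by rw [happ]; exact hφ c k, ?_, ?_⟩
  · refine (hT2 univ).trans ?_
    rw [tsum_univ (fun k => ∑' n, ‖H k n‖ ^ 2), ← hs.tsum_prod]
    exact Real.sqrt_le_iff.2 ⟨hM, hle⟩
  · let G : Finset ι → (EllTwo ι' →L[ℂ] EllTwo ι) := fun F =>
      ∑ k ∈ F, (lp.singleContinuousLinearMap ℂ (fun _ : ι => ℂ) 2 k).comp (φ k)
    have hG : ∀ F, T univ - G F = T ((F : Set ι)ᶜ) := fun F => by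
      ext c k
      have h1 : (G F c : ι → ℂ) k = if k ∈ F then φ k c else 0 := by
        simp only [G, sum_apply, lp.coeFn_sum, Finset.sum_apply,
          ContinuousLinearMap.comp_apply, lp.singleContinuousLinearMap_apply, lp.coeFn_single]
        simp [Pi.single_apply]
      rw [sub_apply, lp.coeFn_sub, Pi.sub_apply, h1, happ, hT1]
      by_cases hk : k ∈ F <;> simp [Φ, hk]
    have hlim : Filter.Tendsto G Filter.atTop (nhds (T univ)) := by
      rw [tendsto_iff_norm_sub_tendsto_zero]
      have h0 := tendsto_tsum_compl_atTop_zero (fun k => ∑' n, ‖H k n‖ ^ 2)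
      have h1 := (Real.continuous_sqrt.tendsto 0).comp h0
      rw [Real.sqrt_zero] at h1
      refine squeeze_zero (fun _ => norm_nonneg _) (fun F => ?_) h1
      rw [norm_sub_rev, hG]
      exact hT2 _
    refine isCompactOperator_of_tendsto hlim (Filter.Eventually.of_forall fun F => ?_)
    have hk : ∀ k, IsCompactOperator
        ((lp.singleContinuousLinearMap ℂ (fun _ : ι => ℂ) 2 k).comp (φ k)) := fun k =>
      ((isCompactOperator_id (E := ℂ)).comp_clm (φ k)).clm_comp
        (lp.singleContinuousLinearMap ℂ (fun _ : ι => ℂ) 2 k)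
    have : G F ∈ compactOperator (RingHom.id ℂ) (EllTwo ι') (EllTwo ι) :=
      Submodule.sum_mem _ fun k _ => hk k
    exact this

theorem isCompactOperator_tsum {κ : Type*} {E F : Type*} [NormedAddCommGroup E] [NormedSpace ℂ E]
    [NormedAddCommGroup F] [NormedSpace ℂ F] [CompleteSpace F] {T : κ → E →L[ℂ] F}
    {S : E →L[ℂ] F} (h : HasSum T S) (hT : ∀ k, IsCompactOperator (T k)) :
    IsCompactOperator S := by
  refine isCompactOperator_of_tendsto h (Filter.Eventually.of_forall fun A => ?_)
  have : ∑ k ∈ A, T k ∈ compactOperator (RingHom.id ℂ) E F :=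
    Submodule.sum_mem _ fun k _ => hT k
  exact this

/-! ### Weights -/

/-- The weight `(1 + n²)^{1/2}`. -/
noncomputable def jap (n : ℤ) : ℝ := Real.sqrt (1 + (n : ℝ) ^ 2)

/-- The weight `1 + |p| + |q|`. -/
def latticeWeight (x : ℤ × ℤ) : ℝ := 1 + |(x.1 : ℝ)| + |(x.2 : ℝ)|

theorem one_le_jap (n : ℤ) : 1 ≤ jap n := by
  rw [jap, Real.one_le_sqrt]
  nlinarith [sq_nonneg (n : ℝ)]

theorem jap_pos (n : ℤ) : 0 < jap n := zero_lt_one.trans_le (one_le_jap n)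

theorem jap_sq (n : ℤ) : jap n ^ 2 = 1 + (n : ℝ) ^ 2 := Real.sq_sqrt (by positivity)

theorem jap_rpow (n : ℤ) (r : ℝ) : jap n ^ r = (1 + (n : ℝ) ^ 2) ^ (r / 2) := by
  rw [jap, Real.sqrt_eq_rpow, ← Real.rpow_mul (by positivity)]
  congr 1
  ring

theorem abs_le_jap (n : ℤ) : |(n : ℝ)| ≤ jap n := by
  rw [jap]
  apply Real.le_sqrt_of_sq_le
  rw [sq_abs]
  linarith

theorem jap_add_le (a b : ℤ) : jap (a + b) ≤ jap a + |(b : ℝ)| := by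
  have h0 := abs_le_jap a
  have h1 := jap_sq a
  rw [show jap (a + b) = Real.sqrt (1 + ((a + b : ℤ) : ℝ) ^ 2) from rfl, Real.sqrt_le_iff]
  refine ⟨by have := jap_pos a; positivity, ?_⟩
  push_cast
  have h2 : (a : ℝ) * b ≤ jap a * |(b : ℝ)| :=
    (le_abs_self _).trans (by rw [abs_mul]; gcongr)
  nlinarith [sq_abs (b : ℝ)]

theorem one_le_latticeWeight (x : ℤ × ℤ) : 1 ≤ latticeWeight x := by
  rw [latticeWeight]
  have := abs_nonneg (x.1 : ℝ)
  have := abs_nonneg (x.2 : ℝ)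
  linarith

theorem latticeWeight_pos (x : ℤ × ℤ) : 0 < latticeWeight x :=
  zero_lt_one.trans_le (one_le_latticeWeight x)

theorem summable_one_add_abs_rpow {r : ℝ} (hr : 1 < r) :
    Summable fun n : ℤ => (1 + |(n : ℝ)|) ^ (-r) := by
  -- The added indicator dominates the term n = 0, where the power of |n| itself is 0.
  have h1 := (Real.summable_abs_int_rpow hr).add (hasSum_ite_eq (0 : ℤ) (1 : ℝ)).summable
  refine Summable.of_nonneg_of_le (fun n => by positivity) (fun n => ?_) h1
  by_cases hn : n = 0
  · subst hn
    simp [Real.zero_rpow_nonneg]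
  · have h2 : 0 < |(n : ℝ)| := by positivity
    simp only [hn, if_false, add_zero]
    exact Real.rpow_le_rpow_of_nonpos h2 (by linarith) (by linarith)

theorem summable_jap_rpow {r : ℝ} (hr : 1 < r) : Summable fun n : ℤ => jap n ^ (-r) := by
  have h1 := (summable_one_add_abs_rpow hr).mul_left ((2 : ℝ)⁻¹ ^ (-r))
  refine Summable.of_nonneg_of_le (fun n => by have := jap_pos n; positivity) (fun n => ?_) h1
  rw [← Real.mul_rpow (by norm_num) (by positivity)]
  refine Real.rpow_le_rpow_of_nonpos (by positivity) ?_ (by linarith)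
  have := abs_le_jap n
  have := one_le_jap n
  linarith

/-- The weight dominates both 1+|p| and 1+|q|; giving one of the two square factors to each variable
leaves a product of two convergent one-dimensional series. -/
theorem summable_latticeWeight_rpow {ε : ℝ} (hε : 0 < ε) :
    Summable fun x : ℤ × ℤ => (latticeWeight x ^ (-(1 + ε))) ^ 2 := by
  have h := summable_one_add_abs_rpow (r := 1 + ε) (by linarith)
  have h1 := h.mul_of_nonneg h (fun n => by positivity) (fun n => by positivity)
  refine Summable.of_nonneg_of_le (fun x => by positivity) (fun x => ?_) h1
  rw [sq]
  have h2 : ∀ y : ℝ, 0 ≤ y → 1 + y ≤ latticeWeight x →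
      latticeWeight x ^ (-(1 + ε)) ≤ (1 + y) ^ (-(1 + ε)) := fun y hy h =>
    Real.rpow_le_rpow_of_nonpos (by positivity) h (by linarith)
  have h3 : 0 < latticeWeight x := latticeWeight_pos x
  have h4 := abs_nonneg (x.1 : ℝ)
  have h5 := abs_nonneg (x.2 : ℝ)
  exact mul_le_mul (h2 _ h4 (by rw [latticeWeight]; linarith))
    (h2 _ h5 (by rw [latticeWeight]; linarith)) (by positivity) (by positivity)

/-- The order of regularity, less one, which an operator of order `-1` on the scale needs. -/
noncomputable def excessOrder (s : ℝ) : ℝ := max (max s 0) (-s - 1)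

/-- Comparison of the weights of a matrix entry `(k, n)` which is reached through `j`. -/
theorem jap_mul_jap_le (s : ℝ) (k j n : ℤ) :
    jap k ^ (s + 1) * jap n ^ (-s) ≤
      (2 * latticeWeight (k - j, j - n)) ^ excessOrder s *
        (jap j + latticeWeight (k - j, j - n)) := by
  set R := latticeWeight (k - j, j - n) with hR
  have hR1 : 1 ≤ R := one_le_latticeWeight _
  have hk := jap_pos k
  have hn := jap_pos n
  have hj := jap_pos j
  have hn1 := one_le_jap n
  have hk1 := one_le_jap k
  have hRdef : R = 1 + |((k - j : ℤ) : ℝ)| + |((j - n : ℤ) : ℝ)| := rfl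
  have ha := abs_nonneg ((k - j : ℤ) : ℝ)
  have hb := abs_nonneg ((j - n : ℤ) : ℝ)
  have hkj : jap k ≤ jap j + R := by
    have := jap_add_le j (k - j)
    rw [add_sub_cancel] at this
    linarith
  have hnj : jap n ≤ jap j + R := by
    have := jap_add_le j (n - j)
    rw [add_sub_cancel] at this
    have h2 : |((n - j : ℤ) : ℝ)| = |((j - n : ℤ) : ℝ)| := by
      push_cast
      rw [abs_sub_comm]
    rw [h2] at this
    linarith
  have habs : |((k - n : ℤ) : ℝ)| ≤ R := by
    have : ((k - n : ℤ) : ℝ) = ((k - j : ℤ) : ℝ) + ((j - n : ℤ) : ℝ) := by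
      push_cast
      ring
    rw [this]
    have := abs_add_le ((k - j : ℤ) : ℝ) ((j - n : ℤ) : ℝ)
    linarith
  have hkn : jap k ≤ 2 * R * jap n := by
    have h := jap_add_le n (k - n)
    rw [add_sub_cancel] at h
    nlinarith
  have hnk : jap n ≤ 2 * R * jap k := by
    have h := jap_add_le k (n - k)
    rw [add_sub_cancel] at h
    have h2 : |((n - k : ℤ) : ℝ)| = |((k - n : ℤ) : ℝ)| := by
      push_cast
      rw [abs_sub_comm]
    rw [h2] at h
    nlinarith
  have h2R : 1 ≤ 2 * R := by linarith
  -- For s ≥ 0 the left side is (⟨k⟩/⟨n⟩)^s ⟨k⟩, for s < -1 it is (⟨n⟩/⟨k⟩)^{-s-1} ⟨n⟩, and both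
  -- ratios are at most 2R. In between, both exponents are nonnegative with sum 1, so no power of R
  -- is lost.
  rcases le_or_gt 0 s with hs | hs
  · have h1 : jap k ^ (s + 1) * jap n ^ (-s) = (jap k / jap n) ^ s * jap k := by
      rw [Real.rpow_add hk, Real.rpow_one, Real.rpow_neg hn.le, Real.div_rpow hk.le hn.le]
      field_simp
    rw [h1]
    have h2 : (jap k / jap n) ^ s ≤ (2 * R) ^ s :=
      Real.rpow_le_rpow (by positivity) ((div_le_iff₀ hn).2 hkn) hs
    have h3 : (2 * R) ^ s ≤ (2 * R) ^ excessOrder s :=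
      Real.rpow_le_rpow_of_exponent_le h2R ((le_max_left _ _).trans (le_max_left _ _))
    gcongr
    exact h2.trans h3
  · rcases le_or_gt (-1) s with hs1 | hs1
    · have h1 : jap k ^ (s + 1) * jap n ^ (-s) ≤ jap j + R := by
        calc jap k ^ (s + 1) * jap n ^ (-s) ≤ (jap j + R) ^ (s + 1) * (jap j + R) ^ (-s) := by
              gcongr <;> linarith
          _ = jap j + R := by
              rw [← Real.rpow_add (by positivity)]
              simp
      have h2 : 1 ≤ (2 * R) ^ excessOrder s :=
        Real.one_le_rpow h2R ((le_max_right _ _).trans (le_max_left _ _))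
      have h3 : 0 ≤ jap j + R := by positivity
      nlinarith
    · have h1 : jap k ^ (s + 1) * jap n ^ (-s) = (jap n / jap k) ^ (-s - 1) * jap n := by
        rw [Real.div_rpow hn.le hk.le, show s + 1 = -(-s - 1) by ring, Real.rpow_neg hk.le]
        have : jap n ^ (-s) = jap n ^ (-s - 1) * jap n := by
          conv_lhs => rw [show -s = (-s - 1) + 1 by ring]
          rw [Real.rpow_add hn, Real.rpow_one]
        rw [this]
        field_simp
      rw [h1]
      have h2 : (jap n / jap k) ^ (-s - 1) ≤ (2 * R) ^ (-s - 1) :=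
        Real.rpow_le_rpow (by positivity) ((div_le_iff₀ hk).2 hnk) (by linarith)
      have h3 : (2 * R) ^ (-s - 1) ≤ (2 * R) ^ excessOrder s :=
        Real.rpow_le_rpow_of_exponent_le h2R (le_max_right _ _)
      gcongr
      exact h2.trans h3

theorem sum_mul_le_of_sq_le {κ : Type*} (F : Finset κ) (f g : κ → ℝ) (A B : ℝ) (hA : 0 ≤ A)
    (hB : 0 ≤ B) (hf : ∑ i ∈ F, f i ^ 2 ≤ A ^ 2) (hg : ∑ i ∈ F, g i ^ 2 ≤ B ^ 2) :
    ∑ i ∈ F, f i * g i ≤ A * B := by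
  have h := Finset.sum_mul_sq_le_sq_mul_sq F f g
  refine le_of_sq_le_sq ?_ (by positivity)
  rw [mul_pow]
  refine h.trans ?_
  have := Finset.sum_nonneg fun i (_ : i ∈ F) => sq_nonneg (g i)
  gcongr

/-- The bijection `(j, n) ↦ (k - j, j - n)`. -/
def pathEquiv (k : ℤ) : ℤ × ℤ ≃ ℤ × ℤ where
  toFun y := (k - y.1, y.1 - y.2)
  invFun x := (k - x.1, k - x.1 - x.2)
  left_inv y := by ext <;> simp
  right_inv x := by ext <;> simp

/-- The bijection `(k, n) ↦ (k - j, j - n)`. -/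
def throughEquiv (j : ℤ) : ℤ × ℤ ≃ ℤ × ℤ where
  toFun y := (y.1 - j, j - y.2)
  invFun x := (x.1 + j, j - x.2)
  left_inv y := by ext <;> simp
  right_inv x := by ext <;> simp

theorem norm_mul_ofReal_mul (z w : ℂ) {x y : ℝ} (hx : 0 < x) (hy : 0 < y) :
    ‖z * (((x * y : ℝ) : ℂ) * w)‖ = ‖z‖ * (x * y * ‖w‖) := by
  rw [norm_mul, norm_mul, Complex.norm_real, Real.norm_eq_abs, abs_of_pos (mul_pos hx hy)]

/-- Near the diagonal ⟨j⟩ + R ≤ 2⟨j⟩, which the decay of `a j` absorbs; only R^μ remains. -/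
theorem norm_entry_le_of_le {s A : ℝ} {a : ℤ → ℂ} (hA : ∀ j, ‖a j‖ * jap j ≤ A) (k j n : ℤ)
    (h : latticeWeight (k - j, j - n) ≤ jap j) :
    jap k ^ (s + 1) * jap n ^ (-s) * ‖a j‖ ≤
      2 * 2 ^ excessOrder s * A * latticeWeight (k - j, j - n) ^ excessOrder s := by
  have h1 := jap_mul_jap_le s k j n
  set R := latticeWeight (k - j, j - n)
  have hR : 0 < R := latticeWeight_pos _
  have hj := jap_pos j
  calc jap k ^ (s + 1) * jap n ^ (-s) * ‖a j‖
      ≤ (2 * R) ^ excessOrder s * (jap j + R) * ‖a j‖ := by gcongr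
    _ ≤ (2 * R) ^ excessOrder s * (jap j + jap j) * ‖a j‖ := by gcongr
    _ = 2 * (2 * R) ^ excessOrder s * (‖a j‖ * jap j) := by ring
    _ ≤ 2 * (2 * R) ^ excessOrder s * A := by gcongr; exact hA j
    _ = _ := by rw [Real.mul_rpow (by norm_num) hR.le]; ring

/-- Far from the diagonal ⟨j⟩ + R ≤ 2R, and the factor (R/⟨j⟩)^ε ≥ 1 buys decay in j beyond order
one, hence summability over j, at the price of R^ε. -/
theorem norm_entry_le_of_lt {s A ε : ℝ} {a : ℤ → ℂ} (hA : ∀ j, ‖a j‖ * jap j ≤ A) (hε : 0 < ε)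
    (k j n : ℤ) (h : jap j < latticeWeight (k - j, j - n)) :
    jap k ^ (s + 1) * jap n ^ (-s) * ‖a j‖ ≤
      2 * 2 ^ excessOrder s * A * jap j ^ (-(1 + ε)) *
        latticeWeight (k - j, j - n) ^ (excessOrder s + 1 + ε) := by
  have h1 := jap_mul_jap_le s k j n
  set R := latticeWeight (k - j, j - n)
  have hR : 0 < R := latticeWeight_pos _
  have hj := jap_pos j
  have hA0 : 0 ≤ A := le_trans (by positivity) (hA j)
  have h2 : ‖a j‖ ≤ A * jap j ^ (-(1 + ε)) * R ^ ε := by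
    have h3 : jap j ^ (-(1 + ε)) = (jap j)⁻¹ * (jap j ^ ε)⁻¹ := by
      rw [Real.rpow_neg hj.le, Real.rpow_add hj, Real.rpow_one, mul_inv]
    have h4 : ‖a j‖ ≤ A * (jap j)⁻¹ := by
      rw [← div_eq_mul_inv, le_div_iff₀ hj]
      exact hA j
    have h5 : 1 ≤ (jap j ^ ε)⁻¹ * R ^ ε := by
      rw [inv_mul_eq_div, one_le_div (by positivity)]
      exact Real.rpow_le_rpow hj.le h.le hε.le
    rw [h3]
    calc ‖a j‖ ≤ A * (jap j)⁻¹ := h4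
      _ ≤ A * (jap j)⁻¹ * ((jap j ^ ε)⁻¹ * R ^ ε) :=
          le_mul_of_one_le_right (by positivity) h5
      _ = _ := by ring
  calc jap k ^ (s + 1) * jap n ^ (-s) * ‖a j‖
      ≤ (2 * R) ^ excessOrder s * (jap j + R) * (A * jap j ^ (-(1 + ε)) * R ^ ε) := by gcongr
    _ ≤ (2 * R) ^ excessOrder s * (R + R) * (A * jap j ^ (-(1 + ε)) * R ^ ε) := by gcongr
    _ = _ := by
        rw [Real.mul_rpow (by norm_num) hR.le, Real.rpow_add hR, Real.rpow_add hR, Real.rpow_one]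
        ring

/-- The operator on `ℓ²(ℤ)` whose matrix is that of a periodic integral operator with kernel
`a(θ - φ) Φ(θ, φ)`, conjugated to act from `H^s` to `H^{s+1}`; here `a` has Fourier coefficients
of order `-1`, and `σ` are the Fourier coefficients of `Φ`. -/
theorem exists_matrix_operator (s τ : ℝ) (hτ : excessOrder s + 1 < τ) :
    ∃ C : ℝ, 0 ≤ C ∧ ∀ (σ : ℤ × ℤ → ℂ) (a : ℤ → ℂ) (A W : ℝ), 0 ≤ W →
      (∀ j, ‖a j‖ * jap j ≤ A) →
      (Summable fun x => (latticeWeight x ^ τ * ‖σ x‖) ^ 2) →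
      ∑' x, (latticeWeight x ^ τ * ‖σ x‖) ^ 2 ≤ W ^ 2 →
      Summable σ ∧
      ∃ K : EllTwo ℤ →L[ℂ] EllTwo ℤ, ‖K‖ ≤ C * A * W ∧
        ((Summable fun j => (‖a j‖ * jap j) ^ 2) → IsCompactOperator K) ∧
        ∀ (c : EllTwo ℤ) (B : ℝ), (∀ n, jap n ^ (-s) * ‖c n‖ ≤ B) → ∀ k,
          K c k = ((jap k ^ (s + 1) : ℝ) : ℂ) * ∑' x : ℤ × ℤ,
            σ x * a (k - x.1) * (((jap (k - x.1 - x.2) ^ (-s) : ℝ) : ℂ) *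
              c (k - x.1 - x.2)) := by
  classical
  set μ := excessOrder s with hμ
  have hμ0 : 0 ≤ μ := (le_max_right _ _).trans (le_max_left _ _)
  -- The surplus `ε` is used twice: it makes R^{-(1+ε)} square summable over the lattice, and
  -- ⟨j⟩^{-(1+ε)} summable over the integers.
  obtain ⟨ε, hε⟩ : ∃ ε, ε = τ - 1 - μ := ⟨_, rfl⟩
  have hε0 : 0 < ε := by linarith
  have hτε : τ = μ + 1 + ε := by linarith
  set D := Real.sqrt (∑' x : ℤ × ℤ, (latticeWeight x ^ (-(1 + ε))) ^ 2) with hD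
  set S := ∑' j : ℤ, jap j ^ (-(1 + ε)) with hS
  have hjs := summable_jap_rpow (r := 1 + ε) (by linarith)
  have hS0 : 0 ≤ S := tsum_nonneg fun j => by have := jap_pos j; positivity
  have hC0 : (0 : ℝ) ≤ 2 * 2 ^ μ := by positivity
  refine ⟨2 * 2 ^ μ * D + 2 * 2 ^ μ * S, by positivity, ?_⟩
  intro σ a A W hW hA hσs hσW
  have hA0 : 0 ≤ A := le_trans (by have := jap_pos 0; positivity) (hA 0)
  -- absolute summability of the symbol
  have hfin : ∀ F : Finset (ℤ × ℤ), ∑ x ∈ F, ‖σ x‖ * latticeWeight x ^ μ ≤ D * W := by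
    intro F
    have h1 : ∀ x, ‖σ x‖ * latticeWeight x ^ μ =
        latticeWeight x ^ (-(1 + ε)) * (latticeWeight x ^ τ * ‖σ x‖) := fun x => by
      have hR := latticeWeight_pos x
      rw [← mul_assoc, ← Real.rpow_add hR, hτε]
      rw [show -(1 + ε) + (μ + 1 + ε) = μ by ring, mul_comm]
    simp only [h1]
    refine sum_mul_le_of_sq_le F _ _ _ _ (Real.sqrt_nonneg _) hW ?_ ?_
    · rw [hD, Real.sq_sqrt (tsum_nonneg fun x => by positivity)]
      exact (summable_latticeWeight_rpow hε0).sum_le_tsum F fun x _ => by positivity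
    · exact (hσs.sum_le_tsum F fun x _ => by positivity).trans hσW
  have hμnn : ∀ x, 0 ≤ ‖σ x‖ * latticeWeight x ^ μ := fun x => by
    have hR := latticeWeight_pos x
    positivity
  have hσμ : Summable fun x => ‖σ x‖ * latticeWeight x ^ μ :=
    summable_of_sum_le hμnn hfin
  have hσμ' : ∑' x, ‖σ x‖ * latticeWeight x ^ μ ≤ D * W :=
    Real.tsum_le_of_sum_le hμnn hfin
  have hσ1 : Summable fun x => ‖σ x‖ :=
    Summable.of_nonneg_of_le (fun x => norm_nonneg _)
      (fun x => le_mul_of_one_le_right (norm_nonneg _)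
        (Real.one_le_rpow (one_le_latticeWeight x) hμ0)) hσμ
  refine ⟨hσ1.of_norm, ?_⟩
  -- the part near the diagonal
  let ω : ℤ × ℤ → ℤ → ℂ := fun x k => if latticeWeight x ≤ jap (k - x.1) then
    σ x * (((jap k ^ (s + 1) * jap (k - x.1 - x.2) ^ (-s) : ℝ) : ℂ) * a (k - x.1)) else 0
  have hpath : ∀ (x : ℤ × ℤ) (k : ℤ), (k - (k - x.1), k - x.1 - (k - x.1 - x.2)) = x :=
    fun x k => by ext <;> simp
  have hωn : ∀ x k, ‖ω x k‖ ≤ 2 * 2 ^ μ * A * (‖σ x‖ * latticeWeight x ^ μ) := by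
    intro x k
    have hR := latticeWeight_pos x
    by_cases h : latticeWeight x ≤ jap (k - x.1)
    · have h1 := norm_entry_le_of_le (s := s) hA k (k - x.1) (k - x.1 - x.2)
        (by rw [hpath]; exact h)
      rw [hpath] at h1
      have := jap_pos k
      have := jap_pos (k - x.1 - x.2)
      simp only [ω, h, if_true]
      rw [norm_mul_ofReal_mul _ _ (by positivity) (by positivity)]
      calc _ ≤ ‖σ x‖ * (2 * 2 ^ μ * A * latticeWeight x ^ μ) := by gcongr
        _ = _ := by ring
    · simp only [ω, h, if_false, norm_zero]
      have := hμnn x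
      positivity
  have hinj : ∀ x : ℤ × ℤ, Function.Injective fun k : ℤ => k - x.1 - x.2 := fun x k l h => by
    simpa using h
  -- For a fixed frequency `x` the entries lie on the single diagonal n = k - x₁ - x₂, so the norm
  -- is the supremum of the weights and no smallness along the diagonal is needed.
  choose T hT hTn using fun x => EllTwo.exists_weightedComp (ω x) (fun k => k - x.1 - x.2)
    (hinj x).injOn _ (mul_nonneg (mul_nonneg hC0 hA0) (hμnn x)) (hωn x)
  have hTs : Summable fun x => ‖T x‖ :=
    Summable.of_nonneg_of_le (fun x => norm_nonneg _) hTn (hσμ.mul_left _)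
  have hT1 : HasSum T (∑' x, T x) := hTs.of_norm.hasSum
  have hT1n : ‖∑' x, T x‖ ≤ 2 * 2 ^ μ * A * (D * W) := by
    refine (norm_tsum_le_tsum_norm hTs).trans ?_
    refine (hTs.tsum_le_tsum hTn (hσμ.mul_left _)).trans ?_
    rw [tsum_mul_left]
    gcongr
  -- the part far from the diagonal
  let H : ℤ → ℤ → ℤ → ℂ := fun j k n => if jap j < latticeWeight (k - j, j - n) then
    σ (k - j, j - n) * (((jap k ^ (s + 1) * jap n ^ (-s) : ℝ) : ℂ) * a j) else 0
  have hHn : ∀ j (y : ℤ × ℤ), ‖H j y.1 y.2‖ ^ 2 ≤ (2 * 2 ^ μ * A * jap j ^ (-(1 + ε))) ^ 2 *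
      (latticeWeight (throughEquiv j y) ^ τ * ‖σ (throughEquiv j y)‖) ^ 2 := by
    rintro j ⟨k, n⟩
    rw [← mul_pow]
    have hR := latticeWeight_pos (throughEquiv j (k, n))
    have hj := jap_pos j
    gcongr
    by_cases h : jap j < latticeWeight (k - j, j - n)
    · have h1 := norm_entry_le_of_lt (s := s) hA hε0 k j n h
      rw [← hμ, ← hτε] at h1
      have := jap_pos k
      have := jap_pos n
      simp only [H, h, if_true]
      rw [norm_mul_ofReal_mul _ _ (by positivity) (by positivity)]
      calc _ ≤ ‖σ (k - j, j - n)‖ * (2 * 2 ^ μ * A * jap j ^ (-(1 + ε)) *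
            latticeWeight (k - j, j - n) ^ τ) := by gcongr
        _ = _ := by
            change _ = 2 * 2 ^ μ * A * jap j ^ (-(1 + ε)) *
              (latticeWeight (k - j, j - n) ^ τ * ‖σ (k - j, j - n)‖)
            ring
    · simp only [H, h, if_false, norm_zero]
      positivity
  have hth : ∀ j, Summable fun y => (latticeWeight (throughEquiv j y) ^ τ *
      ‖σ (throughEquiv j y)‖) ^ 2 := fun j => (throughEquiv j).summable_iff.2 hσs
  have hHs : ∀ j, Summable fun y : ℤ × ℤ => ‖H j y.1 y.2‖ ^ 2 := fun j =>
    Summable.of_nonneg_of_le (fun y => by positivity) (hHn j) ((hth j).mul_left _)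
  have hHle : ∀ j, ∑' y : ℤ × ℤ, ‖H j y.1 y.2‖ ^ 2 ≤
      (2 * 2 ^ μ * A * jap j ^ (-(1 + ε)) * W) ^ 2 := fun j => by
    refine ((hHs j).tsum_le_tsum (hHn j) ((hth j).mul_left _)).trans ?_
    rw [tsum_mul_left, mul_pow _ W]
    gcongr
    rw [(throughEquiv j).tsum_eq fun x => (latticeWeight x ^ τ * ‖σ x‖) ^ 2]
    exact hσW
  -- For a fixed `j` the pairs (k-j, j-n) run once through all frequencies, so the Hilbert–Schmidt
  -- norm is controlled by `W` times a factor that is summable in `j`.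
  choose Q hQ hQn hQc using fun j => EllTwo.exists_hilbertSchmidt (H j) _
    (by have := jap_pos j; positivity) (hHs j) (hHle j)
  have hQb : Summable fun j => 2 * 2 ^ μ * A * jap j ^ (-(1 + ε)) * W :=
    (hjs.mul_left _).mul_right _
  have hQs : Summable fun j => ‖Q j‖ :=
    Summable.of_nonneg_of_le (fun j => norm_nonneg _) hQn hQb
  have hQ1 : HasSum Q (∑' j, Q j) := hQs.of_norm.hasSum
  have hQ1n : ‖∑' j, Q j‖ ≤ 2 * 2 ^ μ * A * S * W := by
    refine (norm_tsum_le_tsum_norm hQs).trans ?_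
    refine (hQs.tsum_le_tsum hQn hQb).trans (le_of_eq ?_)
    rw [tsum_mul_right, tsum_mul_left]
  refine ⟨(∑' x, T x) + ∑' j, Q j, ?_, ?_, ?_⟩
  · refine (norm_add_le _ _).trans ((add_le_add hT1n hQ1n).trans (le_of_eq ?_))
    ring
  · intro ha
    refine IsCompactOperator.add ?_ (isCompactOperator_tsum hQ1 hQc)
    refine isCompactOperator_tsum hT1 fun x => ?_
    -- For compactness of each weighted shift, its weights are compared with ‖a j‖⟨j⟩ rather than
    -- with the upper bound `A`; they are then square summable, and the shift is itself
    -- Hilbert–Schmidt.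
    have hR := latticeWeight_pos x
    have hω2 : ∀ k, ‖ω x k‖ ≤
        2 * 2 ^ μ * (‖σ x‖ * latticeWeight x ^ μ) * (‖a (k - x.1)‖ * jap (k - x.1)) := by
      intro k
      have hj := jap_pos (k - x.1)
      by_cases h : latticeWeight x ≤ jap (k - x.1)
      · have h1 := jap_mul_jap_le s k (k - x.1) (k - x.1 - x.2)
        rw [hpath] at h1
        have := jap_pos k
        have := jap_pos (k - x.1 - x.2)
        simp only [ω, h, if_true]
        rw [norm_mul_ofReal_mul _ _ (by positivity) (by positivity)]
        calc _ ≤ ‖σ x‖ * ((2 * latticeWeight x) ^ μ * (jap (k - x.1) + jap (k - x.1)) *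
              ‖a (k - x.1)‖) := by
              have h3 := h1.trans (mul_le_mul_of_nonneg_left (add_le_add_right h (jap (k - x.1)))
                (by positivity))
              exact mul_le_mul_of_nonneg_left (mul_le_mul_of_nonneg_right h3 (norm_nonneg _))
                (norm_nonneg _)
          _ = _ := by
              rw [Real.mul_rpow (by norm_num) hR.le]
              ring
      · simp only [ω, h, if_false, norm_zero]
        positivity
    let G : ℤ → ℤ → ℂ := fun k n => if n = k - x.1 - x.2 then ω x k else 0
    have hsum : Summable fun k => ‖ω x k‖ ^ 2 := by
      have h2 := ((Equiv.subRight x.1).summable_iff.2 ha).mul_left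
        ((2 * 2 ^ μ * (‖σ x‖ * latticeWeight x ^ μ)) ^ 2)
      refine Summable.of_nonneg_of_le (fun k => by positivity) (fun k => ?_) h2
      rw [Function.comp, ← mul_pow]
      gcongr
      exact hω2 k
    have hGs : Summable fun y : ℤ × ℤ => ‖G y.1 y.2‖ ^ 2 := by
      refine (summable_prod_of_nonneg fun y => by positivity).2 ⟨fun k => ?_, ?_⟩
      · refine summable_of_ne_finset_zero (s := {k - x.1 - x.2}) fun n hn => ?_
        have : n ≠ k - x.1 - x.2 := by simpa using hn
        simp [G, this]
      · refine hsum.congr fun k => ?_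
        rw [tsum_eq_single (k - x.1 - x.2) fun n hn => by simp [G, hn]]
        simp [G]
    obtain ⟨P, hP, -, hPc⟩ := EllTwo.exists_hilbertSchmidt G _ (Real.sqrt_nonneg _) hGs
      (le_of_eq (Real.sq_sqrt (tsum_nonneg fun y => by positivity)).symm)
    have hPT : P = T x := by
      ext c k
      rw [hT]
      refine (hP c k).unique ?_
      have := hasSum_single (f := fun n => G k n * c n) (k - x.1 - x.2)
        fun n hn => by simp [G, hn]
      simpa [G] using this
    rw [← hPT]
    exact hPc
  -- For a general `c` in ℓ² the unweighted sequence may grow when s < 0. The bound `B` makes the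
  -- double series absolutely convergent; it is available because Fourier coefficients of integrable
  -- functions are bounded.
  · intro c B hB k
    have hev1 : HasSum (fun x => T x c k) ((∑' x, T x) c k) :=
      ((hT1.mapL (ContinuousLinearMap.apply ℂ (EllTwo ℤ) c)).mapL
        (lp.evalCLM ℂ (fun _ : ℤ => ℂ) 2 k))
    have hev2 : HasSum (fun j => Q j c k) ((∑' j, Q j) c k) :=
      ((hQ1.mapL (ContinuousLinearMap.apply ℂ (EllTwo ℤ) c)).mapL
        (lp.evalCLM ℂ (fun _ : ℤ => ℂ) 2 k))
    let g : ℤ × ℤ → ℂ := fun x => ((jap k ^ (s + 1) : ℝ) : ℂ) * (σ x * a (k - x.1) *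
      (((jap (k - x.1 - x.2) ^ (-s) : ℝ) : ℂ) * c (k - x.1 - x.2)))
    have hg : Summable g := by
      refine Summable.mul_left _ ?_
      refine Summable.of_norm_bounded (g := fun x => ‖σ x‖ * (A * B)) (hσ1.mul_right _) fun x => ?_
      have h1 : ‖a (k - x.1)‖ ≤ A :=
        (le_mul_of_one_le_right (norm_nonneg _) (one_le_jap _)).trans (hA _)
      have h2 := jap_pos (k - x.1 - x.2)
      rw [norm_mul, norm_mul, norm_mul, Complex.norm_real, Real.norm_eq_abs,
        abs_of_nonneg (by positivity), mul_assoc]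
      gcongr
      exact hB _
    have hg1 : (fun x => T x c k) = {x : ℤ × ℤ | latticeWeight x ≤ jap (k - x.1)}.indicator g := by
      funext x
      rw [hT]
      by_cases h : latticeWeight x ≤ jap (k - x.1)
      · simp only [ω, g, h, if_true, indicator, mem_ofPred_eq]
        push_cast
        ring
      · simp [ω, h, indicator]
    have hg2 : HasSum ({x : ℤ × ℤ | latticeWeight x ≤ jap (k - x.1)}ᶜ.indicator g)
        ((∑' j, Q j) c k) := by
      have hs2 := hg.indicator {x : ℤ × ℤ | latticeWeight x ≤ jap (k - x.1)}ᶜ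
      -- The far operators are summed over `j` and then `n`; reindexing by (j, n) identifies this
      -- iterated sum with the far part of the sum over frequencies.
      have hs3 := (pathEquiv k).hasSum_iff.2 hs2.hasSum
      have hs5 : HasSum (fun j => Q j c k)
          (∑' x, ({x : ℤ × ℤ | latticeWeight x ≤ jap (k - x.1)}ᶜ.indicator g) x) := by
        refine hs3.prod_fiberwise fun j => ?_
        refine (hQ j c k).congr_fun fun n => ?_
        by_cases h : jap j < latticeWeight (k - j, j - n)
        · have h' : ¬ latticeWeight (k - j, j - n) ≤ jap j := not_le.2 h
          simp only [H, g, h, if_true, indicator, mem_compl_iff, mem_ofPred_eq, pathEquiv,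
            Function.comp, Equiv.coe_fn_mk, sub_sub_cancel, h', not_false_iff]
          push_cast
          ring
        · have h' : latticeWeight (k - j, j - n) ≤ jap j := not_lt.1 h
          simp [H, h, indicator, pathEquiv, h']
      rw [hev2.unique hs5]
      exact hs2.hasSum
    rw [hg1] at hev1
    have h3 := hev1.add hg2
    rw [← tsum_mul_left]
    have h4 : (fun x => ({x : ℤ × ℤ | latticeWeight x ≤ jap (k - x.1)}.indicator g) x +
        ({x : ℤ × ℤ | latticeWeight x ≤ jap (k - x.1)}ᶜ.indicator g) x) = g := by
      funext x
      exact congrFun (indicator_self_add_compl _ g) x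
    rw [h4] at h3
    rw [add_apply, lp.coeFn_add, Pi.add_apply]
    exact h3.tsum_eq.symm

/-! ### Operators between the spaces of Sobolev type -/

theorem exists_coeff_eq {ι : Type} {b : ι → ℝ → ℂ} (hb : LinearIndependent ℂ b) (c : ι → ℂ) :
    ∃ U : DistribOn b, coeff b U = c := by
  refine ⟨(Module.Basis.span hb).constr ℂ c, ?_⟩
  funext n
  have h : (⟨b n, Submodule.subset_span (mem_range_self n)⟩ : TestSpace b) =
      Module.Basis.span hb n := (Module.Basis.span_apply hb n).symm
  change (Module.Basis.span hb).constr ℂ c ⟨b n, _⟩ = c n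
  rw [h, Module.Basis.constr_basis]

theorem sobolev_weight_pos (x s : ℝ) : 0 < (1 + x ^ 2) ^ (s / 2) := by positivity

/-- Linear independence of the test functions lets a distribution have any prescribed coefficients,
so the space is all of ℓ² up to the weight. -/
theorem sobolevToLp_surjective {ι : Type} {b : ι → ℝ → ℂ} (hb : LinearIndependent ℂ b)
    (d : ι → ℝ) (s : ℝ) : Function.Surjective (sobolevToLp b d s) := by
  intro c
  obtain ⟨U, hU⟩ := exists_coeff_eq hb fun n => (((1 + d n ^ 2) ^ (s / 2) : ℝ) : ℂ)⁻¹ * c n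
  have h : weightedCoeff b d s U = c := by
    funext n
    have h2 : (((1 + d n ^ 2) ^ (s / 2) : ℝ) : ℂ) ≠ 0 := by
      exact_mod_cast (sobolev_weight_pos (d n) s).ne'
    change (((1 + d n ^ 2) ^ (s / 2) : ℝ) : ℂ) * coeff b U n = c n
    rw [hU, mul_inv_cancel_left₀ h2]
  have hm : Memℓp (weightedCoeff b d s U) 2 := by
    rw [h]
    exact c.2
  exact ⟨⟨U, hm⟩, Subtype.ext h⟩

/-- `sobolevToLp` as a linear isometry. -/
noncomputable def sobolevIsometry {ι : Type} (b : ι → ℝ → ℂ) (d : ι → ℝ) (s : ℝ) :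
    sobolev b d s →ₗᵢ[ℂ] EllTwo ι where
  toLinearMap := sobolevToLp b d s
  norm_map' _ := rfl

theorem sobolevIsometry_apply {ι : Type} (b : ι → ℝ → ℂ) (d : ι → ℝ) (s : ℝ)
    (U : sobolev b d s) (n : ι) :
    sobolevIsometry b d s U n = (((1 + d n ^ 2) ^ (s / 2) : ℝ) : ℂ) * coeff b U.1 n := rfl

/-- An operator on the sequence spaces defines an operator on the spaces of Sobolev type. -/
theorem exists_sobolev_operator {ι ι' : Type} {b : ι → ℝ → ℂ} {b' : ι' → ℝ → ℂ}
    (hb' : LinearIndependent ℂ b') (d : ι → ℝ) (d' : ι' → ℝ) (s s' : ℝ)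
    (K : EllTwo ι →L[ℂ] EllTwo ι') :
    ∃ A : sobolev b d s →L[ℂ] sobolev b' d' s',
      (∀ U k, (((1 + d' k ^ 2) ^ (s' / 2) : ℝ) : ℂ) * coeff b' (A U).1 k =
        K (sobolevIsometry b d s U) k) ∧
      ‖A‖ ≤ ‖K‖ ∧ (IsCompactOperator K → IsCompactOperator A) := by
  let e : sobolev b' d' s' ≃ₗᵢ[ℂ] EllTwo ι' :=
    LinearIsometryEquiv.ofSurjective (sobolevIsometry b' d' s') (sobolevToLp_surjective hb' d' s')
  let A : sobolev b d s →L[ℂ] sobolev b' d' s' :=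
    (e.symm.toContinuousLinearEquiv : EllTwo ι' →L[ℂ] sobolev b' d' s').comp
      (K.comp (sobolevIsometry b d s).toContinuousLinearMap)
  refine ⟨A, fun U k => ?_, ?_, fun hK => ?_⟩
  · have h : e (A U) = K (sobolevIsometry b d s U) := e.apply_symm_apply _
    rw [← h]
    rfl
  · refine ContinuousLinearMap.opNorm_le_bound _ (norm_nonneg _) fun U => ?_
    have h : ‖A U‖ = ‖K (sobolevIsometry b d s U)‖ := e.symm.norm_map _
    rw [h, ← (sobolevIsometry b d s).norm_map U]
    exact K.le_opNorm _
  · exact (hK.comp_clm (sobolevIsometry b d s).toContinuousLinearMap).clm_comp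
      (e.symm.toContinuousLinearEquiv : EllTwo ι' →L[ℂ] sobolev b' d' s')

theorem represents_of_basis {ι : Type} {b : ι → ℝ → ℂ} {I : Set ℝ} {u : ℝ → ℂ} {U : DistribOn b}
    (h : ∀ n, IntegrableOn (fun t => u t * b n t) I ∧ coeff b U n = ∫ t in I, u t * b n t) :
    Represents I u U := by
  rintro ⟨φ, hφ⟩
  induction hφ using Submodule.span_induction with
  | mem x hx =>
    obtain ⟨n, rfl⟩ := hx
    exact h n
  | zero =>
    have h0 : (⟨0, Submodule.zero_mem _⟩ : TestSpace b) = 0 := rfl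
    rw [h0, map_zero]
    simp
  | add x y hx hy h1 h2 =>
    have h0 : (⟨x + y, Submodule.add_mem _ hx hy⟩ : TestSpace b) = ⟨x, hx⟩ + ⟨y, hy⟩ := rfl
    have h3 : (fun t => u t * (x + y) t) = fun t => u t * x t + u t * y t := by
      funext t
      simp [mul_add]
    constructor
    · change IntegrableOn (fun t => u t * (x + y) t) I
      rw [h3]
      exact h1.1.add h2.1
    · change _ = ∫ t in I, u t * (x + y) t
      rw [h3, h0, map_add, h1.2, h2.2]
      exact (integral_add h1.1 h2.1).symm
  | smul a x hx h1 =>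
    have h0 : (⟨a • x, Submodule.smul_mem _ a hx⟩ : TestSpace b) = a • ⟨x, hx⟩ := rfl
    have h3 : (fun t => u t * (a • x) t) = fun t => a * (u t * x t) := by
      funext t
      simp only [Pi.smul_apply, smul_eq_mul]
      ring
    constructor
    · change IntegrableOn (fun t => u t * (a • x) t) I
      rw [h3]
      exact h1.1.const_mul a
    · change _ = ∫ t in I, u t * (a • x) t
      rw [h3, h0, map_smul, h1.2, integral_const_mul, smul_eq_mul]

theorem Represents.coeff_eq {ι : Type} {b : ι → ℝ → ℂ} {I : Set ℝ} {u : ℝ → ℂ} {U : DistribOn b}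
    (h : Represents I u U) (n : ι) :
    IntegrableOn (fun t => u t * b n t) I ∧ coeff b U n = ∫ t in I, u t * b n t :=
  h ⟨b n, Submodule.subset_span (mem_range_self n)⟩

/-- If every test function of `b'` is a combination of two test functions of `b`, restriction of
functionals is a bounded map between the spaces of Sobolev type. -/
theorem exists_restriction {b b' : ℕ → ℝ → ℂ} (s B : ℝ) (hB : 0 ≤ B) (x y : ℕ → ℂ) (ρ : ℕ → ℕ)
    (hρ : InjOn ρ {n | y n ≠ 0}) (hb : ∀ n t, b' n t = x n * b n t + y n * b (ρ n) t)
    (hx : ∀ n, ‖x n‖ ≤ B)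
    (hy : ∀ n, ‖y n‖ * ((1 + (n : ℝ) ^ 2) ^ (s / 2) / (1 + (ρ n : ℝ) ^ 2) ^ (s / 2)) ≤ B) :
    ∃ J : sobolev b (fun n => (n : ℝ)) s →L[ℂ] sobolev b' (fun n => (n : ℝ)) s,
      ‖J‖ ≤ 2 * B ∧ ∀ I u U, Represents I u U.1 → Represents I u (J U).1 := by
  have hle : TestSpace b' ≤ TestSpace b := by
    refine Submodule.span_le.2 ?_
    rintro _ ⟨n, rfl⟩
    have h : b' n = x n • b n + y n • b (ρ n) := by
      funext t
      simp [hb]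
    rw [h]
    exact Submodule.add_mem _
      (Submodule.smul_mem _ _ (Submodule.subset_span (mem_range_self _)))
      (Submodule.smul_mem _ _ (Submodule.subset_span (mem_range_self _)))
  let res : DistribOn b →ₗ[ℂ] DistribOn b' := (Submodule.inclusion hle).dualMap
  have hres : ∀ U n, coeff b' (res U) n = x n * coeff b U n + y n * coeff b U (ρ n) := by
    intro U n
    have h : Submodule.inclusion hle ⟨b' n, Submodule.subset_span (mem_range_self n)⟩ =
        x n • (⟨b n, Submodule.subset_span (mem_range_self n)⟩ : TestSpace b) +
        y n • (⟨b (ρ n), Submodule.subset_span (mem_range_self _)⟩ : TestSpace b) := by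
      apply Subtype.ext
      funext t
      exact hb n t
    change U (Submodule.inclusion hle ⟨b' n, _⟩) = _
    rw [h, map_add, map_smul, map_smul]
    rfl
  let w : ℕ → ℝ := fun n => (1 + (n : ℝ) ^ 2) ^ (s / 2)
  have hw : ∀ n, 0 < w n := fun n => sobolev_weight_pos n s
  -- In weighted coordinates the restriction is a diagonal operator plus a weighted composition with
  -- `ρ`; only the latter sees the ratio of the weights at `n` and `ρ n`.
  obtain ⟨D₁, hD₁, hD₁n⟩ := EllTwo.exists_weightedComp x id Function.injective_id.injOn B hB hx
  obtain ⟨D₂, hD₂, hD₂n⟩ := EllTwo.exists_weightedComp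
    (fun n => y n * ((w n / w (ρ n) : ℝ) : ℂ)) ρ
    (fun n hn k hk h => hρ (fun h0 => hn (by simp [h0])) (fun h0 => hk (by simp [h0])) h) B hB
    (fun n => by
      rw [norm_mul, Complex.norm_real, Real.norm_eq_abs,
        abs_of_pos (div_pos (hw n) (hw _))]
      exact hy n)
  let iso := sobolevIsometry b (fun n => (n : ℝ)) s
  have hwc : ∀ U : sobolev b (fun n => (n : ℝ)) s,
      weightedCoeff b' (fun n => (n : ℝ)) s (res U.1) = ((D₁ + D₂) (iso U) : EllTwo ℕ) := by
    intro U
    funext n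
    rw [add_apply, lp.coeFn_add, Pi.add_apply, hD₁, hD₂]
    change ((w n : ℝ) : ℂ) * coeff b' (res U.1) n = x n * (((w n : ℝ) : ℂ) * coeff b U.1 n) +
      y n * ((w n / w (ρ n) : ℝ) : ℂ) * (((w (ρ n) : ℝ) : ℂ) * coeff b U.1 (ρ n))
    have h2 : ((w (ρ n) : ℝ) : ℂ) ≠ 0 := by exact_mod_cast (hw (ρ n)).ne'
    rw [hres]
    push_cast
    field_simp
  have hmem : ∀ U : sobolev b (fun n => (n : ℝ)) s,
      res U.1 ∈ sobolev b' (fun n => (n : ℝ)) s := fun U => by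
    change Memℓp (weightedCoeff b' (fun n => (n : ℝ)) s (res U.1)) 2
    rw [hwc]
    exact lp.memℓp _
  let J : sobolev b (fun n => (n : ℝ)) s →ₗ[ℂ] sobolev b' (fun n => (n : ℝ)) s :=
    (res.comp (Submodule.subtype _)).codRestrict _ hmem
  have hJ : ∀ U, ‖J U‖ ≤ 2 * B * ‖U‖ := by
    intro U
    have h1 : sobolevToLp b' (fun n => (n : ℝ)) s (J U) = (D₁ + D₂) (iso U) := Subtype.ext (hwc U)
    have h2 : ‖J U‖ = ‖(D₁ + D₂) (iso U)‖ := by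
      rw [← h1]
      rfl
    rw [h2, ← iso.norm_map U]
    refine ((D₁ + D₂).le_opNorm _).trans ?_
    gcongr
    exact (norm_add_le _ _).trans (by linarith)
  refine ⟨J.mkContinuous _ hJ, J.mkContinuous_norm_le (by positivity) hJ, fun I u U h φ => ?_⟩
  exact h (Submodule.inclusion hle φ)

/-! ### Restriction from `U^s` to `T^s` and from `W^s` to `Y^s` -/

theorem rpow_div_rpow_le {x y c : ℝ} (hx : 0 < x) (hy : 0 < y) (hxy : x ≤ c * y)
    (hyx : y ≤ c * x) (r : ℝ) : x ^ r / y ^ r ≤ c ^ |r| := by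
  rw [← Real.div_rpow hx.le hy.le]
  rcases le_or_gt 0 r with hr | hr
  · rw [abs_of_nonneg hr]
    exact Real.rpow_le_rpow (by positivity) ((div_le_iff₀ hy).2 hxy) hr
  · rw [abs_of_neg hr]
    have h : (x / y) ^ r = (y / x) ^ (-r) := by
      rw [← inv_div, Real.inv_rpow (by positivity), Real.rpow_neg (by positivity)]
    rw [h]
    exact Real.rpow_le_rpow (by positivity) ((div_le_iff₀ hx).2 hyx) (by linarith)

theorem sqrt_two_div_pi : Real.sqrt (2 / Real.pi) = Real.sqrt 2 * Real.sqrt (1 / Real.pi) := by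
  rw [← Real.sqrt_mul (by norm_num)]
  congr 1
  ring

theorem sqrt_two_mul_half : Real.sqrt 2 * (Real.sqrt 2 / 2) = 1 := by
  have := Real.mul_self_sqrt (show (0 : ℝ) ≤ 2 by norm_num)
  linarith

theorem norm_sqrt_two_half_le : ‖((Real.sqrt 2 / 2 : ℝ) : ℂ)‖ ≤ 1 := by
  rw [Complex.norm_real, Real.norm_eq_abs, abs_of_nonneg (by positivity)]
  have := Real.sqrt_le_sqrt (show (2 : ℝ) ≤ 4 by norm_num)
  rw [show (4 : ℝ) = 2 ^ 2 by norm_num, Real.sqrt_sq (by norm_num)] at this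
  linarith

/-- This is 2T_n = U_n - U_{n-2} with the normalizations inserted. The √2/2 comes from the different
normalization of T_0, and for n < 2 the coefficient 0 makes the truncated index n - 2 harmless. -/
theorem chebT_eq_chebU (n : ℕ) (t : ℝ) :
    chebT n t = (if n = 0 then Real.sqrt 2 / 2 else 1 / 2) * chebU n t +
      (if n < 2 then 0 else -(1 / 2)) * chebU (n - 2) t := by
  match n with
  | 0 =>
    simp only [chebT, chebU, if_true, sqrt_two_div_pi]
    simp
    linear_combination (-(Real.sqrt Real.pi)⁻¹) * sqrt_two_mul_half
  | 1 =>
    simp [chebT, chebU]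
    ring
  | k + 2 =>
    have h := congrArg (Polynomial.eval t) (Polynomial.Chebyshev.two_mul_T_eq_U_sub_U ℝ (k : ℤ))
    simp only [Polynomial.eval_mul, Polynomial.eval_sub, Polynomial.eval_ofNat] at h
    simp only [chebT, chebU, Nat.add_eq_zero_iff, OfNat.ofNat_ne_zero, and_false, if_false,
      Nat.add_sub_cancel]
    rw [if_neg (by omega)]
    push_cast
    linear_combination (Real.sqrt (2 / Real.pi) / 2) * h

/-- Writing w = w²w⁻¹ with w² = 1 - t² reduces this to 2(1-t²)U_n = T_n - T_{n+2}. Where 1 - t² ≤ 0,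
both w and its inverse are 0 by convention, so both sides vanish. -/
theorem chebU_mul_weight_eq (n : ℕ) (t : ℝ) :
    chebU n t * chebWeight t =
      (if n = 0 then Real.sqrt 2 / 2 else 1 / 2) * (chebT n t * (chebWeight t)⁻¹) +
      (-(1 / 2)) * (chebT (n + 2) t * (chebWeight t)⁻¹) := by
  by_cases ht : 0 < 1 - t ^ 2
  · have hw : 0 < chebWeight t := Real.sqrt_pos.2 ht
    have hw2 : chebWeight t * chebWeight t = 1 - t ^ 2 := Real.mul_self_sqrt ht.le
    have h := congrArg (Polynomial.eval t)
      (Polynomial.Chebyshev.one_sub_X_sq_mul_U_eq_pol_in_T ℝ (n : ℤ))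
    have h' := congrArg (Polynomial.eval t) (Polynomial.Chebyshev.T_add_two ℝ (n : ℤ))
    simp only [Polynomial.eval_mul, Polynomial.eval_sub, Polynomial.eval_one, Polynomial.eval_pow,
      Polynomial.eval_X, Polynomial.eval_ofNat] at h h'
    have key : Real.sqrt (2 / Real.pi) * (Polynomial.Chebyshev.T ℝ n).eval t =
        2 * ((if n = 0 then Real.sqrt 2 / 2 else 1 / 2) * chebT n t) := by
      rcases Nat.eq_zero_or_pos n with rfl | hn
      · simp only [chebT, if_true, sqrt_two_div_pi]
        ring
      · simp only [chebT, hn.ne', if_false]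
        ring
    have e1 : chebU n t * chebWeight t =
        chebU n t * (chebWeight t * chebWeight t) * (chebWeight t)⁻¹ := by
      field_simp
    rw [e1, hw2]
    have e2 : chebU n t * (1 - t ^ 2) = (if n = 0 then Real.sqrt 2 / 2 else 1 / 2) * chebT n t +
        (-(1 / 2)) * chebT (n + 2) t := by
      simp only [chebU]
      rw [show chebT (n + 2) t = Real.sqrt (2 / Real.pi) *
        (Polynomial.Chebyshev.T ℝ ((n : ℤ) + 2)).eval t by simp [chebT]]
      linear_combination (Real.sqrt (2 / Real.pi)) * h - (Real.sqrt (2 / Real.pi) / 2) * h' +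
        (1 / 2) * key
    rw [e2]
    ring
  · have hw : chebWeight t = 0 := Real.sqrt_eq_zero_of_nonpos (not_lt.1 ht)
    simp [hw]

/-- Operators `U^s → Y^{s'}` are obtained from operators `T^s → W^{s'}` with the same kernel. -/
theorem exists_U_operator_of_T_operator (s s' : ℝ) :
    ∃ C : ℝ, 0 ≤ C ∧ ∀ A : SpaceT s →L[ℂ] SpaceW s', ∃ A' : SpaceU s →L[ℂ] SpaceY s',
      ‖A'‖ ≤ C * ‖A‖ ∧ (IsCompactOperator A → IsCompactOperator A') ∧
      ∀ κ, IsIntegralOp arcI κ A → IsIntegralOp arcI κ A' := by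
  have hxn : ∀ n : ℕ, ‖((if n = 0 then Real.sqrt 2 / 2 else 1 / 2 : ℝ) : ℂ)‖ ≤ 1 := by
    intro n
    split_ifs
    · exact norm_sqrt_two_half_le
    · rw [Complex.norm_real]
      norm_num
  -- A shift of the index by 2 changes 1 + n² by a factor of at most 10 in either direction; the
  -- added 1 also covers the diagonal coefficient. The same constant serves for the shift n ↦ n + 2
  -- below.
  obtain ⟨J, hJ, hJr⟩ := exists_restriction (b := famU) (b' := famT) s (10 ^ |s / 2| + 1)
    (by positivity) (fun n => ((if n = 0 then Real.sqrt 2 / 2 else 1 / 2 : ℝ) : ℂ))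
    (fun n => ((if n < 2 then 0 else -(1 / 2) : ℝ) : ℂ)) (fun n => n - 2)
    (by
      intro n hn k hk h
      simp only [mem_ofPred_eq] at hn hk h
      split_ifs at hn hk
      · simp at hn
      · simp at hn
      · simp at hk
      · omega)
    (fun n t => by
      simp only [famT, famU]
      rw [chebT_eq_chebU]
      push_cast
      rfl)
    (fun n => (hxn n).trans (by
      have : (0 : ℝ) ≤ 10 ^ |s / 2| := by positivity
      linarith))
    (fun n => by
      have hp : (0 : ℝ) ≤ 10 ^ |s / 2| := by positivity
      split_ifs with h
      · simp
        linarith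
      · have h2 : ((n - 2 : ℕ) : ℝ) = (n : ℝ) - 2 := by
          rw [Nat.cast_sub (by omega)]
          norm_num
        rw [h2]
        have hn : (2 : ℝ) ≤ n := by exact_mod_cast not_lt.1 h
        have h3 := rpow_div_rpow_le (x := 1 + (n : ℝ) ^ 2) (y := 1 + ((n : ℝ) - 2) ^ 2) (c := 10)
          (by positivity) (by positivity) (by nlinarith [sq_nonneg ((n : ℝ) * 3 - 20 / 3)])
          (by nlinarith) (s / 2)
        rw [Complex.norm_real]
        have h4 : ‖(-(1 / 2) : ℝ)‖ = 1 / 2 := by norm_num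
        rw [h4]
        linarith)
  obtain ⟨J', hJ', hJr'⟩ := exists_restriction (b := famW) (b' := famY) s' (10 ^ |s' / 2| + 1)
    (by positivity) (fun n => ((if n = 0 then Real.sqrt 2 / 2 else 1 / 2 : ℝ) : ℂ))
    (fun _ => ((-(1 / 2) : ℝ) : ℂ)) (fun n => n + 2)
    (by
      intro n _ k _ h
      simpa using h)
    (fun n t => by
      simp only [famY, famW]
      rw [chebU_mul_weight_eq]
      push_cast
      rfl)
    (fun n => (hxn n).trans (by
      have : (0 : ℝ) ≤ 10 ^ |s' / 2| := by positivity
      linarith))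
    (fun n => by
      have hp : (0 : ℝ) ≤ 10 ^ |s' / 2| := by positivity
      have hn : (0 : ℝ) ≤ n := Nat.cast_nonneg n
      push_cast
      have h3 := rpow_div_rpow_le (x := 1 + (n : ℝ) ^ 2) (y := 1 + ((n : ℝ) + 2) ^ 2) (c := 10)
        (by positivity) (by positivity) (by nlinarith)
        (by nlinarith [sq_nonneg ((n : ℝ) * 3 - 2 / 3)]) (s' / 2)
      rw [show ‖(-(1 / 2) : ℂ)‖ = 1 / 2 by norm_num]
      linarith)
  refine ⟨(2 * (10 ^ |s' / 2| + 1)) * (2 * (10 ^ |s / 2| + 1)), by positivity, fun A => ?_⟩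
  refine ⟨J'.comp (A.comp J), ?_, fun hA => (hA.comp_clm J).clm_comp J', fun κ hκ u U hu hU => ?_⟩
  · refine (J'.opNorm_comp_le _).trans ?_
    calc ‖J'‖ * ‖A.comp J‖ ≤ ‖J'‖ * (‖A‖ * ‖J‖) := by
          gcongr
          exact A.opNorm_comp_le _
      _ ≤ (2 * (10 ^ |s' / 2| + 1)) * (‖A‖ * (2 * (10 ^ |s / 2| + 1))) := by gcongr
      _ = _ := by ring
  · obtain ⟨h1, h2⟩ := hκ u (J U) hu (hJr _ _ _ hU)
    exact ⟨h1, hJr' _ _ _ h2⟩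

/-! ### Fourier coefficients and periodic integral operators -/

/-- The function `e^{inx}`. -/
noncomputable def expI (n : ℤ) (x : ℝ) : ℂ := Complex.exp (Complex.I * n * x)

theorem expI_add (m n : ℤ) (x : ℝ) : expI (m + n) x = expI m x * expI n x := by
  rw [expI, expI, expI, ← Complex.exp_add]
  congr 1
  push_cast
  ring

theorem expI_add_arg (n : ℤ) (x y : ℝ) : expI n (x + y) = expI n x * expI n y := by
  rw [expI, expI, expI, ← Complex.exp_add]
  congr 1
  push_cast
  ring

theorem norm_expI (n : ℤ) (x : ℝ) : ‖expI n x‖ = 1 := by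
  have h : Complex.I * n * x = ((n * x : ℝ) : ℂ) * Complex.I := by
    push_cast
    ring
  rw [expI, h, Complex.norm_exp_ofReal_mul_I]

theorem continuous_expI (n : ℤ) : Continuous (expI n) := by
  unfold expI
  fun_prop

theorem periodic_expI (n : ℤ) : Function.Periodic (expI n) (2 * Real.pi) := by
  intro x
  rw [expI_add_arg]
  have h : expI n (2 * Real.pi) = 1 := by
    rw [expI]
    have h2 : Complex.I * n * ((2 * Real.pi : ℝ) : ℂ) = n * (2 * Real.pi * Complex.I) := by
      push_cast
      ring
    rw [h2]
    exact Complex.exp_int_mul_two_pi_mul_I n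
  rw [h, mul_one]

@[simp] theorem expI_zero (x : ℝ) : expI 0 x = 1 := by simp [expI]

theorem famH_eq (n : ℤ) (x : ℝ) : famH n x = expI (-n) x / Real.sqrt (2 * Real.pi) := by
  simp [famH, fourierFun, expI]

/-- The Fourier coefficient `∫_{-π}^π v(x) e^{-inx} dx`, without normalization. -/
noncomputable def fourierInt (v : ℝ → ℂ) (n : ℤ) : ℂ := ∫ x in periodI, v x * expI (-n) x

theorem measurableSet_periodI : MeasurableSet periodI := measurableSet_Ioo

theorem integrableOn_periodI_iff {v : ℝ → ℂ} :
    IntegrableOn v periodI ↔ IntervalIntegrable v volume (-Real.pi) Real.pi := by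
  rw [intervalIntegrable_iff_integrableOn_Ioo_of_le (by linarith [Real.pi_pos])]
  rfl

theorem setIntegral_periodI {E : Type*} [NormedAddCommGroup E] [NormedSpace ℝ E] (v : ℝ → E) :
    ∫ x in periodI, v x = ∫ x in (-Real.pi)..Real.pi, v x := by
  rw [intervalIntegral.integral_of_le (by linarith [Real.pi_pos]), integral_Ioc_eq_integral_Ioo]
  rfl

theorem Function.Periodic.integrableOn_shift {v : ℝ → ℂ} (hv : Function.Periodic v (2 * Real.pi))
    (hi : IntegrableOn v periodI) (y : ℝ) : IntegrableOn (fun x => v (x - y)) periodI := by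
  rw [integrableOn_periodI_iff] at hi ⊢
  have h1 : IntervalIntegrable v volume (-Real.pi) (-Real.pi + 2 * Real.pi) := by
    convert hi using 1
    ring
  have h2 := hv.intervalIntegrable (by linarith [Real.pi_pos]) h1 (-Real.pi - y) (Real.pi - y)
  simpa using h2.comp_sub_right y

theorem Function.Periodic.setIntegral_shift {E : Type*} [NormedAddCommGroup E] [NormedSpace ℝ E]
    {v : ℝ → E} (hv : Function.Periodic v (2 * Real.pi)) (y : ℝ) :
    ∫ x in periodI, v (x - y) = ∫ x in periodI, v x := by
  rw [setIntegral_periodI, setIntegral_periodI, intervalIntegral.integral_comp_sub_right]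
  have h := hv.intervalIntegral_add_eq (-Real.pi - y) (-Real.pi)
  convert h using 2 <;> ring

theorem norm_fourierInt_le (v : ℝ → ℂ) (n : ℤ) :
    ‖fourierInt v n‖ ≤ ∫ x in periodI, ‖v x‖ := by
  refine (norm_integral_le_integral_norm _).trans (le_of_eq ?_)
  simp [norm_expI]

theorem MeasureTheory.IntegrableOn.mul_expI {v : ℝ → ℂ} {I : Set ℝ} (hv : IntegrableOn v I)
    (n : ℤ) : IntegrableOn (fun x => v x * expI n x) I := by
  refine Integrable.mul_bdd (c := 1) hv (continuous_expI n).aestronglyMeasurable ?_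
  exact Filter.Eventually.of_forall fun x => (norm_expI n x).le

section Kernel

variable {a v : ℝ → ℂ}

/-- By Tonelli: for each fixed second variable, periodicity makes the integral of |a| over the
shifted period independent of the shift. No more than integrability of a and v is needed. -/
theorem integrable_convolution_kernel (ham : Measurable a)
    (hap : Function.Periodic a (2 * Real.pi)) (ha : IntegrableOn a periodI)
    (hv : IntegrableOn v periodI) :
    Integrable (fun x : ℝ × ℝ => a (x.1 - x.2) * v x.2)
      ((volume.restrict periodI).prod (volume.restrict periodI)) := by
  have hm : AEStronglyMeasurable (fun x : ℝ × ℝ => a (x.1 - x.2) * v x.2)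
      ((volume.restrict periodI).prod (volume.restrict periodI)) :=
    (ham.comp (measurable_fst.sub measurable_snd)).aestronglyMeasurable.mul
      hv.aestronglyMeasurable.comp_snd
  rw [integrable_prod_iff' hm]
  refine ⟨Filter.Eventually.of_forall fun y => ?_, ?_⟩
  · exact (hap.integrableOn_shift ha y).mul_const (v y)
  · have h : (fun y => ∫ x, ‖a (x - y) * v y‖ ∂volume.restrict periodI) =
        fun y => (∫ x in periodI, ‖a x‖) * ‖v y‖ := by
      funext y
      simp only [norm_mul]
      rw [integral_mul_const]
      congr 1
      exact Function.Periodic.setIntegral_shift (v := fun x => ‖a x‖)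
        (fun x => by simp only [hap x]) y
    simp only [h]
    exact hv.norm.const_mul _

/-- Fourier coefficients of `θ ↦ ∫ a(θ - φ) Φ(θ, φ) v(φ) dφ`, for `Φ` given by an absolutely
convergent Fourier series. -/
theorem fourierInt_integral_operator {Φ : ℝ × ℝ → ℂ} {σ : ℤ × ℤ → ℂ} (ham : Measurable a)
    (hap : Function.Periodic a (2 * Real.pi)) (ha : IntegrableOn a periodI)
    (hv : IntegrableOn v periodI) (hσ : Summable σ) (hΦc : Continuous Φ)
    (hΦ : ∀ x, HasSum (fun p : ℤ × ℤ => σ p * (expI p.1 x.1 * expI p.2 x.2)) (Φ x)) :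
    (∀ᵐ θ ∂volume.restrict periodI,
      IntegrableOn (fun φ => a (θ - φ) * Φ (θ, φ) * v φ) periodI) ∧
    IntegrableOn (fun θ => ∫ φ in periodI, a (θ - φ) * Φ (θ, φ) * v φ) periodI ∧
    ∀ k, fourierInt (fun θ => ∫ φ in periodI, a (θ - φ) * Φ (θ, φ) * v φ) k =
      ∑' p : ℤ × ℤ, σ p * fourierInt a (k - p.1) * fourierInt v (k - p.1 - p.2) := by
  have hG := integrable_convolution_kernel ham hap ha hv
  have hK : Integrable (fun x : ℝ × ℝ => a (x.1 - x.2) * Φ x * v x.2)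
      ((volume.restrict periodI).prod (volume.restrict periodI)) := by
    have h1 : (fun x : ℝ × ℝ => a (x.1 - x.2) * Φ x * v x.2) =
        fun x => (a (x.1 - x.2) * v x.2) * Φ x := by
      funext x
      ring
    rw [h1]
    refine Integrable.mul_bdd (c := ∑' p, ‖σ p‖) hG hΦc.aestronglyMeasurable ?_
    refine Filter.Eventually.of_forall fun x => ?_
    rw [← (hΦ x).tsum_eq]
    have h2 : ∀ p : ℤ × ℤ, ‖σ p * (expI p.1 x.1 * expI p.2 x.2)‖ = ‖σ p‖ := fun p => by
      simp [norm_expI]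
    refine (norm_tsum_le_tsum_norm ?_).trans (le_of_eq ?_)
    · simpa only [h2] using hσ.norm
    · simp only [h2]
  refine ⟨hK.prod_right_ae, hK.integral_prod_left, fun k => ?_⟩
  have hKe : Integrable (fun x : ℝ × ℝ => a (x.1 - x.2) * Φ x * v x.2 * expI (-k) x.1)
      ((volume.restrict periodI).prod (volume.restrict periodI)) := by
    refine Integrable.mul_bdd (c := 1) hK
      ((continuous_expI _).comp continuous_fst).aestronglyMeasurable ?_
    exact Filter.Eventually.of_forall fun x => (norm_expI _ _).le
  have h1 : fourierInt (fun θ => ∫ φ in periodI, a (θ - φ) * Φ (θ, φ) * v φ) k =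
      ∫ x, a (x.1 - x.2) * Φ x * v x.2 * expI (-k) x.1
        ∂((volume.restrict periodI).prod (volume.restrict periodI)) := by
    rw [integral_prod _ hKe, fourierInt]
    congr 1
    funext θ
    rw [← integral_mul_const]
  let F : ℤ × ℤ → ℝ × ℝ → ℂ := fun p x =>
    σ p * (a (x.1 - x.2) * v x.2 * (expI p.1 x.1 * expI p.2 x.2 * expI (-k) x.1))
  have hFb : ∀ p : ℤ × ℤ, ∀ x, ‖F p x‖ = ‖σ p‖ * ‖a (x.1 - x.2) * v x.2‖ := fun p x => by
    simp only [F, norm_mul, norm_expI]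
    ring
  have hFi : ∀ p, Integrable (F p)
      ((volume.restrict periodI).prod (volume.restrict periodI)) := fun p => by
    refine Integrable.const_mul ?_ _
    refine Integrable.mul_bdd (c := 1) hG (Continuous.aestronglyMeasurable ?_) ?_
    · exact (((continuous_expI _).comp continuous_fst).mul
        ((continuous_expI _).comp continuous_snd)).mul ((continuous_expI _).comp continuous_fst)
    · exact Filter.Eventually.of_forall fun x => by simp [norm_expI]
  -- The exponentials have modulus one, so the L¹ norms of the terms are ‖σ p‖ times a constant, and
  -- the series may be integrated term by term.
  have h2 := hasSum_integral_of_summable_integral_norm hFi (by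
    simp only [hFb, integral_const_mul]
    exact hσ.norm.mul_right _)
  have h3 : (fun x : ℝ × ℝ => ∑' p, F p x) =
      fun x => a (x.1 - x.2) * Φ x * v x.2 * expI (-k) x.1 := by
    funext x
    have h4 := (hΦ x).mul_left (a (x.1 - x.2) * v x.2 * expI (-k) x.1)
    rw [show a (x.1 - x.2) * Φ x * v x.2 * expI (-k) x.1 =
      a (x.1 - x.2) * v x.2 * expI (-k) x.1 * Φ x by ring, ← h4.tsum_eq]
    congr 1
    funext p
    simp only [F]
    ring
  rw [h3] at h2
  rw [h1, ← h2.tsum_eq]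
  congr 1
  funext p
  rw [integral_prod_symm _ (hFi p)]
  have h5 : ∀ y, ∫ x, F p (x, y) ∂volume.restrict periodI =
      σ p * fourierInt a (k - p.1) * (v y * expI (-(k - p.1 - p.2)) y) := by
    intro y
    -- Splitting the exponential in x at x - y turns the inner integral, by translation invariance,
    -- into the coefficient of `a` at k - p₁; the leftover exponential in y gives that of `v` at k -
    -- p₁ - p₂.
    have h6 : (fun x => F p (x, y)) = fun x => (a (x - y) * expI (-(k - p.1)) (x - y)) *
        (σ p * (v y * expI (-(k - p.1 - p.2)) y)) := by
      funext x
      have e1 : expI (-(k - p.1)) x = expI (-(k - p.1)) (x - y) * expI (-(k - p.1)) y := by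
        rw [← expI_add_arg, sub_add_cancel]
      have e2 : expI p.1 x * expI (-k) x = expI (-(k - p.1)) x := by
        rw [← expI_add]
        congr 1
        ring
      have e3 : expI (-(k - p.1)) y * expI p.2 y = expI (-(k - p.1 - p.2)) y := by
        rw [← expI_add]
        congr 1
        ring
      simp only [F]
      linear_combination (σ p * a (x - y) * v y * expI p.2 y) * e2 +
        (σ p * a (x - y) * v y * expI p.2 y) * e1 +
        (σ p * a (x - y) * v y * expI (-(k - p.1)) (x - y)) * e3
    rw [h6, integral_mul_const]
    have h7 := Function.Periodic.setIntegral_shift (v := fun x => a x * expI (-(k - p.1)) x)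
      (fun x => by simp only [hap x, periodic_expI _ x]) y
    rw [h7, fourierInt]
    ring
  simp only [h5]
  rw [integral_const_mul]
  rfl

end Kernel

/-! ### Decay of the Fourier coefficients of Hölder functions of one variable -/

theorem fourierCoeffOn_eq_fourierInt (f : ℝ → ℂ) (p : ℤ)
    (h : -Real.pi < Real.pi) :
    fourierCoeffOn h f p = ((2 * Real.pi : ℝ) : ℂ)⁻¹ * fourierInt f p := by
  rw [fourierCoeffOn_eq_integral, fourierInt, setIntegral_periodI, Complex.real_smul]
  congr 1
  · push_cast
    ring
  · congr 1
    funext x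
    rw [smul_eq_mul, mul_comm, fourier_coe_apply, expI]
    congr 2
    have : (Real.pi : ℂ) ≠ 0 := by exact_mod_cast Real.pi_ne_zero
    push_cast
    field_simp
    ring

theorem neg_pi_lt_pi : -Real.pi < Real.pi := by linarith [Real.pi_pos]

/-- Parseval's identity. -/
theorem hasSum_sq_fourierInt {f : ℝ → ℂ} {N : ℝ}
    (hf : AEStronglyMeasurable f (volume.restrict periodI)) (hN : ∀ x ∈ periodI, ‖f x‖ ≤ N) :
    HasSum (fun p => ‖fourierInt f p‖ ^ 2) (2 * Real.pi * ∫ x in periodI, ‖f x‖ ^ 2) := by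
  have hr : volume.restrict (Ioc (-Real.pi) Real.pi) = volume.restrict periodI :=
    (Measure.restrict_congr_set Ioo_ae_eq_Ioc).symm
  have hm : MemLp f 2 (volume.restrict (Ioc (-Real.pi) Real.pi)) := by
    rw [hr]
    have : IsFiniteMeasure (volume.restrict periodI) :=
      ⟨by simp [periodI]⟩
    refine MemLp.of_bound hf N ?_
    exact (ae_restrict_iff' measurableSet_periodI).2 (Filter.Eventually.of_forall hN)
  have h := (hasSum_sq_fourierCoeffOn neg_pi_lt_pi hm).mul_left ((2 * Real.pi) ^ 2)
  have hpi : (2 * Real.pi) ≠ 0 := by positivity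
  have e1 : (fun p => ‖fourierInt f p‖ ^ 2) =
      fun p => (2 * Real.pi) ^ 2 * ‖fourierCoeffOn neg_pi_lt_pi f p‖ ^ 2 := by
    funext p
    rw [fourierCoeffOn_eq_fourierInt, norm_mul, norm_inv, Complex.norm_real, Real.norm_eq_abs,
      abs_of_pos Real.two_pi_pos, mul_pow]
    field_simp
  have e2 : 2 * Real.pi * ∫ x in periodI, ‖f x‖ ^ 2 = (2 * Real.pi) ^ 2 *
      ((Real.pi - -Real.pi)⁻¹ • ∫ x in (-Real.pi)..Real.pi, ‖f x‖ ^ 2) := by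
    rw [setIntegral_periodI, smul_eq_mul, sub_neg_eq_add, ← two_mul]
    field_simp
  rw [e1, e2]
  exact h

theorem setIntegral_periodI_le {f : ℝ → ℝ} {M : ℝ} (h : ∀ x ∈ periodI, ‖f x‖ ≤ M) :
    ∫ x in periodI, f x ≤ 2 * Real.pi * M := by
  have h1 : ‖∫ x in periodI, f x‖ ≤ M * volume.real periodI :=
    norm_setIntegral_le_of_norm_le_const measure_Ioo_lt_top h
  have h2 : volume.real periodI = 2 * Real.pi := by
    rw [periodI, Real.volume_real_Ioo_of_le neg_pi_lt_pi.le]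
    ring
  rw [h2, mul_comm] at h1
  exact (le_abs_self _).trans h1

theorem sum_sq_fourierInt_le {f : ℝ → ℂ} {N : ℝ}
    (hf : AEStronglyMeasurable f (volume.restrict periodI)) (hN : ∀ x ∈ periodI, ‖f x‖ ≤ N)
    (F : Finset ℤ) : ∑ p ∈ F, ‖fourierInt f p‖ ^ 2 ≤ (2 * Real.pi) ^ 2 * N ^ 2 := by
  have h := hasSum_sq_fourierInt hf hN
  refine (sum_le_hasSum F (fun p _ => by positivity) h).trans ?_
  have h1 : ∫ x in periodI, ‖f x‖ ^ 2 ≤ 2 * Real.pi * N ^ 2 := by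
    refine setIntegral_periodI_le fun x hx => ?_
    rw [norm_pow, norm_norm]
    gcongr
    exact hN x hx
  have := Real.pi_pos
  nlinarith

theorem Function.Periodic.deriv {g : ℝ → ℂ} {c : ℝ} (hg : Function.Periodic g c) :
    Function.Periodic (deriv g) c := by
  intro x
  rw [← deriv_comp_add_const]
  congr 1
  funext y
  exact hg y

theorem Function.Periodic.iteratedDeriv {g : ℝ → ℂ} {c : ℝ} (hg : Function.Periodic g c) (m : ℕ) :
    Function.Periodic (iteratedDeriv m g) c := by
  induction m with
  | zero => simpa using hg
  | succ k ih =>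
    rw [iteratedDeriv_succ]
    exact ih.deriv

theorem hasDerivAt_expI (n : ℤ) (x : ℝ) :
    HasDerivAt (expI n) (Complex.I * n * expI n x) x := by
  have h1 : HasDerivAt (fun y : ℝ => Complex.I * n * (y : ℂ)) (Complex.I * n) x := by
    simpa using (Complex.ofRealCLM.hasDerivAt (x := x)).const_mul (Complex.I * n)
  have h2 := h1.cexp
  have h3 : Complex.I * n * expI n x = Complex.exp (Complex.I * n * x) * (Complex.I * n) :=
    mul_comm _ _
  rw [h3]
  exact h2

theorem fourierInt_deriv {g : ℝ → ℂ} (hg : ContDiff ℝ 1 g)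
    (hp : Function.Periodic g (2 * Real.pi)) (p : ℤ) :
    fourierInt (deriv g) p = Complex.I * p * fourierInt g p := by
  have hd : ∀ x, HasDerivAt g (deriv g x) x := fun x =>
    (hg.differentiable (by norm_num) x).hasDerivAt
  have hc : Continuous (deriv g) := hg.continuous_deriv (by norm_num)
  have h := intervalIntegral.integral_eq_sub_of_hasDerivAt (a := -Real.pi) (b := Real.pi)
    (f := fun x => g x * expI (-p) x)
    (f' := fun x => deriv g x * expI (-p) x + g x * (Complex.I * (-p : ℤ) * expI (-p) x))
    (fun x _ => (hd x).mul (hasDerivAt_expI (-p) x))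
    (((hc.mul (continuous_expI _)).add (hg.continuous.mul
      (continuous_const.mul (continuous_expI _)))).intervalIntegrable _ _)
  have hend : g Real.pi * expI (-p) Real.pi - g (-Real.pi) * expI (-p) (-Real.pi) = 0 := by
    have e1 : Real.pi = -Real.pi + 2 * Real.pi := by ring
    have e2 : g Real.pi = g (-Real.pi) := by
      conv_lhs => rw [e1]
      exact hp _
    have e3 : expI (-p) Real.pi = expI (-p) (-Real.pi) := by
      conv_lhs => rw [e1]
      exact periodic_expI _ _
    rw [e2, e3, sub_self]
  have hi1 : IntervalIntegrable (fun x => deriv g x * expI (-p) x) volume (-Real.pi) Real.pi :=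
    (hc.mul (continuous_expI _)).intervalIntegrable _ _
  have hi2 : IntervalIntegrable (fun x => g x * (Complex.I * (-p : ℤ) * expI (-p) x)) volume
      (-Real.pi) Real.pi :=
    (hg.continuous.mul (continuous_const.mul (continuous_expI _))).intervalIntegrable _ _
  rw [hend, intervalIntegral.integral_add hi1 hi2] at h
  have h2 : (∫ x in (-Real.pi)..Real.pi, g x * (Complex.I * (-p : ℤ) * expI (-p) x)) =
      -(Complex.I * p) * ∫ x in (-Real.pi)..Real.pi, g x * expI (-p) x := by
    rw [← intervalIntegral.integral_const_mul]
    congr 1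
    funext x
    push_cast
    ring
  rw [h2] at h
  rw [fourierInt, fourierInt, setIntegral_periodI, setIntegral_periodI]
  linear_combination h

theorem fourierInt_iteratedDeriv {g : ℝ → ℂ} {m : ℕ} (hg : ContDiff ℝ m g)
    (hp : Function.Periodic g (2 * Real.pi)) (p : ℤ) :
    fourierInt (iteratedDeriv m g) p = (Complex.I * p) ^ m * fourierInt g p := by
  induction m with
  | zero => simp
  | succ k ih =>
    have h1 : ContDiff ℝ 1 (iteratedDeriv k g) := by
      rw [iteratedDeriv_eq_iterate]
      refine ContDiff.iterate_deriv' 1 k ?_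
      rw [add_comm]
      exact hg
    rw [iteratedDeriv_succ, fourierInt_deriv h1 (hp.iteratedDeriv k),
      ih (hg.of_le (by exact_mod_cast Nat.le_succ k)), pow_succ]
    ring

theorem fourierInt_translate {v : ℝ → ℂ} (hv : Function.Periodic v (2 * Real.pi)) (h : ℝ) (p : ℤ) :
    fourierInt (fun x => v (x + h)) p = expI p h * fourierInt v p := by
  have h1 := Function.Periodic.setIntegral_shift (v := fun x => v x * expI (-p) x)
    (fun x => by simp only [hv x, periodic_expI _ x]) (-h)
  rw [fourierInt, fourierInt, ← h1, ← integral_const_mul]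
  congr 1
  funext x
  rw [sub_neg_eq_add, expI_add_arg]
  have h2 : expI p h * expI (-p) h = 1 := by
    rw [← expI_add]
    simp
  linear_combination (-(v (x + h) * expI (-p) x)) * h2

theorem holder_Icc {D : ℝ → ℂ} (hD : Continuous D) {α N : ℝ} (hα : 0 < α)
    (h : ∀ x ∈ periodI, ∀ y ∈ periodI, ‖D x - D y‖ ≤ N * |x - y| ^ α) :
    ∀ x ∈ Icc (-Real.pi) Real.pi, ∀ y ∈ Icc (-Real.pi) Real.pi,
      ‖D x - D y‖ ≤ N * |x - y| ^ α := by
  have hcl : IsClosed {z : ℝ × ℝ | ‖D z.1 - D z.2‖ ≤ N * |z.1 - z.2| ^ α} := by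
    refine isClosed_le (by fun_prop) ?_
    refine continuous_const.mul (Continuous.rpow_const (by fun_prop) fun _ => Or.inr hα.le)
  have hsub : closure (periodI ×ˢ periodI) ⊆ {z : ℝ × ℝ | ‖D z.1 - D z.2‖ ≤ N * |z.1 - z.2| ^ α} :=
    closure_minimal (fun z hz => h z.1 hz.1 z.2 hz.2) hcl
  rw [closure_prod_eq, periodI, closure_Ioo neg_pi_lt_pi.ne] at hsub
  intro x hx y hy
  exact hsub (a := (x, y)) ⟨hx, hy⟩

/-- The Hölder bound is known within one period only. If x + h passes π, the increment is split at
the point π, identified with -π; this costs the factor 2. -/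
theorem norm_translate_sub_le {D : ℝ → ℂ} (hD : Continuous D)
    (hp : Function.Periodic D (2 * Real.pi)) {α N : ℝ} (hα : 0 < α) (hN : 0 ≤ N)
    (hh : ∀ x ∈ periodI, ∀ y ∈ periodI, ‖D x - D y‖ ≤ N * |x - y| ^ α) {h : ℝ} (h0 : 0 ≤ h)
    (h1 : h ≤ 1) {x : ℝ} (hx : x ∈ periodI) : ‖D (x + h) - D x‖ ≤ 2 * N * h ^ α := by
  have hI := holder_Icc hD hα hh
  have hpi := Real.pi_gt_three
  have hha : 0 ≤ h ^ α := by positivity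
  obtain ⟨hx1, hx2⟩ := hx
  rcases le_or_gt (x + h) Real.pi with hle | hlt
  · have h2 := hI (x + h) ⟨by linarith, hle⟩ x ⟨hx1.le, hx2.le⟩
    rw [add_sub_cancel_left, abs_of_nonneg h0] at h2
    nlinarith
  · have e1 : D (x + h) = D (x + h - 2 * Real.pi) := by
      have := hp (x + h - 2 * Real.pi)
      rwa [sub_add_cancel] at this
    have e2 : D (-Real.pi) = D Real.pi := by
      have := hp (-Real.pi)
      rw [← this]
      congr 1
      ring
    have h2 := hI (x + h - 2 * Real.pi) ⟨by linarith, by linarith⟩ (-Real.pi)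
      ⟨le_refl _, by linarith⟩
    have h3 := hI Real.pi ⟨by linarith, le_refl _⟩ x ⟨hx1.le, hx2.le⟩
    have h4 : |x + h - 2 * Real.pi - -Real.pi| ^ α ≤ h ^ α := by
      refine Real.rpow_le_rpow (abs_nonneg _) ?_ hα.le
      rw [abs_of_nonneg (by linarith)]
      linarith
    have h5 : |Real.pi - x| ^ α ≤ h ^ α := by
      refine Real.rpow_le_rpow (abs_nonneg _) ?_ hα.le
      rw [abs_of_nonneg (by linarith)]
      linarith
    have e3 : D (x + h) - D x = (D (x + h - 2 * Real.pi) - D (-Real.pi)) + (D Real.pi - D x) := by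
      rw [e1, e2]
      ring
    rw [e3]
    refine (norm_add_le _ _).trans ?_
    nlinarith

theorem norm_expI_sub_one_sq (n : ℤ) (x : ℝ) :
    ‖expI n x - 1‖ ^ 2 = 2 - 2 * Real.cos (n * x) := by
  have h : Complex.I * n * x = ((n * x : ℝ) : ℂ) * Complex.I := by
    push_cast
    ring
  rw [expI, h, ← Complex.normSq_eq_norm_sq, Complex.normSq_apply, Complex.sub_re, Complex.sub_im,
    Complex.exp_ofReal_mul_I_re, Complex.exp_ofReal_mul_I_im, Complex.one_re, Complex.one_im]
  have := Real.sin_sq_add_cos_sq (n * x)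
  nlinarith

/-- With 2^l ≤ |p| < 2^{l+1}, the phase |p|2^{-l} lies in [1, 2], where the cosine is at most cos 1.
Thus translation by 2^{-l} detects the whole dyadic block of p. -/
theorem half_le_norm_expI_sub_one_sq {p : ℤ} (hp : p ≠ 0) :
    1 / 2 ≤ ‖expI p ((1 / 2) ^ Nat.log 2 p.natAbs) - 1‖ ^ 2 := by
  rw [norm_expI_sub_one_sq]
  set l := Nat.log 2 p.natAbs with hl
  have hp' : p.natAbs ≠ 0 := Int.natAbs_ne_zero.2 hp
  have h1 : ((2 : ℝ)) ^ l ≤ (p.natAbs : ℝ) := by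
    exact_mod_cast Nat.pow_log_le_self 2 hp'
  have h2 : (p.natAbs : ℝ) ≤ 2 ^ (l + 1) := by
    exact_mod_cast (Nat.lt_pow_succ_log_self (by norm_num) p.natAbs).le
  have h3 : Real.cos (p * (1 / 2) ^ l) = Real.cos ((p.natAbs : ℝ) * (1 / 2) ^ l) := by
    rw [← Real.cos_abs, abs_mul, abs_of_pos (show (0 : ℝ) < (1 / 2) ^ l by positivity)]
    congr 2
    rw [Nat.cast_natAbs, Int.cast_abs]
  rw [h3]
  have e : (2 : ℝ) ^ l * (1 / 2) ^ l = 1 := by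
    rw [← mul_pow]
    norm_num
  have h4 : 1 ≤ (p.natAbs : ℝ) * (1 / 2) ^ l := by
    calc (1 : ℝ) = 2 ^ l * (1 / 2) ^ l := e.symm
      _ ≤ _ := by gcongr
  have h5 : (p.natAbs : ℝ) * (1 / 2) ^ l ≤ 2 := by
    calc (p.natAbs : ℝ) * (1 / 2) ^ l ≤ 2 ^ (l + 1) * (1 / 2) ^ l := by gcongr
      _ = 2 := by rw [pow_succ]; linear_combination 2 * e
  have h6 := Real.cos_le_cos_of_nonneg_of_le_pi (x := 1) (by norm_num)
    (by linarith [Real.pi_gt_three]) h4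
  have h7 := Real.cos_one_le
  linarith

/-- Bernstein's argument: Bessel's inequality for D(x+h) - D(x) with h = 2^{-l} bounds the
coefficients in the l-th dyadic block in square sum by a multiple of N²2^{-2lα}. The weight is of
order 2^{2lβ} there, so the blocks sum to a geometric series of ratio `q` < 1. -/
theorem sum_abs_rpow_fourierInt_le_of_holder {α β : ℝ} (hβ : 0 ≤ β) (hβα : β < α) :
    ∃ C : ℝ, 0 ≤ C ∧ ∀ (D : ℝ → ℂ) (N : ℝ), Continuous D → Function.Periodic D (2 * Real.pi) →
      0 ≤ N → (∀ x ∈ periodI, ∀ y ∈ periodI, ‖D x - D y‖ ≤ N * |x - y| ^ α) →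
      ∀ F : Finset ℤ, (∀ p ∈ F, p ≠ 0) →
        ∑ p ∈ F, (|(p : ℝ)| ^ β * ‖fourierInt D p‖) ^ 2 ≤ C * N ^ 2 := by
  have hα : 0 < α := lt_of_le_of_lt hβ hβα
  set q : ℝ := ((2 : ℝ) ^ (β - α)) ^ 2 with hq
  have hq0 : 0 ≤ q := by positivity
  have hq1 : q < 1 := by
    have : (2 : ℝ) ^ (β - α) < 1 := Real.rpow_lt_one_of_one_lt_of_neg (by norm_num) (by linarith)
    have h0 : (0 : ℝ) ≤ (2 : ℝ) ^ (β - α) := by positivity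
    nlinarith
  refine ⟨(2 * ((2 : ℝ) ^ β) ^ 2) * ((2 * Real.pi) ^ 2 * 4) * (1 - q)⁻¹, ?_, ?_⟩
  · have : 0 ≤ (1 - q)⁻¹ := inv_nonneg.2 (by linarith)
    positivity
  intro D N hD hp hN hh F hF
  let h : ℕ → ℝ := fun l => (1 / 2) ^ l
  have hh0 : ∀ l, 0 ≤ h l := fun l => by positivity
  have hh1 : ∀ l, h l ≤ 1 := fun l => pow_le_one₀ (by norm_num) (by norm_num)
  have hbes : ∀ l, ∑ p ∈ F, ‖expI p (h l) - 1‖ ^ 2 * ‖fourierInt D p‖ ^ 2 ≤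
      (2 * Real.pi) ^ 2 * (2 * N * h l ^ α) ^ 2 := by
    intro l
    have h1 : ∀ p, ‖expI p (h l) - 1‖ ^ 2 * ‖fourierInt D p‖ ^ 2 =
        ‖fourierInt (fun x => D (x + h l) - D x) p‖ ^ 2 := by
      intro p
      rw [← mul_pow, ← norm_mul, sub_mul, one_mul, ← fourierInt_translate hp]
      congr 2
      rw [fourierInt, fourierInt, fourierInt, ← integral_sub]
      · congr 1
        funext x
        ring
      · exact (integrableOn_periodI_iff.2 ((hD.comp (continuous_add_const _)).intervalIntegrable
          _ _)).mul_expI _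
      · exact (integrableOn_periodI_iff.2 (hD.intervalIntegrable _ _)).mul_expI _
    simp only [h1]
    refine sum_sq_fourierInt_le (Continuous.aestronglyMeasurable (by fun_prop)) (fun x hx => ?_) F
    exact norm_translate_sub_le hD hp hα hN hh (hh0 l) (hh1 l) hx
  let lg : ℤ → ℕ := fun p => Nat.log 2 p.natAbs
  let w : ℕ → ℝ := fun l => 2 * ((2 : ℝ) ^ β) ^ 2 * (((2 : ℝ) ^ β) ^ l) ^ 2
  have hterm : ∀ p ∈ F, (|(p : ℝ)| ^ β * ‖fourierInt D p‖) ^ 2 ≤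
      w (lg p) * (‖expI p (h (lg p)) - 1‖ ^ 2 * ‖fourierInt D p‖ ^ 2) := by
    intro p hpF
    have h1 := half_le_norm_expI_sub_one_sq (hF p hpF)
    have h2 : |(p : ℝ)| ^ β ≤ (2 : ℝ) ^ β * ((2 : ℝ) ^ β) ^ lg p := by
      have h3 : |(p : ℝ)| ≤ 2 ^ (lg p + 1) := by
        rw [← Int.cast_abs, ← Nat.cast_natAbs]
        exact_mod_cast (Nat.lt_pow_succ_log_self (by norm_num) p.natAbs).le
      calc |(p : ℝ)| ^ β ≤ ((2 : ℝ) ^ (lg p + 1)) ^ β := Real.rpow_le_rpow (abs_nonneg _) h3 hβ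
        _ = ((2 : ℝ) ^ β) ^ (lg p + 1) := by
            rw [← Real.rpow_natCast, ← Real.rpow_natCast, ← Real.rpow_mul (by norm_num),
              ← Real.rpow_mul (by norm_num), mul_comm]
        _ = _ := by rw [pow_succ]; ring
    have h4 : (|(p : ℝ)| ^ β) ^ 2 ≤ ((2 : ℝ) ^ β) ^ 2 * (((2 : ℝ) ^ β) ^ lg p) ^ 2 := by
      rw [← mul_pow]
      gcongr
    rw [mul_pow]
    have h5 : 0 ≤ ((2 : ℝ) ^ β) ^ 2 * (((2 : ℝ) ^ β) ^ lg p) ^ 2 := by positivity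
    calc (|(p : ℝ)| ^ β) ^ 2 * ‖fourierInt D p‖ ^ 2
        ≤ ((2 : ℝ) ^ β) ^ 2 * (((2 : ℝ) ^ β) ^ lg p) ^ 2 * ‖fourierInt D p‖ ^ 2 := by gcongr
      _ = (((2 : ℝ) ^ β) ^ 2 * (((2 : ℝ) ^ β) ^ lg p) ^ 2) * 2 * (1 / 2) *
          ‖fourierInt D p‖ ^ 2 := by ring
      _ ≤ (((2 : ℝ) ^ β) ^ 2 * (((2 : ℝ) ^ β) ^ lg p) ^ 2) * 2 * ‖expI p (h (lg p)) - 1‖ ^ 2 *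
          ‖fourierInt D p‖ ^ 2 := by gcongr
      _ = _ := by
          simp only [w]
          ring
  have hw0 : ∀ l, 0 ≤ w l := fun l => by positivity
  set M := F.sup lg + 1 with hM
  calc ∑ p ∈ F, (|(p : ℝ)| ^ β * ‖fourierInt D p‖) ^ 2
      ≤ ∑ p ∈ F, ∑ l ∈ Finset.range M,
        w l * (‖expI p (h l) - 1‖ ^ 2 * ‖fourierInt D p‖ ^ 2) := by
        -- Instead of sorting `F` into dyadic blocks, the nonnegative terms of all levels are added
        -- for each `p`; its own level is one of them.
        refine Finset.sum_le_sum fun p hpF => (hterm p hpF).trans ?_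
        refine Finset.single_le_sum
          (f := fun l => w l * (‖expI p (h l) - 1‖ ^ 2 * ‖fourierInt D p‖ ^ 2))
          (fun l _ => mul_nonneg (hw0 l) (by positivity)) ?_
        rw [Finset.mem_range, hM]
        exact Nat.lt_succ_of_le (Finset.le_sup hpF)
    _ = ∑ l ∈ Finset.range M, w l *
        ∑ p ∈ F, (‖expI p (h l) - 1‖ ^ 2 * ‖fourierInt D p‖ ^ 2) := by
        rw [Finset.sum_comm]
        simp only [Finset.mul_sum]
    _ ≤ ∑ l ∈ Finset.range M, w l * ((2 * Real.pi) ^ 2 * (2 * N * h l ^ α) ^ 2) := by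
        refine Finset.sum_le_sum fun l _ => ?_
        exact mul_le_mul_of_nonneg_left (hbes l) (hw0 l)
    _ = (2 * ((2 : ℝ) ^ β) ^ 2) * ((2 * Real.pi) ^ 2 * 4) * N ^ 2 *
        ∑ l ∈ Finset.range M, q ^ l := by
        rw [Finset.mul_sum]
        refine Finset.sum_congr rfl fun l _ => ?_
        have e1 : h l ^ α = ((2 : ℝ) ^ (-α)) ^ l := by
          simp only [h]
          rw [← Real.rpow_natCast, ← Real.rpow_natCast, ← Real.rpow_mul (by norm_num),
            ← Real.rpow_mul (by norm_num), show (1 / 2 : ℝ) = 2 ^ (-1 : ℝ) by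
              rw [Real.rpow_neg_one]; norm_num, ← Real.rpow_mul (by norm_num)]
          congr 1
          ring
        have e2 : q ^ l = (((2 : ℝ) ^ β) ^ l) ^ 2 * (((2 : ℝ) ^ (-α)) ^ l) ^ 2 := by
          rw [hq, sub_eq_add_neg, Real.rpow_add (by norm_num)]
          ring
        rw [e1, e2]
        simp only [w]
        ring
    _ ≤ (2 * ((2 : ℝ) ^ β) ^ 2) * ((2 * Real.pi) ^ 2 * 4) * N ^ 2 * (1 - q)⁻¹ := by
        gcongr
        rw [← tsum_geometric_of_lt_one hq0 hq1]
        exact (summable_geometric_of_lt_one hq0 hq1).sum_le_tsum _ fun l _ => by positivity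
    _ = _ := by ring

/-- The Fourier coefficients of a periodic function of class `C^{m,α}`. -/
theorem sum_abs_rpow_fourierInt_le (m : ℕ) {α τ : ℝ} (hτ0 : 0 < τ)
    (hτ : τ < m + α) :
    ∃ C : ℝ, 0 ≤ C ∧ ∀ (g : ℝ → ℂ) (N : ℝ), ContDiff ℝ m g →
      Function.Periodic g (2 * Real.pi) → 0 ≤ N → (∀ x ∈ periodI, ‖iteratedDeriv m g x‖ ≤ N) →
      (α ≠ 0 → ∀ x ∈ periodI, ∀ y ∈ periodI,
        ‖iteratedDeriv m g x - iteratedDeriv m g y‖ ≤ N * |x - y| ^ α) →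
      ∀ F : Finset ℤ, ∑ p ∈ F, (|(p : ℝ)| ^ τ * ‖fourierInt g p‖) ^ 2 ≤ C * N ^ 2 := by
  -- The zero frequency has weight |0|^τ = 0; without it |p| ≥ 1, so powers of |p| can be compared
  -- by exponent.
  have hred : ∀ (g : ℝ → ℂ) (F : Finset ℤ),
      ∑ p ∈ F, (|(p : ℝ)| ^ τ * ‖fourierInt g p‖) ^ 2 =
      ∑ p ∈ F.filter (fun p => p ≠ 0), (|(p : ℝ)| ^ τ * ‖fourierInt g p‖) ^ 2 := by
    intro g F
    symm
    apply Finset.sum_filter_of_ne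
    rintro p _ hp rfl
    apply hp
    simp [Real.zero_rpow hτ0.ne']
  have hder : ∀ (g : ℝ → ℂ), ContDiff ℝ m g → Function.Periodic g (2 * Real.pi) → ∀ p : ℤ,
      ‖fourierInt (iteratedDeriv m g) p‖ = |(p : ℝ)| ^ m * ‖fourierInt g p‖ := by
    intro g hg hp p
    rw [fourierInt_iteratedDeriv hg hp, norm_mul, norm_pow, norm_mul, Complex.norm_I, one_mul,
      Complex.norm_intCast]
  have habs : ∀ p : ℤ, p ≠ 0 → 1 ≤ |(p : ℝ)| := fun p hp => by
    rw [← Int.cast_abs]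
    exact_mod_cast Int.one_le_abs hp
  -- For τ ≤ m Parseval for the m-th derivative suffices. Otherwise τ - m lies strictly between 0
  -- and α, so α ≠ 0 and the Hölder bound is available.
  rcases le_or_gt τ m with hle | hlt
  · refine ⟨(2 * Real.pi) ^ 2, by positivity, fun g N hg hp hN hb _ F => ?_⟩
    have hc : Continuous (iteratedDeriv m g) := hg.continuous_iteratedDeriv m le_rfl
    rw [hred]
    refine le_trans (Finset.sum_le_sum fun p hp' => ?_)
      (sum_sq_fourierInt_le hc.aestronglyMeasurable hb (F.filter (fun p => p ≠ 0)))
    rw [hder g hg hp]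
    gcongr
    rw [← Real.rpow_natCast]
    exact Real.rpow_le_rpow_of_exponent_le (habs p (Finset.mem_filter.1 hp').2) hle
  · obtain ⟨C, hC, h⟩ := sum_abs_rpow_fourierInt_le_of_holder (α := α) (β := τ - m)
      (by linarith) (by linarith)
    refine ⟨C, hC, fun g N hg hp hN hb hh F => ?_⟩
    have hc : Continuous (iteratedDeriv m g) := hg.continuous_iteratedDeriv m le_rfl
    have h1 := h _ N hc (hp.iteratedDeriv m) hN (hh (by linarith))
      (F.filter (fun p => p ≠ 0)) fun p hp' => (Finset.mem_filter.1 hp').2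
    rw [hred]
    refine le_trans (le_of_eq (Finset.sum_congr rfl fun p hp' => ?_)) h1
    have h2 : 0 < |(p : ℝ)| := by linarith [habs p (Finset.mem_filter.1 hp').2]
    rw [hder g hg hp, ← mul_assoc, ← Real.rpow_natCast _ m, ← Real.rpow_add h2, sub_add_cancel]

/-! ### Fourier series of periodic functions of two variables -/

theorem continuous_fourierInt_slice {Φ : ℝ × ℝ → ℂ} (hΦ : Continuous Φ) (p : ℤ) :
    Continuous fun y => fourierInt (fun x => Φ (x, y)) p := by
  simp only [fourierInt, setIntegral_periodI]
  refine intervalIntegral.continuous_parametric_intervalIntegral_of_continuous' ?_ _ _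
  have h := (continuous_expI (-p)).comp (continuous_snd (X := ℝ) (Y := ℝ))
  have h2 : Continuous fun z : ℝ × ℝ => Φ (z.2, z.1) := hΦ.comp continuous_swap
  exact h2.mul h

/-- The Fourier coefficients `∫∫ Φ(x, y) e^{-ipx} e^{-iqy} dx dy`, without normalization. -/
noncomputable def fourierInt₂ (Φ : ℝ × ℝ → ℂ) (p : ℤ × ℤ) : ℂ :=
  fourierInt (fun y => fourierInt (fun x => Φ (x, y)) p.1) p.2

theorem fourierInt₂_swap {Φ : ℝ × ℝ → ℂ} (hΦ : Continuous Φ) (p : ℤ × ℤ) :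
    fourierInt₂ (fun x => Φ x.swap) p.swap = fourierInt₂ Φ p := by
  have hprod : Integrable (fun z : ℝ × ℝ => Φ (z.1, z.2) * expI (-p.1) z.1 * expI (-p.2) z.2)
      ((volume.restrict periodI).prod (volume.restrict periodI)) := by
    rw [Measure.prod_restrict]
    have hc : Continuous fun z : ℝ × ℝ => Φ (z.1, z.2) * expI (-p.1) z.1 * expI (-p.2) z.2 :=
      (hΦ.mul ((continuous_expI _).comp continuous_fst)).mul ((continuous_expI _).comp continuous_snd)
    have hK : IsCompact (Icc (-Real.pi) Real.pi ×ˢ Icc (-Real.pi) Real.pi) :=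
      isCompact_Icc.prod isCompact_Icc
    exact (hc.continuousOn.integrableOn_compact hK).mono_set
      (prod_mono Ioo_subset_Icc_self Ioo_subset_Icc_self)
  simp only [fourierInt₂, fourierInt, Prod.swap_prod_mk, Prod.fst_swap, Prod.snd_swap,
    ← integral_mul_const]
  rw [integral_integral_swap (f := fun y x => Φ (x, y) * expI (-p.1) x * expI (-p.2) y) hprod.swap]
  congr 1
  funext x
  congr 1
  funext y
  ring

/-- Parseval in y, for each coefficient in x, followed by exchanging the finite sum over p with the
integral over y: a one-variable bound uniform in the frozen variable gives the two-variable bound.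
-/
theorem sum_sq_fourierInt₂_le {Φ : ℝ × ℝ → ℂ} (hΦ : Continuous Φ) (ω : ℤ → ℝ) (P Q : Finset ℤ)
    {M : ℝ} (hM : ∀ y ∈ periodI, ∑ p ∈ P, (ω p * ‖fourierInt (fun x => Φ (x, y)) p‖) ^ 2 ≤ M) :
    ∑ p ∈ P, ∑ q ∈ Q, (ω p * ‖fourierInt₂ Φ (p, q)‖) ^ 2 ≤ (2 * Real.pi) ^ 2 * M := by
  have hc := continuous_fourierInt_slice hΦ
  have hb : ∀ p, ∃ N, ∀ y ∈ periodI, ‖fourierInt (fun x => Φ (x, y)) p‖ ≤ N := fun p => by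
    obtain ⟨N, hN⟩ := isCompact_Icc.exists_bound_of_continuousOn
      ((hc p).continuousOn (s := Icc (-Real.pi) Real.pi))
    exact ⟨N, fun y hy => hN y (Ioo_subset_Icc_self hy)⟩
  have hi : ∀ p, IntegrableOn (fun y => (ω p * ‖fourierInt (fun x => Φ (x, y)) p‖) ^ 2) periodI :=
    fun p => by
      have h1 : Continuous fun y => (ω p * ‖fourierInt (fun x => Φ (x, y)) p‖) ^ 2 :=
        (continuous_const.mul (hc p).norm).pow 2
      exact (h1.continuousOn.integrableOn_Icc (a := -Real.pi) (b := Real.pi)).mono_set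
        Ioo_subset_Icc_self
  have h1 : ∀ p, ∑ q ∈ Q, (ω p * ‖fourierInt₂ Φ (p, q)‖) ^ 2 ≤
      2 * Real.pi * ∫ y in periodI, (ω p * ‖fourierInt (fun x => Φ (x, y)) p‖) ^ 2 := by
    intro p
    obtain ⟨N, hN⟩ := hb p
    have h2 := sum_le_hasSum Q (fun q _ => by positivity)
      (hasSum_sq_fourierInt (hc p).aestronglyMeasurable hN)
    simp only [mul_pow, integral_const_mul, ← Finset.mul_sum]
    calc ω p ^ 2 * ∑ q ∈ Q, ‖fourierInt₂ Φ (p, q)‖ ^ 2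
        ≤ ω p ^ 2 * (2 * Real.pi * ∫ y in periodI, ‖fourierInt (fun x => Φ (x, y)) p‖ ^ 2) := by
          gcongr
          exact h2
      _ = _ := by ring
  refine (Finset.sum_le_sum fun p _ => h1 p).trans ?_
  rw [← Finset.mul_sum, ← integral_finsetSum _ fun p _ => hi p]
  have h3 : ∫ y in periodI, ∑ p ∈ P, (ω p * ‖fourierInt (fun x => Φ (x, y)) p‖) ^ 2 ≤
      2 * Real.pi * M := by
    refine setIntegral_periodI_le fun y hy => ?_
    rw [Real.norm_of_nonneg (Finset.sum_nonneg fun p _ => by positivity)]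
    exact hM y hy
  have := Real.pi_pos
  nlinarith

/-- The Fourier coefficients of a periodic function of class `C^{m,α}` of two variables. -/
theorem summable_fourierInt₂ (m : ℕ) {α τ : ℝ} (hτ0 : 0 < τ) (hτ : τ < m + α) :
    ∃ C : ℝ, 0 ≤ C ∧ ∀ (Φ : ℝ × ℝ → ℂ) (N : ℝ), 0 ≤ N → Continuous Φ →
      (∀ y, ContDiff ℝ m fun x => Φ (x, y)) → (∀ x, ContDiff ℝ m fun y => Φ (x, y)) →
      (∀ y, Function.Periodic (fun x => Φ (x, y)) (2 * Real.pi)) →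
      (∀ x, Function.Periodic (fun y => Φ (x, y)) (2 * Real.pi)) →
      (∀ x ∈ periodI, ∀ y ∈ periodI, ‖Φ (x, y)‖ ≤ N) →
      (∀ y ∈ periodI, ∀ x ∈ periodI, ‖iteratedDeriv m (fun t => Φ (t, y)) x‖ ≤ N) →
      (∀ x ∈ periodI, ∀ y ∈ periodI, ‖iteratedDeriv m (fun t => Φ (x, t)) y‖ ≤ N) →
      (α ≠ 0 → ∀ y ∈ periodI, ∀ x ∈ periodI, ∀ x' ∈ periodI,
        ‖iteratedDeriv m (fun t => Φ (t, y)) x - iteratedDeriv m (fun t => Φ (t, y)) x'‖ ≤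
          N * |x - x'| ^ α) →
      (α ≠ 0 → ∀ x ∈ periodI, ∀ y ∈ periodI, ∀ y' ∈ periodI,
        ‖iteratedDeriv m (fun t => Φ (x, t)) y - iteratedDeriv m (fun t => Φ (x, t)) y'‖ ≤
          N * |y - y'| ^ α) →
      (Summable fun p => (latticeWeight p ^ τ * ‖fourierInt₂ Φ p‖) ^ 2) ∧
      ∑' p, (latticeWeight p ^ τ * ‖fourierInt₂ Φ p‖) ^ 2 ≤ (C * N) ^ 2 := by
  obtain ⟨C, hC, hreg⟩ := sum_abs_rpow_fourierInt_le m hτ0 hτ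
  set M := ((3 : ℝ) ^ τ) ^ 2 * (2 * Real.pi) ^ 2 * ((2 * Real.pi) ^ 2 + C + C) with hM
  have hM0 : 0 ≤ M := by positivity
  refine ⟨Real.sqrt M, Real.sqrt_nonneg _, ?_⟩
  intro Φ N hN hΦ hd1 hd2 hp1 hp2 hb hb1 hb2 hh1 hh2
  have hsum : ∀ F : Finset (ℤ × ℤ),
      ∑ p ∈ F, (latticeWeight p ^ τ * ‖fourierInt₂ Φ p‖) ^ 2 ≤ (Real.sqrt M * N) ^ 2 := by
    intro F
    rw [mul_pow, Real.sq_sqrt hM0]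
    set P := F.image Prod.fst
    set Q := F.image Prod.snd
    have hsub : F ⊆ P ×ˢ Q := fun p hp =>
      Finset.mem_product.2 ⟨Finset.mem_image_of_mem _ hp, Finset.mem_image_of_mem _ hp⟩
    -- The weight is at most 3^τ max(1, |p|, |q|)^τ, so three sums with weights in a single variable
    -- suffice, and only the pure derivatives of order m enter.
    have e0 : ∑ p ∈ P, ∑ q ∈ Q, (1 * ‖fourierInt₂ Φ (p, q)‖) ^ 2 ≤
        (2 * Real.pi) ^ 2 * ((2 * Real.pi) ^ 2 * N ^ 2) := by
      refine sum_sq_fourierInt₂_le hΦ (fun _ => 1) P Q fun y hy => ?_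
      simp only [one_mul]
      refine sum_sq_fourierInt_le ?_ (fun x hx => hb x hx y hy) P
      exact (hΦ.comp (Continuous.prodMk_left y)).aestronglyMeasurable
    have e1 : ∑ p ∈ P, ∑ q ∈ Q, (|(p : ℝ)| ^ τ * ‖fourierInt₂ Φ (p, q)‖) ^ 2 ≤
        (2 * Real.pi) ^ 2 * (C * N ^ 2) := by
      refine sum_sq_fourierInt₂_le hΦ (fun p => |(p : ℝ)| ^ τ) P Q fun y hy => ?_
      exact hreg _ N (hd1 y) (hp1 y) hN (hb1 y hy) (fun hα => hh1 hα y hy) P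
    have e2 : ∑ q ∈ Q, ∑ p ∈ P, (|(q : ℝ)| ^ τ * ‖fourierInt₂ Φ (p, q)‖) ^ 2 ≤
        (2 * Real.pi) ^ 2 * (C * N ^ 2) := by
      have h := sum_sq_fourierInt₂_le (hΦ.comp continuous_swap) (fun p => |(p : ℝ)| ^ τ) Q P
        (M := C * N ^ 2) fun y hy =>
          hreg _ N (hd2 y) (hp2 y) hN (hb2 y hy) (fun hα => hh2 hα y hy) Q
      have h' : ∀ p q, fourierInt₂ (Φ ∘ Prod.swap) (q, p) = fourierInt₂ Φ (p, q) := fun p q =>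
        fourierInt₂_swap hΦ (p, q)
      simpa only [h'] using h
    rw [Finset.sum_comm] at e2
    have hterm : ∀ p q : ℤ, (latticeWeight (p, q) ^ τ * ‖fourierInt₂ Φ (p, q)‖) ^ 2 ≤
        ((3 : ℝ) ^ τ) ^ 2 * ((1 * ‖fourierInt₂ Φ (p, q)‖) ^ 2 +
          (|(p : ℝ)| ^ τ * ‖fourierInt₂ Φ (p, q)‖) ^ 2 +
          (|(q : ℝ)| ^ τ * ‖fourierInt₂ Φ (p, q)‖) ^ 2) := by
      intro p q
      have hp := abs_nonneg (p : ℝ)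
      have hq := abs_nonneg (q : ℝ)
      have key : ∀ z : ℝ, 0 ≤ z → latticeWeight (p, q) ≤ 3 * z →
          (latticeWeight (p, q) ^ τ * ‖fourierInt₂ Φ (p, q)‖) ^ 2 ≤
            ((3 : ℝ) ^ τ) ^ 2 * (z ^ τ * ‖fourierInt₂ Φ (p, q)‖) ^ 2 := by
        intro z hz h
        rw [← mul_pow, ← mul_assoc, ← Real.mul_rpow (by norm_num) hz]
        have := latticeWeight_pos (p, q)
        gcongr
      have n0 : 0 ≤ (1 * ‖fourierInt₂ Φ (p, q)‖) ^ 2 := by positivity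
      have n1 : 0 ≤ (|(p : ℝ)| ^ τ * ‖fourierInt₂ Φ (p, q)‖) ^ 2 := by positivity
      have n2 : 0 ≤ (|(q : ℝ)| ^ τ * ‖fourierInt₂ Φ (p, q)‖) ^ 2 := by positivity
      have hL : latticeWeight (p, q) = 1 + |(p : ℝ)| + |(q : ℝ)| := rfl
      have h3 : (0 : ℝ) ≤ ((3 : ℝ) ^ τ) ^ 2 := by positivity
      rcases le_total |(p : ℝ)| 1 with h | h
      · rcases le_total |(q : ℝ)| 1 with h' | h'
        · have := key 1 (by norm_num) (by rw [hL]; linarith)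
          rw [Real.one_rpow] at this
          exact this.trans (mul_le_mul_of_nonneg_left (by linarith) h3)
        · exact (key _ hq (by rw [hL]; linarith)).trans
            (mul_le_mul_of_nonneg_left (by linarith) h3)
      · rcases le_total |(q : ℝ)| |(p : ℝ)| with h' | h'
        · exact (key _ hp (by rw [hL]; linarith)).trans
            (mul_le_mul_of_nonneg_left (by linarith) h3)
        · exact (key _ hq (by rw [hL]; linarith)).trans
            (mul_le_mul_of_nonneg_left (by linarith) h3)
    calc ∑ p ∈ F, (latticeWeight p ^ τ * ‖fourierInt₂ Φ p‖) ^ 2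
        ≤ ∑ p ∈ P ×ˢ Q, (latticeWeight p ^ τ * ‖fourierInt₂ Φ p‖) ^ 2 :=
          Finset.sum_le_sum_of_subset_of_nonneg hsub fun p _ _ => by positivity
      _ = ∑ p ∈ P, ∑ q ∈ Q, (latticeWeight (p, q) ^ τ * ‖fourierInt₂ Φ (p, q)‖) ^ 2 :=
          Finset.sum_product _ _ _
      _ ≤ ∑ p ∈ P, ∑ q ∈ Q, ((3 : ℝ) ^ τ) ^ 2 * ((1 * ‖fourierInt₂ Φ (p, q)‖) ^ 2 +
          (|(p : ℝ)| ^ τ * ‖fourierInt₂ Φ (p, q)‖) ^ 2 +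
          (|(q : ℝ)| ^ τ * ‖fourierInt₂ Φ (p, q)‖) ^ 2) :=
          Finset.sum_le_sum fun p _ => Finset.sum_le_sum fun q _ => hterm p q
      _ = ((3 : ℝ) ^ τ) ^ 2 * (∑ p ∈ P, ∑ q ∈ Q, (1 * ‖fourierInt₂ Φ (p, q)‖) ^ 2 +
          ∑ p ∈ P, ∑ q ∈ Q, (|(p : ℝ)| ^ τ * ‖fourierInt₂ Φ (p, q)‖) ^ 2 +
          ∑ p ∈ P, ∑ q ∈ Q, (|(q : ℝ)| ^ τ * ‖fourierInt₂ Φ (p, q)‖) ^ 2) := by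
          simp only [← Finset.mul_sum, Finset.sum_add_distrib]
      _ ≤ ((3 : ℝ) ^ τ) ^ 2 * ((2 * Real.pi) ^ 2 * ((2 * Real.pi) ^ 2 * N ^ 2) +
          (2 * Real.pi) ^ 2 * (C * N ^ 2) + (2 * Real.pi) ^ 2 * (C * N ^ 2)) := by gcongr
      _ = M * N ^ 2 := by
          rw [hM]
          ring
  exact ⟨summable_of_sum_le (fun p => by positivity) hsum,
    Real.tsum_le_of_sum_le (fun p => by positivity) hsum⟩

/-- A continuous periodic function with summable Fourier coefficients is the sum of its
Fourier series. -/
theorem hasSum_fourierInt {g : ℝ → ℂ} (hg : Continuous g)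
    (hp : Function.Periodic g (2 * Real.pi)) (hs : Summable (fourierInt g)) (x : ℝ) :
    HasSum (fun p => ((2 * Real.pi : ℝ) : ℂ)⁻¹ * fourierInt g p * expI p x) (g x) := by
  have : Fact (0 < 2 * Real.pi) := ⟨Real.two_pi_pos⟩
  let f : C(AddCircle (2 * Real.pi), ℂ) := ⟨hp.lift, continuous_coinduced_dom.2 hg⟩
  have hf : ∀ y : ℝ, f (y : AddCircle (2 * Real.pi)) = g y := fun y => hp.lift_coe y
  have hexp : ∀ (n : ℤ) (y : ℝ), fourier n (y : AddCircle (2 * Real.pi)) = expI n y := by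
    intro n y
    rw [fourier_coe_apply, expI]
    congr 1
    have : (Real.pi : ℂ) ≠ 0 := by exact_mod_cast Real.pi_ne_zero
    push_cast
    field_simp
  have hcoef : ∀ n, fourierCoeff f n = ((2 * Real.pi : ℝ) : ℂ)⁻¹ * fourierInt g n := by
    intro n
    rw [fourierCoeff_eq_intervalIntegral _ _ (-Real.pi), Complex.real_smul, fourierInt,
      setIntegral_periodI, show -Real.pi + 2 * Real.pi = Real.pi by ring]
    congr 1
    · push_cast
      ring
    · congr 1
      funext y
      rw [hexp, hf, smul_eq_mul, mul_comm]
  have h := has_pointwise_sum_fourier_series_of_summable (f := f) (by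
    simp only [funext hcoef]
    exact hs.mul_left _) (x : AddCircle (2 * Real.pi))
  rw [hf] at h
  have e : (fun p => ((2 * Real.pi : ℝ) : ℂ)⁻¹ * fourierInt g p * expI p x) =
      fun p => fourierCoeff f p • fourier p (x : AddCircle (2 * Real.pi)) := by
    funext p
    rw [hcoef, hexp, smul_eq_mul]
  rw [e]
  exact h

/-- Each x-coefficient is expanded in y, and the slice at fixed y is expanded in x; absolute
summability identifies the iterated sum with the double sum. -/
theorem hasSum_fourierInt₂ {Φ : ℝ × ℝ → ℂ} (hΦ : Continuous Φ)
    (hp1 : ∀ y, Function.Periodic (fun x => Φ (x, y)) (2 * Real.pi))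
    (hp2 : ∀ x, Function.Periodic (fun y => Φ (x, y)) (2 * Real.pi))
    (hs : Summable (fourierInt₂ Φ)) (x : ℝ × ℝ) :
    HasSum (fun p : ℤ × ℤ => (((2 * Real.pi : ℝ) : ℂ)⁻¹ ^ 2 * fourierInt₂ Φ p) *
      (expI p.1 x.1 * expI p.2 x.2)) (Φ x) := by
  have hpi : ‖((2 * Real.pi : ℝ) : ℂ)⁻¹‖ = (2 * Real.pi)⁻¹ := by
    rw [norm_inv, Complex.norm_real, Real.norm_of_nonneg Real.two_pi_pos.le]
  have hsl : ∀ p y, HasSum (fun q => ((2 * Real.pi : ℝ) : ℂ)⁻¹ * fourierInt₂ Φ (p, q) * expI q y)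
      (fourierInt (fun x => Φ (x, y)) p) := by
    intro p y
    refine hasSum_fourierInt (g := fun y => fourierInt (fun x => Φ (x, y)) p)
      (continuous_fourierInt_slice hΦ p) (fun y => ?_) (hs.prod_factor p) y
    have : (fun x => Φ (x, y + 2 * Real.pi)) = fun x => Φ (x, y) := funext fun x => hp2 x y
    simp only [this]
  have hns : Summable fun p => ‖fourierInt₂ Φ p‖ := hs.norm
  have hs1 : Summable fun p => fourierInt (fun t => Φ (t, x.2)) p := by
    refine Summable.of_norm_bounded (g := fun p => (2 * Real.pi)⁻¹ *
      ∑' q, ‖fourierInt₂ Φ (p, q)‖) (hns.prod.mul_left _) fun p => ?_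
    rw [← (hsl p x.2).tsum_eq, ← tsum_mul_left]
    have e : ∀ q, ‖((2 * Real.pi : ℝ) : ℂ)⁻¹ * fourierInt₂ Φ (p, q) * expI q x.2‖ =
        (2 * Real.pi)⁻¹ * ‖fourierInt₂ Φ (p, q)‖ := fun q => by
      rw [norm_mul, norm_mul, norm_expI, mul_one, hpi]
    refine (norm_tsum_le_tsum_norm ?_).trans (le_of_eq ?_)
    · simp only [e]
      exact (hns.prod_factor p).mul_left _
    · simp only [e]
  have h1 := hasSum_fourierInt (hΦ.comp (Continuous.prodMk_left x.2)) (hp1 x.2) hs1 x.1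
  have htot : Summable fun p : ℤ × ℤ => (((2 * Real.pi : ℝ) : ℂ)⁻¹ ^ 2 * fourierInt₂ Φ p) *
      (expI p.1 x.1 * expI p.2 x.2) := by
    refine Summable.of_norm ?_
    have e : ∀ p : ℤ × ℤ, ‖(((2 * Real.pi : ℝ) : ℂ)⁻¹ ^ 2 * fourierInt₂ Φ p) *
        (expI p.1 x.1 * expI p.2 x.2)‖ = (2 * Real.pi)⁻¹ ^ 2 * ‖fourierInt₂ Φ p‖ := fun p => by
      rw [norm_mul, norm_mul, norm_mul, norm_expI, norm_expI, norm_pow, hpi]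
      ring
    simp only [e]
    exact hns.mul_left _
  have h2 := htot.hasSum.prod_fiberwise fun p => by
    have h3 := (hsl p x.2).mul_left (((2 * Real.pi : ℝ) : ℂ)⁻¹ * expI p x.1)
    refine h3.congr_fun fun q => ?_
    ring
  have h4 : HasSum (fun p => ((2 * Real.pi : ℝ) : ℂ)⁻¹ * expI p x.1 *
      fourierInt (fun t => Φ (t, x.2)) p) (Φ x) := by
    refine h1.congr_fun fun p => ?_
    simp only [Function.comp_def]
    ring
  rw [← h2.unique h4]
  exact htot.hasSum

noncomputable section

/-! ### Partial derivatives in the plane -/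

/-- The partial derivative in the first variable. -/
def pderivFst (g : ℝ × ℝ → ℂ) (x : ℝ × ℝ) : ℂ := deriv (fun t => g (t, x.2)) x.1

/-- The partial derivative in the second variable. -/
def pderivSnd (g : ℝ × ℝ → ℂ) (x : ℝ × ℝ) : ℂ := deriv (fun τ => g (x.1, τ)) x.2

theorem iteratedDeriv_fst (g : ℝ × ℝ → ℂ) (i : ℕ) (x : ℝ × ℝ) :
    iteratedDeriv i (fun t => g (t, x.2)) x.1 = pderivFst^[i] g x := by
  induction i generalizing x with
  | zero => simp
  | succ i ih =>
    rw [iteratedDeriv_succ, Function.iterate_succ_apply', pderivFst]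
    congr 1
    ext t
    exact ih (t, x.2)

theorem iteratedDeriv_snd (g : ℝ × ℝ → ℂ) (i : ℕ) (x : ℝ × ℝ) :
    iteratedDeriv i (fun τ => g (x.1, τ)) x.2 = pderivSnd^[i] g x := by
  induction i generalizing x with
  | zero => simp
  | succ i ih =>
    rw [iteratedDeriv_succ, Function.iterate_succ_apply', pderivSnd]
    congr 1
    ext t
    exact ih (x.1, t)

theorem partialDeriv_eq_iterate (i j : ℕ) (f : ℝ × ℝ → ℂ) :
    partialDeriv (i, j) f = pderivFst^[i] (pderivSnd^[j] f) := by
  ext x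
  rw [← iteratedDeriv_fst, partialDeriv]
  congr 1
  ext t
  exact iteratedDeriv_snd f j (t, x.2)

theorem HasFDerivAt.hasDerivAt_fst {g : ℝ × ℝ → ℂ} {L : ℝ × ℝ →L[ℝ] ℂ} {x : ℝ × ℝ}
    (h : HasFDerivAt g L x) : HasDerivAt (fun t => g (t, x.2)) (L (1, 0)) x.1 := by
  have h1 : HasDerivAt (fun t : ℝ => (t, x.2)) ((1 : ℝ), (0 : ℝ)) x.1 :=
    (hasDerivAt_id x.1).prodMk (hasDerivAt_const x.1 x.2)
  exact h.comp_hasDerivAt x.1 h1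

theorem HasFDerivAt.hasDerivAt_snd {g : ℝ × ℝ → ℂ} {L : ℝ × ℝ →L[ℝ] ℂ} {x : ℝ × ℝ}
    (h : HasFDerivAt g L x) : HasDerivAt (fun t => g (x.1, t)) (L (0, 1)) x.2 := by
  have h1 : HasDerivAt (fun t : ℝ => (x.1, t)) ((0 : ℝ), (1 : ℝ)) x.2 :=
    (hasDerivAt_const x.2 x.1).prodMk (hasDerivAt_id x.2)
  exact h.comp_hasDerivAt x.2 h1

theorem ContDiffOn.hasFDerivAt_of_isOpen {g : ℝ × ℝ → ℂ} {U : Set (ℝ × ℝ)} {n : ℕ}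
    (hU : IsOpen U) (hg : ContDiffOn ℝ (n + 1 : ℕ) g U) {x : ℝ × ℝ} (hx : x ∈ U) :
    HasFDerivAt g (fderiv ℝ g x) x :=
  ((hg.contDiffAt (hU.mem_nhds hx)).differentiableAt (by simp)).hasFDerivAt

theorem pderivFst_eq_fderiv {g : ℝ × ℝ → ℂ} {U : Set (ℝ × ℝ)} {n : ℕ}
    (hU : IsOpen U) (hg : ContDiffOn ℝ (n + 1 : ℕ) g U) :
    EqOn (pderivFst g) (fun x => fderiv ℝ g x (1, 0)) U := fun _ hx =>
  ((hg.hasFDerivAt_of_isOpen hU hx).hasDerivAt_fst).deriv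

theorem pderivSnd_eq_fderiv {g : ℝ × ℝ → ℂ} {U : Set (ℝ × ℝ)} {n : ℕ}
    (hU : IsOpen U) (hg : ContDiffOn ℝ (n + 1 : ℕ) g U) :
    EqOn (pderivSnd g) (fun x => fderiv ℝ g x (0, 1)) U := fun _ hx =>
  ((hg.hasFDerivAt_of_isOpen hU hx).hasDerivAt_snd).deriv

theorem ContDiffOn.pderivFst {g : ℝ × ℝ → ℂ} {U : Set (ℝ × ℝ)} {n : ℕ}
    (hU : IsOpen U) (hg : ContDiffOn ℝ (n + 1 : ℕ) g U) :
    ContDiffOn ℝ n (pderivFst g) U :=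
  ((hg.fderiv_of_isOpen hU (by norm_cast)).clm_apply contDiffOn_const).congr
    (pderivFst_eq_fderiv hU hg)

theorem ContDiffOn.pderivSnd {g : ℝ × ℝ → ℂ} {U : Set (ℝ × ℝ)} {n : ℕ}
    (hU : IsOpen U) (hg : ContDiffOn ℝ (n + 1 : ℕ) g U) :
    ContDiffOn ℝ n (pderivSnd g) U :=
  ((hg.fderiv_of_isOpen hU (by norm_cast)).clm_apply contDiffOn_const).congr
    (pderivSnd_eq_fderiv hU hg)

theorem pderivFst_congr {g h : ℝ × ℝ → ℂ} {U : Set (ℝ × ℝ)} (hU : IsOpen U) (H : EqOn g h U) :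
    EqOn (pderivFst g) (pderivFst h) U := by
  intro x hx
  refine Filter.EventuallyEq.deriv_eq ?_
  have hc : ContinuousAt (fun t : ℝ => (t, x.2)) x.1 := by fun_prop
  filter_upwards [hc.preimage_mem_nhds (hU.mem_nhds hx)] with t ht using H ht

theorem pderivSnd_congr {g h : ℝ × ℝ → ℂ} {U : Set (ℝ × ℝ)} (hU : IsOpen U) (H : EqOn g h U) :
    EqOn (pderivSnd g) (pderivSnd h) U := by
  intro x hx
  refine Filter.EventuallyEq.deriv_eq ?_
  have hc : ContinuousAt (fun t : ℝ => (x.1, t)) x.2 := by fun_prop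
  filter_upwards [hc.preimage_mem_nhds (hU.mem_nhds hx)] with t ht using H ht

theorem pderivSnd_pderivFst {g : ℝ × ℝ → ℂ} {U : Set (ℝ × ℝ)} {n : ℕ}
    (hU : IsOpen U) (hg : ContDiffOn ℝ (n + 2 : ℕ) g U) :
    EqOn (pderivSnd (pderivFst g)) (pderivFst (pderivSnd g)) U := by
  intro x hx
  have hg' : ContDiffOn ℝ (n + 1 + 1 : ℕ) g U := hg
  rw [pderivSnd_congr hU (pderivFst_eq_fderiv hU hg') hx,
    pderivFst_congr hU (pderivSnd_eq_fderiv hU hg') hx]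
  have hd : HasFDerivAt (fderiv ℝ g) (fderiv ℝ (fderiv ℝ g) x) x := by
    have h1 : ContDiffOn ℝ (n + 1 : ℕ) (fderiv ℝ g) U :=
      hg'.fderiv_of_isOpen hU (by norm_cast)
    exact ((h1.contDiffAt (hU.mem_nhds hx)).differentiableAt (by simp)).hasFDerivAt
  have hsym : IsSymmSndFDerivAt ℝ g x := by
    refine (hg.contDiffAt (hU.mem_nhds hx)).isSymmSndFDerivAt ?_
    simp only [minSmoothness_of_isRCLikeNormedField]
    norm_cast
    omega
  have e1 : HasFDerivAt (fun y => fderiv ℝ g y (1, 0))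
      ((ContinuousLinearMap.apply ℝ ℂ ((1 : ℝ), (0 : ℝ))).comp (fderiv ℝ (fderiv ℝ g) x)) x :=
    (ContinuousLinearMap.apply ℝ ℂ ((1 : ℝ), (0 : ℝ))).hasFDerivAt.comp x hd
  have e2 : HasFDerivAt (fun y => fderiv ℝ g y (0, 1))
      ((ContinuousLinearMap.apply ℝ ℂ ((0 : ℝ), (1 : ℝ))).comp (fderiv ℝ (fderiv ℝ g) x)) x :=
    (ContinuousLinearMap.apply ℝ ℂ ((0 : ℝ), (1 : ℝ))).hasFDerivAt.comp x hd
  rw [pderivSnd, pderivFst, e1.hasDerivAt_snd.deriv, e2.hasDerivAt_fst.deriv]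
  exact hsym.eq _ _

theorem contDiffOn_iterate_pderiv {f : ℝ × ℝ → ℂ} {U : Set (ℝ × ℝ)} {m : ℕ} (hU : IsOpen U)
    (hf : ContDiffOn ℝ m f U) (i j n : ℕ) (h : i + j + n = m) :
    ContDiffOn ℝ n (pderivFst^[i] (pderivSnd^[j] f)) U := by
  induction i generalizing n with
  | zero =>
    induction j generalizing n with
    | zero =>
      obtain rfl : n = m := by omega
      exact hf
    | succ j ih =>
      simp only [Function.iterate_zero, id_eq, Function.iterate_succ_apply'] at ih ⊢
      exact (ih (n + 1) (by omega)).pderivSnd hU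
  | succ i ih =>
    rw [Function.iterate_succ_apply']
    exact (ih (n + 1) (by omega)).pderivFst hU

/-- In `partialDeriv` the second variable is differentiated first, so a further derivative in it has
to be commuted past all derivatives in the first variable. -/
theorem pderivSnd_iterate_pderiv {f : ℝ × ℝ → ℂ} {U : Set (ℝ × ℝ)} {m : ℕ} (hU : IsOpen U)
    (hf : ContDiffOn ℝ m f U) (i j n : ℕ) (h : i + j + (n + 1) = m) :
    EqOn (pderivSnd (pderivFst^[i] (pderivSnd^[j] f)))
      (pderivFst^[i] (pderivSnd^[j + 1] f)) U := by
  induction i generalizing n with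
  | zero => simp only [Function.iterate_zero, id_eq, Function.iterate_succ_apply']; exact fun _ _ => rfl
  | succ i ih =>
    intro x hx
    rw [Function.iterate_succ_apply', Function.iterate_succ_apply',
      pderivSnd_pderivFst hU (contDiffOn_iterate_pderiv hU hf i j (n + 2) (by omega)) hx]
    exact pderivFst_congr hU (ih (n + 1) (by omega)) hx

theorem hasDerivAt_partialDeriv_fst {f : ℝ × ℝ → ℂ} {U : Set (ℝ × ℝ)} {m : ℕ} (hU : IsOpen U)
    (hf : ContDiffOn ℝ m f U) {i j : ℕ} (h : i + j + 1 ≤ m) {x : ℝ × ℝ} (hx : x ∈ U) :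
    HasDerivAt (fun t => partialDeriv (i, j) f (t, x.2)) (partialDeriv (i + 1, j) f x) x.1 := by
  obtain ⟨n, hn⟩ := Nat.exists_eq_add_of_le h
  have h1 := contDiffOn_iterate_pderiv hU hf i j (n + 1) (by omega)
  rw [partialDeriv_eq_iterate, partialDeriv_eq_iterate, Function.iterate_succ_apply']
  have h2 := (h1.hasFDerivAt_of_isOpen hU hx).hasDerivAt_fst
  rwa [pderivFst, h2.deriv]

theorem hasDerivAt_partialDeriv_snd {f : ℝ × ℝ → ℂ} {U : Set (ℝ × ℝ)} {m : ℕ} (hU : IsOpen U)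
    (hf : ContDiffOn ℝ m f U) {i j : ℕ} (h : i + j + 1 ≤ m) {x : ℝ × ℝ} (hx : x ∈ U) :
    HasDerivAt (fun t => partialDeriv (i, j) f (x.1, t)) (partialDeriv (i, j + 1) f x) x.2 := by
  obtain ⟨n, hn⟩ := Nat.exists_eq_add_of_le h
  have h1 := contDiffOn_iterate_pderiv hU hf i j (n + 1) (by omega)
  have h3 := pderivSnd_iterate_pderiv hU hf i j n (by omega) hx
  rw [partialDeriv_eq_iterate, partialDeriv_eq_iterate, ← h3]
  have h2 := (h1.hasFDerivAt_of_isOpen hU hx).hasDerivAt_snd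
  rwa [pderivSnd, h2.deriv]

end

noncomputable section

/-! ### Jets of functions of two variables -/

/-- For y outside `S` the fundamental theorem of calculus with a countable exceptional set gives
G(θ,y) - G(0,y) = ∫H. Both sides are continuous in y, so this holds for all y, and differentiating
the integral of the continuous `H` gives the derivative everywhere. It supplies the chain rule where
the cosine reaches the edge of the square. -/
theorem hasDerivAt_fst_of_off_countable {G H : ℝ × ℝ → ℂ} {S : Set ℝ} (hS : S.Countable)
    (hG : Continuous G) (hH : Continuous H)
    (hd : ∀ x : ℝ × ℝ, x.1 ∉ S → x.2 ∉ S → HasDerivAt (fun t => G (t, x.2)) (H x) x.1)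
    (x : ℝ × ℝ) : HasDerivAt (fun t => G (t, x.2)) (H x) x.1 := by
  have h1 : ∀ y θ : ℝ, y ∈ Sᶜ → ∫ t in (0 : ℝ)..θ, H (t, y) = G (θ, y) - G (0, y) := by
    intro y θ hy
    refine integral_eq_of_hasDerivAt_off_countable (fun t => G (t, y)) (fun t => H (t, y)) hS
      (by fun_prop) (fun t ht => hd (t, y) ht.2 hy) ?_
    exact Continuous.intervalIntegrable (by fun_prop) _ _
  have h2 : ∀ θ y : ℝ, ∫ t in (0 : ℝ)..θ, H (t, y) = G (θ, y) - G (0, y) := by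
    intro θ
    refine congrFun (Continuous.ext_on (hS.dense_compl ℝ) ?_ ?_ fun y hy => h1 y θ hy)
    · refine intervalIntegral.continuous_parametric_intervalIntegral_of_continuous'
        (f := fun y t => H (t, y)) ?_ 0 θ
      exact hH.comp continuous_swap
    · fun_prop
  have hc : Continuous fun t => H (t, x.2) := by fun_prop
  have h3 := (hc.integral_hasStrictDerivAt 0 x.1).hasDerivAt.const_add (G (0, x.2))
  refine h3.congr_of_eventuallyEq (Filter.Eventually.of_forall fun θ => ?_)
  show G (θ, x.2) = G (0, x.2) + ∫ t in (0 : ℝ)..θ, H (t, x.2)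
  rw [h2]
  ring

theorem hasDerivAt_snd_of_off_countable {G H : ℝ × ℝ → ℂ} {S : Set ℝ} (hS : S.Countable)
    (hG : Continuous G) (hH : Continuous H)
    (hd : ∀ x : ℝ × ℝ, x.1 ∉ S → x.2 ∉ S → HasDerivAt (fun t => G (x.1, t)) (H x) x.2)
    (x : ℝ × ℝ) : HasDerivAt (fun t => G (x.1, t)) (H x) x.2 :=
  hasDerivAt_fst_of_off_countable hS (hG.comp continuous_swap) (hH.comp continuous_swap)
    (fun y h1 h2 => hd y.swap h2 h1) x.swap

/-- The functions `P i j`, for `i + j ≤ m`, are continuous and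
`∂₁ P i j = r(x₁) P (i + 1) j`, `∂₂ P i j = r(x₂) P i (j + 1)`. -/
structure IsJet (m : ℕ) (r : ℝ → ℝ) (P : ℕ → ℕ → ℝ × ℝ → ℂ) : Prop where
  continuous : ∀ i j, i + j ≤ m → Continuous (P i j)
  fst : ∀ i j, i + j + 1 ≤ m → ∀ x : ℝ × ℝ,
    HasDerivAt (fun t => P i j (t, x.2)) (r x.1 * P (i + 1) j x) x.1
  snd : ∀ i j, i + j + 1 ≤ m → ∀ x : ℝ × ℝ,
    HasDerivAt (fun t => P i j (x.1, t)) (r x.2 * P i (j + 1) x) x.2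

theorem IsJet.partialDeriv_eq {m : ℕ} {P : ℕ → ℕ → ℝ × ℝ → ℂ} (hP : IsJet m (fun _ => 1) P)
    (i j : ℕ) (h : i + j ≤ m) : partialDeriv (i, j) (P 0 0) = P i j := by
  rw [partialDeriv_eq_iterate]
  have h2 : ∀ j ≤ m, pderivSnd^[j] (P 0 0) = P 0 j := by
    intro j hj
    induction j with
    | zero => rfl
    | succ j ih =>
      rw [Function.iterate_succ_apply', ih (by omega)]
      ext x
      simpa [pderivSnd] using (hP.snd 0 j (by omega) x).deriv
  rw [h2 j (by omega)]
  induction i with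
  | zero => rfl
  | succ i ih =>
    rw [Function.iterate_succ_apply', ih (by omega)]
    ext x
    simpa [pderivFst] using (hP.fst i j (by omega) x).deriv

/-- Continuous partial derivatives give differentiability, and the total derivative is assembled
from the next members of the jet, which are smooth of one order less by induction. -/
theorem IsJet.contDiff {m : ℕ} {P : ℕ → ℕ → ℝ × ℝ → ℂ} (hP : IsJet m (fun _ => 1) P)
    (n i j : ℕ) (h : i + j + n ≤ m) : ContDiff ℝ n (P i j) := by
  induction n generalizing i j with
  | zero => exact contDiff_zero.2 (hP.continuous i j (by omega))
  | succ n ih =>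
    have c1 := ih (i + 1) j (by omega)
    have c2 := ih i (j + 1) (by omega)
    have e : ((n + 1 : ℕ) : WithTop ℕ∞) = n + 1 := by norm_cast
    rw [e, contDiff_succ_iff_hasFDerivAt]
    have d1 : ContDiff ℝ n fun x => ContinuousLinearMap.smulRight (1 : ℝ →L[ℝ] ℝ) (P (i + 1) j x) :=
      contDiff_const.smulRight c1
    have d2 : ContDiff ℝ n fun x => ContinuousLinearMap.smulRight (1 : ℝ →L[ℝ] ℝ) (P i (j + 1) x) :=
      contDiff_const.smulRight c2
    refine ⟨fun x => (ContinuousLinearMap.smulRight (1 : ℝ →L[ℝ] ℝ) (P (i + 1) j x)).coprod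
      (ContinuousLinearMap.smulRight (1 : ℝ →L[ℝ] ℝ) (P i (j + 1) x)), ?_, fun x => ?_⟩
    · have e2 : ∀ L M : ℝ →L[ℝ] ℂ, L.coprod M =
          L.comp (ContinuousLinearMap.fst ℝ ℝ ℝ) + M.comp (ContinuousLinearMap.snd ℝ ℝ ℝ) := by
        intro L M; ext <;> simp
      simp only [e2]
      exact (d1.clm_comp contDiff_const).add (d2.clm_comp contDiff_const)
    · refine HasStrictFDerivAt.hasFDerivAt ?_
      refine hasStrictFDerivAt_uncurry_coprod (f := fun a b => P i j (a, b))
        (f₁ := fun a b => ContinuousLinearMap.smulRight (1 : ℝ →L[ℝ] ℝ) (P (i + 1) j (a, b)))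
        (f₂ := fun a b => ContinuousLinearMap.smulRight (1 : ℝ →L[ℝ] ℝ) (P i (j + 1) (a, b)))
        (Filter.Eventually.of_forall fun v => ?_) (Filter.Eventually.of_forall fun v => ?_)
        d1.continuous.continuousAt d2.continuous.continuousAt
      · have := (hP.fst i j (by omega) v).hasFDerivAt
        refine this.congr_fderiv ?_
        ext
        simp [Function.HasUncurry.uncurry]
      · have := (hP.snd i j (by omega) v).hasFDerivAt
        refine this.congr_fderiv ?_
        ext
        simp [Function.HasUncurry.uncurry]

/-! ### Products of a jet with trigonometric coefficients -/

/-- The coefficients in `(d/dθ)^a (e · H₀) = ∑ᵢ trigCoef e a i · Hᵢ` if `Hᵢ' = -sin · Hᵢ₊₁`. -/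
def trigCoef (e : ℝ → ℝ) : ℕ → ℕ → ℝ → ℝ
  | 0, 0 => e
  | 0, _ + 1 => 0
  | a + 1, 0 => deriv (trigCoef e a 0)
  | a + 1, i + 1 => fun x => deriv (trigCoef e a (i + 1)) x - Real.sin x * trigCoef e a i x

open scoped ContDiff in
theorem contDiff_trigCoef {e : ℝ → ℝ} (he : ContDiff ℝ ∞ e) (a i : ℕ) :
    ContDiff ℝ ∞ (trigCoef e a i) := by
  induction a generalizing i with
  | zero =>
    cases i with
    | zero => exact he
    | succ i => exact contDiff_const
  | succ a ih =>
    have hd : ∀ i, ContDiff ℝ ∞ (deriv (trigCoef e a i)) := fun i =>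
      (contDiff_infty_iff_deriv.1 (ih i)).2
    cases i with
    | zero => exact hd 0
    | succ i => exact (hd (i + 1)).sub (Real.contDiff_sin.mul (ih i))

theorem trigCoef_eq_zero (e : ℝ → ℝ) {a i : ℕ} (h : a < i) : trigCoef e a i = 0 := by
  induction a generalizing i with
  | zero =>
    cases i with
    | zero => omega
    | succ i => rfl
  | succ a ih =>
    cases i with
    | zero => omega
    | succ i =>
      ext x
      simp [trigCoef, ih (show a < i + 1 by omega), ih (show a < i by omega)]

open scoped ContDiff in
theorem hasDerivAt_sum_trigCoef {e : ℝ → ℝ} (he : ContDiff ℝ ∞ e) (a : ℕ) {X : ℕ → ℝ → ℂ} {x : ℝ}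
    (hX : ∀ i ≤ a, HasDerivAt (X i) (-Real.sin x * X (i + 1) x) x) :
    HasDerivAt (fun t => ∑ i ∈ Finset.range (a + 1), (trigCoef e a i t : ℂ) * X i t)
      (∑ i ∈ Finset.range (a + 1 + 1), (trigCoef e (a + 1) i x : ℂ) * X i x) x := by
  have h1 : ∀ i ∈ Finset.range (a + 1), HasDerivAt (fun t => (trigCoef e a i t : ℂ) * X i t)
      (((deriv (trigCoef e a i) x : ℝ) : ℂ) * X i x
        + (trigCoef e a i x : ℂ) * (-Real.sin x * X (i + 1) x)) x := by
    intro i hi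
    have h2 : HasDerivAt (trigCoef e a i) (deriv (trigCoef e a i) x) x :=
      ((contDiff_trigCoef he a i).differentiable (by simp)).differentiableAt.hasDerivAt
    exact h2.ofReal_comp.mul (hX i (by simpa [Nat.lt_succ_iff] using hi))
  have h3 := HasDerivAt.fun_sum h1
  have e3 : ∑ i ∈ Finset.range (a + 1 + 1), (trigCoef e (a + 1) i x : ℂ) * X i x =
      ∑ i ∈ Finset.range (a + 1), (((deriv (trigCoef e a i) x : ℝ) : ℂ) * X i x
        + (trigCoef e a i x : ℂ) * (-Real.sin x * X (i + 1) x)) := by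
    -- The shift of the index loses nothing at the upper end, since the coefficient with index a + 1
    -- at level `a` is identically zero.
    have e4 : ∑ i ∈ Finset.range (a + 1), ((deriv (trigCoef e a i) x : ℝ) : ℂ) * X i x =
        ∑ i ∈ Finset.range (a + 1), ((deriv (trigCoef e a (i + 1)) x : ℝ) : ℂ) * X (i + 1) x
          + ((deriv (trigCoef e a 0) x : ℝ) : ℂ) * X 0 x := by
      rw [← Finset.sum_range_succ' (fun i => ((deriv (trigCoef e a i) x : ℝ) : ℂ) * X i x),
        Finset.sum_range_succ _ (a + 1), trigCoef_eq_zero e (Nat.lt_succ_self a)]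
      have : deriv (0 : ℝ → ℝ) x = 0 := by simp
      simp [this]
    rw [Finset.sum_range_succ', Finset.sum_add_distrib, e4, add_right_comm,
      ← Finset.sum_add_distrib]
    congr 1
    refine Finset.sum_congr rfl fun i _ => ?_
    simp only [trigCoef]
    push_cast
    ring
  rw [e3]
  exact h3

/-- The jet of `e(x₁) e(x₂) G 0 0 x`, if `∂₁ G i j = -sin x₁ · G (i + 1) j` and
`∂₂ G i j = -sin x₂ · G i (j + 1)`. -/
def trigJet (e : ℝ → ℝ) (G : ℕ → ℕ → ℝ × ℝ → ℂ) (a b : ℕ) (x : ℝ × ℝ) : ℂ :=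
  ∑ i ∈ Finset.range (a + 1), (trigCoef e a i x.1 : ℂ) *
    ∑ j ∈ Finset.range (b + 1), (trigCoef e b j x.2 : ℂ) * G i j x

theorem trigJet_comm (e : ℝ → ℝ) (G : ℕ → ℕ → ℝ × ℝ → ℂ) (a b : ℕ) (x : ℝ × ℝ) :
    trigJet e G a b x = ∑ j ∈ Finset.range (b + 1), (trigCoef e b j x.2 : ℂ) *
      ∑ i ∈ Finset.range (a + 1), (trigCoef e a i x.1 : ℂ) * G i j x := by
  simp only [trigJet, Finset.mul_sum]
  rw [Finset.sum_comm]
  refine Finset.sum_congr rfl fun _ _ => Finset.sum_congr rfl fun _ _ => ?_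
  ring

open scoped ContDiff in
theorem IsJet.trigJet {m : ℕ} {G : ℕ → ℕ → ℝ × ℝ → ℂ} (hG : IsJet m (fun x => -Real.sin x) G)
    {e : ℝ → ℝ} (he : ContDiff ℝ ∞ e) : IsJet m (fun _ => 1) (trigJet e G) where
  continuous a b h := by
    have hc : ∀ a i, Continuous (trigCoef e a i) := fun a i => (contDiff_trigCoef he a i).continuous
    unfold _root_.trigJet
    refine continuous_finsetSum _ fun i hi => Continuous.mul ?_
      (continuous_finsetSum _ fun j hj => Continuous.mul ?_ (hG.continuous i j ?_))
    · exact Complex.continuous_ofReal.comp ((hc a i).comp continuous_fst)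
    · exact Complex.continuous_ofReal.comp ((hc b j).comp continuous_snd)
    · simp only [Finset.mem_range] at hi hj
      omega
  fst a b h x := by
    have := hasDerivAt_sum_trigCoef he a (x := x.1)
      (X := fun i t => ∑ j ∈ Finset.range (b + 1), (trigCoef e b j x.2 : ℂ) * G i j (t, x.2)) ?_
    · simpa [_root_.trigJet] using this
    · intro i hi
      rw [Finset.mul_sum]
      refine (HasDerivAt.fun_sum fun j hj => ((hG.fst i j ?_ x).const_mul
        (trigCoef e b j x.2 : ℂ))).congr_deriv ?_
      · simp only [Finset.mem_range] at hj
        omega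
      · refine Finset.sum_congr rfl fun j _ => ?_
        push_cast
        ring
  snd a b h x := by
    simp only [trigJet_comm]
    have := hasDerivAt_sum_trigCoef he b (x := x.2)
      (X := fun j t => ∑ i ∈ Finset.range (a + 1), (trigCoef e a i x.1 : ℂ) * G i j (x.1, t)) ?_
    · simpa using this
    · intro j hj
      rw [Finset.mul_sum]
      refine (HasDerivAt.fun_sum fun i hi => ((hG.snd i j ?_ x).const_mul
        (trigCoef e a i x.1 : ℂ))).congr_deriv ?_
      · simp only [Finset.mem_range] at hi
        omega
      · refine Finset.sum_congr rfl fun j _ => ?_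
        push_cast
        ring

end

noncomputable section

/-! ### Estimates with the Hölder norm -/

theorem norm_partialDeriv_le {m : ℕ} {α : ℝ} {Ω : Set (ℝ × ℝ)} {f : ℝ × ℝ → ℂ}
    (hf : holderNorm m α Ω f < ⊤) {k : ℕ × ℕ} (hk : k.1 + k.2 ≤ m) {x : ℝ × ℝ} (hx : x ∈ Ω) :
    ‖partialDeriv k f x‖ ≤ (holderNorm m α Ω f).toReal := by
  rw [← toReal_enorm]
  refine ENNReal.toReal_mono hf.ne ?_
  calc ‖partialDeriv k f x‖ₑ ≤ ⨆ x ∈ Ω, ‖partialDeriv k f x‖ₑ :=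
        le_iSup₂_of_le (f := fun x _ => ‖partialDeriv k f x‖ₑ) x hx le_rfl
    _ ≤ ∑ k ∈ Finset.HasAntidiagonal.antidiagonal (k.1 + k.2),
          ⨆ x ∈ Ω, ‖partialDeriv k f x‖ₑ :=
        Finset.single_le_sum (f := fun k => ⨆ x ∈ Ω, ‖partialDeriv k f x‖ₑ)
          (fun _ _ => zero_le) (Finset.HasAntidiagonal.mem_antidiagonal.2 rfl)
    _ ≤ _ := Finset.single_le_sum
          (f := fun j => ∑ k ∈ Finset.HasAntidiagonal.antidiagonal j,
            ⨆ x ∈ Ω, ‖partialDeriv k f x‖ₑ)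
          (fun _ _ => zero_le) (Finset.mem_range.2 (Nat.lt_succ_of_le hk))
    _ ≤ holderNorm m α Ω f := le_self_add

theorem planeDist_pos {x y : ℝ × ℝ} (h : x ≠ y) : 0 < planeDist x y := by
  refine Real.sqrt_pos.2 ?_
  rcases eq_or_ne x.1 y.1 with h1 | h1
  · have h2 : x.2 ≠ y.2 := fun h2 => h (Prod.ext h1 h2)
    have := sub_ne_zero.2 h2
    positivity
  · have := sub_ne_zero.2 h1
    positivity

theorem planeDist_nonneg (x y : ℝ × ℝ) : 0 ≤ planeDist x y := Real.sqrt_nonneg _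

theorem norm_partialDeriv_sub_le {m : ℕ} {α : ℝ} {Ω : Set (ℝ × ℝ)} {f : ℝ × ℝ → ℂ}
    (hf : holderNorm m α Ω f < ⊤) (hα : α ≠ 0) {k : ℕ × ℕ} (hk : k.1 + k.2 = m) {x y : ℝ × ℝ}
    (hx : x ∈ Ω) (hy : y ∈ Ω) :
    ‖partialDeriv k f x - partialDeriv k f y‖ ≤
      (holderNorm m α Ω f).toReal * planeDist x y ^ α := by
  rcases eq_or_ne x y with rfl | hxy
  · rw [sub_self, norm_zero]
    have := Real.rpow_nonneg (planeDist_nonneg x x) α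
    positivity
  have hd : 0 < planeDist x y ^ α := Real.rpow_pos_of_pos (planeDist_pos hxy) α
  rw [← div_le_iff₀ hd, ← toReal_enorm, ← ENNReal.toReal_ofReal hd.le, ← ENNReal.toReal_div]
  refine ENNReal.toReal_mono hf.ne ?_
  set F : ℕ × ℕ → ℝ≥0∞ := fun k => ⨆ x ∈ Ω, ⨆ y ∈ Ω, ⨆ _ : x ≠ y,
        ‖partialDeriv k f x - partialDeriv k f y‖ₑ / ENNReal.ofReal (planeDist x y ^ α) with hF
  have h1 : ‖partialDeriv k f x - partialDeriv k f y‖ₑ / ENNReal.ofReal (planeDist x y ^ α)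
      ≤ F k := by
    simp only [hF]
    refine le_trans ?_ (le_iSup₂ x hx)
    refine le_trans ?_ (le_iSup₂ y hy)
    exact le_iSup (fun _ : x ≠ y =>
      ‖partialDeriv k f x - partialDeriv k f y‖ₑ / ENNReal.ofReal (planeDist x y ^ α)) hxy
  refine h1.trans ?_
  refine (Finset.single_le_sum (f := F) (fun _ _ => zero_le)
    (Finset.HasAntidiagonal.mem_antidiagonal.2 hk)).trans ?_
  rw [holderNorm, if_neg hα]
  exact le_add_self

/-- The number of the summands in `holderNorm`. -/
def holderCount (m : ℕ) : ℝ := (∑ j ∈ Finset.range (m + 1), ((j : ℝ) + 1)) + (m + 1)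

theorem holderCount_nonneg (m : ℕ) : 0 ≤ holderCount m := by
  unfold holderCount; positivity

theorem holderNorm_le {m : ℕ} {α : ℝ} {Ω : Set (ℝ × ℝ)} {f : ℝ × ℝ → ℂ} {B : ℝ} (hB : 0 ≤ B)
    (h1 : ∀ k : ℕ × ℕ, k.1 + k.2 ≤ m → ∀ x ∈ Ω, ‖partialDeriv k f x‖ ≤ B)
    (h2 : ∀ k : ℕ × ℕ, k.1 + k.2 = m → ∀ x ∈ Ω, ∀ y ∈ Ω,
      ‖partialDeriv k f x - partialDeriv k f y‖ ≤ B * planeDist x y ^ α) :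
    holderNorm m α Ω f ≤ ENNReal.ofReal (holderCount m * B) := by
  have e : ENNReal.ofReal (holderCount m * B) =
      (∑ j ∈ Finset.range (m + 1), ∑ k ∈ Finset.HasAntidiagonal.antidiagonal j,
        ENNReal.ofReal B) +
      ∑ k ∈ Finset.HasAntidiagonal.antidiagonal m, ENNReal.ofReal B := by
    have hs : ∀ j : ℕ, ∑ k ∈ Finset.HasAntidiagonal.antidiagonal j, ENNReal.ofReal B =
        ENNReal.ofReal ((j + 1) * B) := by
      intro j
      rw [Finset.sum_const, Finset.Nat.card_antidiagonal, nsmul_eq_mul, ENNReal.ofReal_mul (by positivity)]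
      congr 1
      rw [ENNReal.ofReal_add (by positivity) zero_le_one]
      simp
    simp only [hs]
    rw [← ENNReal.ofReal_sum_of_nonneg (fun j _ => by positivity), ← ENNReal.ofReal_add
      (Finset.sum_nonneg fun j _ => by positivity) (by positivity), holderCount, add_mul,
      Finset.sum_mul]
  have hen : ∀ z : ℂ, ∀ r : ℝ, ‖z‖ ≤ r → ‖z‖ₑ ≤ ENNReal.ofReal r := by
    intro z r h
    rw [← ofReal_norm]
    exact ENNReal.ofReal_le_ofReal h
  rw [e, holderNorm]
  refine add_le_add (Finset.sum_le_sum fun j hj => Finset.sum_le_sum fun k hk => ?_) ?_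
  · refine iSup₂_le fun x hx => hen _ _ (h1 k ?_ x hx)
    rw [Finset.HasAntidiagonal.mem_antidiagonal] at hk
    rw [Finset.mem_range] at hj
    omega
  · split_ifs
    · exact zero_le
    · refine Finset.sum_le_sum fun k hk => iSup₂_le fun x hx => iSup₂_le fun y hy =>
        iSup_le fun hxy => ?_
      have hd : 0 < planeDist x y ^ α := Real.rpow_pos_of_pos (planeDist_pos hxy) α
      refine ENNReal.div_le_of_le_mul ?_
      rw [← ENNReal.ofReal_mul hB]
      exact hen _ _ (h2 k (Finset.HasAntidiagonal.mem_antidiagonal.1 hk) x hx y hy)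

/-! ### Bounded Hölder continuous functions on the square -/

/-- On the square of the period, `u` and its `α`-Hölder quotients are bounded by `K`. -/
def HolderBound (α K : ℝ) (u : ℝ × ℝ → ℂ) : Prop :=
  (∀ x ∈ periodI ×ˢ periodI, ‖u x‖ ≤ K) ∧
  ∀ x ∈ periodI ×ˢ periodI, ∀ y ∈ periodI ×ˢ periodI, ‖u x - u y‖ ≤ K * planeDist x y ^ α

theorem HolderBound.nonneg {α K : ℝ} {u : ℝ × ℝ → ℂ} (h : HolderBound α K u) : 0 ≤ K := by
  have h0 : ((0 : ℝ), (0 : ℝ)) ∈ periodI ×ˢ periodI := by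
    have := Real.pi_pos
    refine ⟨⟨?_, ?_⟩, ⟨?_, ?_⟩⟩ <;> simp <;> linarith
  exact (norm_nonneg _).trans (h.1 _ h0)

theorem HolderBound.mul {α K L : ℝ} {u v : ℝ × ℝ → ℂ} (hu : HolderBound α K u)
    (hv : HolderBound α L v) : HolderBound α (2 * K * L) fun x => u x * v x := by
  have hK := hu.nonneg
  have hL := hv.nonneg
  refine ⟨fun x hx => ?_, fun x hx y hy => ?_⟩
  · rw [norm_mul]
    have := mul_le_mul (hu.1 x hx) (hv.1 x hx) (norm_nonneg _) hK
    nlinarith [mul_nonneg hK hL]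
  · have hd := Real.rpow_nonneg (planeDist_nonneg x y) α
    have e : u x * v x - u y * v y = (u x - u y) * v x + u y * (v x - v y) := by ring
    calc ‖u x * v x - u y * v y‖ ≤ ‖u x - u y‖ * ‖v x‖ + ‖u y‖ * ‖v x - v y‖ := by
          rw [e, ← norm_mul, ← norm_mul]; exact norm_add_le _ _
      _ ≤ (K * planeDist x y ^ α) * L + K * (L * planeDist x y ^ α) :=
          add_le_add
            (mul_le_mul (hu.2 x hx y hy) (hv.1 x hx) (norm_nonneg _) (by positivity))
            (mul_le_mul (hu.1 y hy) (hv.2 x hx y hy) (norm_nonneg _) hK)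
      _ = _ := by ring

theorem HolderBound.sum {α K : ℝ} {n : ℕ} {u : ℕ → ℝ × ℝ → ℂ}
    (hu : ∀ i < n, HolderBound α K (u i)) :
    HolderBound α (n * K) fun x => ∑ i ∈ Finset.range n, u i x := by
  have hc : ∀ c : ℝ, ∑ i ∈ Finset.range n, c = n * c := by
    intro c; simp
  refine ⟨fun x hx => ?_, fun x hx y hy => ?_⟩
  · rw [← hc]
    exact norm_sum_le_of_le _ fun i hi => (hu i (Finset.mem_range.1 hi)).1 x hx
  · rw [← Finset.sum_sub_distrib, mul_assoc, ← hc]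
    exact norm_sum_le_of_le _ fun i hi => (hu i (Finset.mem_range.1 hi)).2 x hx y hy

theorem HolderBound.mono {α K L : ℝ} {u : ℝ × ℝ → ℂ} (hu : HolderBound α K u) (h : K ≤ L) :
    HolderBound α L u :=
  ⟨fun x hx => (hu.1 x hx).trans h, fun x hx y hy => (hu.2 x hx y hy).trans
    (mul_le_mul_of_nonneg_right h (Real.rpow_nonneg (planeDist_nonneg x y) α))⟩

theorem abs_fst_sub_le_planeDist (x y : ℝ × ℝ) : |x.1 - y.1| ≤ planeDist x y :=
  Real.abs_le_sqrt (by nlinarith [sq_nonneg (x.2 - y.2)])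

theorem abs_snd_sub_le_planeDist (x y : ℝ × ℝ) : |x.2 - y.2| ≤ planeDist x y :=
  Real.abs_le_sqrt (by nlinarith [sq_nonneg (x.1 - y.1)])

/-- Coordinates in the period differ by less than 7, so distances are below 12, and d = d^{1-α}d^α
with d^{1-α} ≤ 12. This turns Lipschitz bounds into Hölder bounds with a constant independent of α.
-/
theorem planeDist_le_rpow {α : ℝ} (hα : α ∈ Icc (0 : ℝ) 1) {x y : ℝ × ℝ}
    (hx : x ∈ periodI ×ˢ periodI) (hy : y ∈ periodI ×ˢ periodI) :
    planeDist x y ≤ 12 * planeDist x y ^ α := by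
  rcases eq_or_ne x y with rfl | hxy
  · have : planeDist x x = 0 := by simp [planeDist]
    rw [this]
    positivity
  have hp := planeDist_pos hxy
  have hle : planeDist x y ≤ 12 := by
    have hπ := Real.pi_lt_d2
    have a1 := hx.1.1; have a2 := hx.1.2; have a3 := hx.2.1; have a4 := hx.2.2
    have b1 := hy.1.1; have b2 := hy.1.2; have b3 := hy.2.1; have b4 := hy.2.2
    refine Real.sqrt_le_iff.2 ⟨by norm_num, ?_⟩
    have c1 : (x.1 - y.1) ^ 2 ≤ 7 ^ 2 := sq_le_sq' (by linarith) (by linarith)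
    have c2 : (x.2 - y.2) ^ 2 ≤ 7 ^ 2 := sq_le_sq' (by linarith) (by linarith)
    linarith
  have h1 : planeDist x y = planeDist x y ^ (1 - α) * planeDist x y ^ α := by
    rw [← Real.rpow_add hp]; simp
  have h2 : planeDist x y ^ (1 - α) ≤ 12 := by
    calc planeDist x y ^ (1 - α) ≤ 12 ^ (1 - α) :=
          Real.rpow_le_rpow hp.le hle (by linarith [hα.2])
      _ ≤ 12 ^ (1 : ℝ) := Real.rpow_le_rpow_of_exponent_le (by norm_num) (by linarith [hα.1])
      _ = 12 := by simp
  calc planeDist x y = planeDist x y ^ (1 - α) * planeDist x y ^ α := h1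
    _ ≤ _ := mul_le_mul_of_nonneg_right h2 (Real.rpow_nonneg hp.le _)

theorem HolderBound.of_lipschitz {α K : ℝ} (hα : α ∈ Icc (0 : ℝ) 1) {u : ℝ × ℝ → ℂ}
    (h1 : ∀ x ∈ periodI ×ˢ periodI, ‖u x‖ ≤ K)
    (h2 : ∀ x ∈ periodI ×ˢ periodI, ∀ y ∈ periodI ×ˢ periodI, ‖u x - u y‖ ≤ K * planeDist x y) :
    HolderBound α (12 * K) u := by
  have hK : 0 ≤ K := by
    have h0 : ((0 : ℝ), (0 : ℝ)) ∈ periodI ×ˢ periodI := by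
      have := Real.pi_pos
      refine ⟨⟨?_, ?_⟩, ⟨?_, ?_⟩⟩ <;> simp <;> linarith
    exact (norm_nonneg _).trans (h1 _ h0)
  refine ⟨fun x hx => (h1 x hx).trans (by linarith), fun x hx y hy => ?_⟩
  refine (h2 x hx y hy).trans ?_
  calc K * planeDist x y ≤ K * (12 * planeDist x y ^ α) :=
        mul_le_mul_of_nonneg_left (planeDist_le_rpow hα hx hy) hK
    _ = _ := by ring

open scoped ContDiff in
theorem exists_holderBound_of_contDiff {α : ℝ} (hα : α ∈ Icc (0 : ℝ) 1) {c : ℝ → ℝ}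
    (hc : ContDiff ℝ ∞ c) : ∃ K, HolderBound α K (fun x => (c x.1 : ℂ)) ∧
      HolderBound α K (fun x => (c x.2 : ℂ)) := by
  obtain ⟨M, hM⟩ := (isCompact_Icc (a := -Real.pi) (b := Real.pi)).exists_bound_of_continuousOn
    hc.continuous.continuousOn
  obtain ⟨M', hM'⟩ := (isCompact_Icc (a := -Real.pi) (b := Real.pi)).exists_bound_of_continuousOn
    (hc.continuous_deriv (by simp)).continuousOn
  have hl : ∀ x ∈ periodI, ∀ y ∈ periodI, |c x - c y| ≤ M' * |x - y| := by
    intro x hx y hy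
    have := (convex_Icc (-Real.pi) Real.pi).norm_image_sub_le_of_norm_deriv_le
      (f := c) (fun x _ => (hc.differentiable (by simp)).differentiableAt) hM'
      (Ioo_subset_Icc_self hy) (Ioo_subset_Icc_self hx)
    simpa using this
  have hn : ∀ r : ℝ, ‖(r : ℂ)‖ = |r| := fun r => by simp
  have hM'0 : 0 ≤ M' := (norm_nonneg _).trans (hM' 0 ⟨by linarith [Real.pi_pos], Real.pi_pos.le⟩)
  refine ⟨12 * (max M M'), HolderBound.of_lipschitz hα (fun x hx => ?_) (fun x hx y hy => ?_),
    HolderBound.of_lipschitz hα (fun x hx => ?_) (fun x hx y hy => ?_)⟩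
  · rw [hn]; exact (hM _ (Ioo_subset_Icc_self hx.1)).trans (le_max_left _ _)
  · rw [← Complex.ofReal_sub, hn]
    refine (hl _ hx.1 _ hy.1).trans ?_
    exact mul_le_mul (le_max_right _ _) (abs_fst_sub_le_planeDist x y) (abs_nonneg _)
      (hM'0.trans (le_max_right _ _))
  · rw [hn]; exact (hM _ (Ioo_subset_Icc_self hx.2)).trans (le_max_left _ _)
  · rw [← Complex.ofReal_sub, hn]
    refine (hl _ hx.2 _ hy.2).trans ?_
    exact mul_le_mul (le_max_right _ _) (abs_snd_sub_le_planeDist x y) (abs_nonneg _)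
      (hM'0.trans (le_max_right _ _))

end

noncomputable section

/-! ### Composition with the cosine -/

theorem isOpen_arcI_prod : IsOpen (arcI ×ˢ arcI) := isOpen_Ioo.prod isOpen_Ioo

theorem closure_arcI_prod : closure (arcI ×ˢ arcI) = Icc (-1 : ℝ) 1 ×ˢ Icc (-1 : ℝ) 1 := by
  rw [closure_prod_eq, arcI, closure_Ioo (by norm_num)]

theorem cos_mem_arcI {x : ℝ} (h : Real.sin x ≠ 0) : Real.cos x ∈ arcI := by
  have h1 : 0 < Real.sin x ^ 2 := by positivity
  have h2 := Real.sin_sq_add_cos_sq x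
  exact ⟨by nlinarith [Real.neg_one_le_cos x], by nlinarith [Real.cos_le_one x]⟩

theorem cos_mem_closure (x : ℝ × ℝ) :
    (Real.cos x.1, Real.cos x.2) ∈ closure (arcI ×ˢ arcI) := by
  rw [closure_arcI_prod]
  exact ⟨⟨Real.neg_one_le_cos _, Real.cos_le_one _⟩, ⟨Real.neg_one_le_cos _, Real.cos_le_one _⟩⟩

theorem countable_sin_eq_zero : {x : ℝ | Real.sin x = 0}.Countable := by
  refine (countable_range fun n : ℤ => (n : ℝ) * Real.pi).mono ?_
  intro x hx
  obtain ⟨n, hn⟩ := Real.sin_eq_zero_iff.1 hx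
  exact ⟨n, hn⟩

/-- The jet consists of the continuous extensions of the derivatives of f to the closed square,
composed with the cosines. The chain rule is immediate where both sines are nonzero, and the other
coordinates form a countable set. -/
theorem exists_cosJet {m : ℕ} {α : ℝ} {f : ℝ × ℝ → ℂ} (hf : InHolder m α (arcI ×ˢ arcI) f) :
    ∃ G : ℕ → ℕ → ℝ × ℝ → ℂ, IsJet m (fun x => -Real.sin x) G ∧ G 0 0 = sigmaFun f ∧
      ∀ i j, i + j ≤ m → ∀ x : ℝ × ℝ, Real.sin x.1 ≠ 0 → Real.sin x.2 ≠ 0 →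
        G i j x = partialDeriv (i, j) f (Real.cos x.1, Real.cos x.2) := by
  have h0 : ∀ i j : ℕ, ∃ g : ℝ × ℝ → ℂ, i + j ≤ m → ContinuousOn g (closure (arcI ×ˢ arcI)) ∧
      EqOn (partialDeriv (i, j) f) g (arcI ×ˢ arcI) := by
    intro i j
    by_cases h : i + j ≤ m
    · obtain ⟨g, hg⟩ := hf.2.1 (i, j) h
      exact ⟨g, fun _ => hg⟩
    · exact ⟨0, fun h' => absurd h' h⟩
  choose g hg using h0
  have hc : ∀ i j, i + j ≤ m → Continuous fun x : ℝ × ℝ => g i j (Real.cos x.1, Real.cos x.2) :=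
    fun i j h => (hg i j h).1.comp_continuous (by fun_prop) cos_mem_closure
  refine ⟨fun i j x => g i j (Real.cos x.1, Real.cos x.2), ⟨hc, ?_, ?_⟩, ?_, ?_⟩
  · intro i j h
    refine hasDerivAt_fst_of_off_countable countable_sin_eq_zero (hc i j (by omega)) ?_ ?_
    · exact (Complex.continuous_ofReal.comp (by fun_prop)).mul (hc (i + 1) j (by omega))
    · intro x h1 h2
      have hx : (Real.cos x.1, Real.cos x.2) ∈ arcI ×ˢ arcI := ⟨cos_mem_arcI h1, cos_mem_arcI h2⟩
      have d := hasDerivAt_partialDeriv_fst isOpen_arcI_prod hf.1 h hx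
      have d' : HasDerivAt (fun t => g i j (t, Real.cos x.2))
          (g (i + 1) j (Real.cos x.1, Real.cos x.2)) (Real.cos x.1) := by
        rw [← (hg (i + 1) j (by omega)).2 hx]
        refine d.congr_of_eventuallyEq ?_
        filter_upwards [isOpen_Ioo.mem_nhds hx.1] with t ht
        exact ((hg i j (by omega)).2 (show (t, Real.cos x.2) ∈ arcI ×ˢ arcI from ⟨ht, hx.2⟩)).symm
      have := d'.scomp x.1 (Real.hasDerivAt_cos x.1)
      refine this.congr_deriv ?_
      rw [Complex.real_smul]
  · intro i j h
    refine hasDerivAt_snd_of_off_countable countable_sin_eq_zero (hc i j (by omega)) ?_ ?_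
    · exact (Complex.continuous_ofReal.comp (by fun_prop)).mul (hc i (j + 1) (by omega))
    · intro x h1 h2
      have hx : (Real.cos x.1, Real.cos x.2) ∈ arcI ×ˢ arcI := ⟨cos_mem_arcI h1, cos_mem_arcI h2⟩
      have d := hasDerivAt_partialDeriv_snd isOpen_arcI_prod hf.1 h hx
      have d' : HasDerivAt (fun t => g i j (Real.cos x.1, t))
          (g i (j + 1) (Real.cos x.1, Real.cos x.2)) (Real.cos x.2) := by
        rw [← (hg i (j + 1) (by omega)).2 hx]
        refine d.congr_of_eventuallyEq ?_
        filter_upwards [isOpen_Ioo.mem_nhds hx.2] with t ht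
        exact ((hg i j (by omega)).2 (show (Real.cos x.1, t) ∈ arcI ×ˢ arcI from ⟨hx.1, ht⟩)).symm
      have := d'.scomp x.2 (Real.hasDerivAt_cos x.2)
      refine this.congr_deriv ?_
      rw [Complex.real_smul]
  · ext x
    have h00 := hg 0 0 (Nat.zero_le m)
    refine (extendFrom_eq (cos_mem_closure x) ?_).symm
    -- Any continuous extension of f to the closed square agrees with `extendFrom`, because the
    -- limit from inside is unique.
    have ht := (h00.1 _ (cos_mem_closure x)).mono_left (nhdsWithin_mono _ subset_closure)
    refine ht.congr' ?_
    filter_upwards [self_mem_nhdsWithin] with y hy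
    rw [← h00.2 hy]
    simp [partialDeriv]
  · intro i j h x h1 h2
    exact ((hg i j h).2 (show (Real.cos x.1, Real.cos x.2) ∈ arcI ×ˢ arcI from
      ⟨cos_mem_arcI h1, cos_mem_arcI h2⟩)).symm

theorem planeDist_cos_le (x y : ℝ × ℝ) :
    planeDist (Real.cos x.1, Real.cos x.2) (Real.cos y.1, Real.cos y.2) ≤ planeDist x y := by
  have hc : ∀ a b : ℝ, |Real.cos a - Real.cos b| ≤ |a - b| := by
    intro a b
    have := Convex.norm_image_sub_le_of_norm_hasDerivWithin_le (f := Real.cos)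
      (f' := fun x => -Real.sin x) (C := 1) (s := univ)
      (fun x _ => (Real.hasDerivAt_cos x).hasDerivWithinAt)
      (fun x _ => by simpa using Real.abs_sin_le_one x) convex_univ (mem_univ b) (mem_univ a)
    simpa using this
  exact Real.sqrt_le_sqrt (add_le_add (sq_le_sq.2 (hc _ _)) (sq_le_sq.2 (hc _ _)))

theorem dense_sin_ne_zero :
    Dense ({x : ℝ | Real.sin x = 0}ᶜ ×ˢ {x : ℝ | Real.sin x = 0}ᶜ : Set (ℝ × ℝ)) :=
  (countable_sin_eq_zero.dense_compl ℝ).prod (countable_sin_eq_zero.dense_compl ℝ)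

theorem continuous_planeDist_cos : Continuous fun z : (ℝ × ℝ) × (ℝ × ℝ) =>
    planeDist (Real.cos z.1.1, Real.cos z.1.2) (Real.cos z.2.1, Real.cos z.2.2) := by
  unfold planeDist
  fun_prop

/-- Bounds for f transfer on the dense set where both sines are nonzero and extend by continuity.
Below the top order the next derivatives give a Lipschitz constant N in each variable, and 24 = 12 ·
2 converts this to Hölder form. At the top order the seminorm of f is used, since the cosine is a
contraction. -/
theorem cosJet_holderBound {m : ℕ} {α : ℝ} (hα : α ∈ Icc (0 : ℝ) 1) {f : ℝ × ℝ → ℂ}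
    (hf : InHolder m α (arcI ×ˢ arcI) f) {G : ℕ → ℕ → ℝ × ℝ → ℂ}
    (hG : IsJet m (fun x => -Real.sin x) G)
    (hG' : ∀ i j, i + j ≤ m → ∀ x : ℝ × ℝ, Real.sin x.1 ≠ 0 → Real.sin x.2 ≠ 0 →
        G i j x = partialDeriv (i, j) f (Real.cos x.1, Real.cos x.2)) (i j : ℕ) (h : i + j ≤ m) :
    HolderBound α (24 * (holderNorm m α (arcI ×ˢ arcI) f).toReal) (G i j) := by
  set N := (holderNorm m α (arcI ×ˢ arcI) f).toReal with hN
  have hN0 : 0 ≤ N := ENNReal.toReal_nonneg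
  have hb : ∀ i j, i + j ≤ m → ∀ x, ‖G i j x‖ ≤ N := by
    intro i j h x
    have hcl : IsClosed {x | ‖G i j x‖ ≤ N} :=
      isClosed_le (hG.continuous i j h).norm continuous_const
    refine hcl.closure_subset_iff.2 ?_ (dense_sin_ne_zero x)
    intro y hy
    simp only [mem_ofPred_eq]
    rw [hG' i j h y hy.1 hy.2]
    exact norm_partialDeriv_le hf.2.2 h ⟨cos_mem_arcI hy.1, cos_mem_arcI hy.2⟩
  rcases h.lt_or_eq with hlt | heq
  · have e : 24 * N = 12 * (2 * N) := by ring
    rw [e]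
    refine HolderBound.of_lipschitz hα (fun x _ => (hb i j h x).trans (by linarith))
      fun x _ y _ => ?_
    have hs : ∀ x : ℝ, ∀ z : ℂ, ‖z‖ ≤ N → ‖((-Real.sin x : ℝ) : ℂ) * z‖ ≤ N := by
      intro x z hz
      rw [norm_mul, Complex.norm_real, norm_neg, Real.norm_eq_abs]
      calc |Real.sin x| * ‖z‖ ≤ 1 * N :=
            mul_le_mul (Real.abs_sin_le_one x) hz (norm_nonneg _) zero_le_one
        _ = N := one_mul N
    have d1 : ‖G i j (x.1, x.2) - G i j (y.1, x.2)‖ ≤ N * ‖x.1 - y.1‖ :=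
      Convex.norm_image_sub_le_of_norm_hasDerivWithin_le (f := fun t => G i j (t, x.2))
      (s := univ)
      (fun t _ => (hG.fst i j (by omega) (t, x.2)).hasDerivWithinAt)
      (fun t _ => hs _ _ (hb (i + 1) j (by omega) _)) convex_univ (mem_univ _) (mem_univ _)
    have d2 : ‖G i j (y.1, x.2) - G i j (y.1, y.2)‖ ≤ N * ‖x.2 - y.2‖ :=
      Convex.norm_image_sub_le_of_norm_hasDerivWithin_le (f := fun t => G i j (y.1, t))
      (s := univ)
      (fun t _ => (hG.snd i j (by omega) (y.1, t)).hasDerivWithinAt)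
      (fun t _ => hs _ _ (hb i (j + 1) (by omega) _)) convex_univ (mem_univ _) (mem_univ _)
    rw [Real.norm_eq_abs] at d1 d2
    have e1 := mul_le_mul_of_nonneg_left (abs_fst_sub_le_planeDist x y) hN0
    have e2 := mul_le_mul_of_nonneg_left (abs_snd_sub_le_planeDist x y) hN0
    have e3 := norm_sub_le_norm_sub_add_norm_sub (G i j (x.1, x.2)) (G i j (y.1, x.2))
      (G i j (y.1, y.2))
    have e4 : ‖G i j x - G i j y‖ = ‖G i j (x.1, x.2) - G i j (y.1, y.2)‖ := rfl
    linarith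
  · refine ⟨fun x _ => (hb i j h x).trans (by linarith), fun x _ y _ => ?_⟩
    -- For α = 0 the norm contains no seminorm, but a difference is trivially at most 2N.
    rcases eq_or_ne α 0 with hα0 | hα0
    · rw [hα0, Real.rpow_zero, mul_one]
      have := norm_sub_le (G i j x) (G i j y)
      linarith [hb i j h x, hb i j h y]
    have hcl : IsClosed {z : (ℝ × ℝ) × (ℝ × ℝ) | ‖G i j z.1 - G i j z.2‖ ≤
        N * planeDist (Real.cos z.1.1, Real.cos z.1.2) (Real.cos z.2.1, Real.cos z.2.2) ^ α} := by
      have hc := hG.continuous i j h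
      refine isClosed_le (by fun_prop) ?_
      exact continuous_const.mul (continuous_planeDist_cos.rpow_const fun _ => Or.inr hα.1)
    have key := hcl.closure_subset_iff.2 ?_
      (dense_sin_ne_zero.prod dense_sin_ne_zero (x, y))
    · refine (show ‖G i j x - G i j y‖ ≤ _ from key).trans ?_
      have h1 := Real.rpow_le_rpow (planeDist_nonneg _ _) (planeDist_cos_le x y) hα.1
      refine (mul_le_mul_of_nonneg_left h1 hN0).trans ?_
      exact mul_le_mul_of_nonneg_right (by linarith) (Real.rpow_nonneg (planeDist_nonneg x y) α)
    · rintro ⟨z, w⟩ ⟨hz, hw⟩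
      simp only [mem_ofPred_eq]
      rw [hG' i j h z hz.1 hz.2, hG' i j h w hw.1 hw.2]
      exact norm_partialDeriv_sub_le hf.2.2 hα0 heq
        ⟨cos_mem_arcI hz.1, cos_mem_arcI hz.2⟩ ⟨cos_mem_arcI hw.1, cos_mem_arcI hw.2⟩

open scoped ContDiff in
/-- Multiplied by smooth functions of the two variables, `f(cos x₁, cos x₂)` is as regular as `f`. -/
theorem exists_inHolder_mul_sigmaFun (m : ℕ) {α : ℝ} (hα : α ∈ Icc (0 : ℝ) 1) {e : ℝ → ℝ}
    (he : ContDiff ℝ ∞ e) :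
    ∃ C : ℝ, 0 ≤ C ∧ ∀ f : ℝ × ℝ → ℂ, InHolder m α (arcI ×ˢ arcI) f →
      ContDiff ℝ m (fun x => (e x.1 : ℂ) * ((e x.2 : ℂ) * sigmaFun f x)) ∧
      InHolder m α (periodI ×ˢ periodI) (fun x => (e x.1 : ℂ) * ((e x.2 : ℂ) * sigmaFun f x)) ∧
      (holderNorm m α (periodI ×ˢ periodI)
        (fun x => (e x.1 : ℂ) * ((e x.2 : ℂ) * sigmaFun f x))).toReal ≤
        C * (holderNorm m α (arcI ×ˢ arcI) f).toReal := by
  choose K hK1 hK2 using fun a i : ℕ => exists_holderBound_of_contDiff hα (contDiff_trigCoef he a i)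
  set M := ∑ a ∈ Finset.range (m + 1), ∑ i ∈ Finset.range (m + 1), K a i with hM
  have hK0 : ∀ a i, 0 ≤ K a i := fun a i => (hK1 a i).nonneg
  have hKM : ∀ a i, a ≤ m → i ≤ m → K a i ≤ M := by
    intro a i ha hi
    refine (Finset.single_le_sum (f := fun i => K a i) (fun i _ => hK0 a i)
      (Finset.mem_range.2 (Nat.lt_succ_of_le hi))).trans ?_
    exact Finset.single_le_sum (f := fun a => ∑ i ∈ Finset.range (m + 1), K a i)
      (fun a _ => Finset.sum_nonneg fun i _ => hK0 a i) (Finset.mem_range.2 (Nat.lt_succ_of_le ha))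
  have hM0 : 0 ≤ M := Finset.sum_nonneg fun a _ => Finset.sum_nonneg fun i _ => hK0 a i
  -- For each variable: at most m + 1 summands, and a factor 2M from multiplying by a trigonometric
  -- coefficient. The 24 is that of `cosJet_holderBound`.
  set D : ℝ := (m + 1) * (2 * M * ((m + 1) * (2 * M * 24))) with hD
  have hD0 : 0 ≤ D := by positivity
  refine ⟨holderCount m * D, mul_nonneg (holderCount_nonneg m) hD0, fun f hf => ?_⟩
  set N := (holderNorm m α (arcI ×ˢ arcI) f).toReal with hN
  have hN0 : 0 ≤ N := ENNReal.toReal_nonneg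
  obtain ⟨G, hG, hG0, hG'⟩ := exists_cosJet hf
  have hP := hG.trigJet he
  have eF : (fun x : ℝ × ℝ => (e x.1 : ℂ) * ((e x.2 : ℂ) * sigmaFun f x)) = trigJet e G 0 0 := by
    ext x
    simp [trigJet, trigCoef, hG0]
  rw [eF]
  have hHB : ∀ a b, a + b ≤ m → HolderBound α (D * N) (trigJet e G a b) := by
    intro a b hab
    have h1 : ∀ i < a + 1, ∀ j < b + 1, HolderBound α (2 * M * (24 * N))
        (fun x => (trigCoef e b j x.2 : ℂ) * G i j x) := fun i hi j hj =>
      HolderBound.mul ((hK2 b j).mono (hKM b j (by omega) (by omega)))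
        (cosJet_holderBound hα hf hG hG' i j (by omega))
    have h2 : ∀ i < a + 1, HolderBound α (2 * M * (((b + 1 : ℕ) : ℝ) * (2 * M * (24 * N))))
        (fun x => (trigCoef e a i x.1 : ℂ) *
          ∑ j ∈ Finset.range (b + 1), (trigCoef e b j x.2 : ℂ) * G i j x) := fun i hi =>
      HolderBound.mul ((hK1 a i).mono (hKM a i (by omega) (by omega)))
        (HolderBound.sum fun j hj => h1 i hi j hj)
    refine (HolderBound.sum h2).mono ?_
    have ha : ((a + 1 : ℕ) : ℝ) ≤ m + 1 := by
      push_cast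
      have : (a : ℝ) ≤ m := by exact_mod_cast (by omega : a ≤ m)
      linarith
    have hb : ((b + 1 : ℕ) : ℝ) ≤ m + 1 := by
      push_cast
      have : (b : ℝ) ≤ m := by exact_mod_cast (by omega : b ≤ m)
      linarith
    calc ((a + 1 : ℕ) : ℝ) * (2 * M * (((b + 1 : ℕ) : ℝ) * (2 * M * (24 * N))))
        ≤ (m + 1) * (2 * M * ((m + 1) * (2 * M * (24 * N)))) :=
          mul_le_mul ha (mul_le_mul_of_nonneg_left (mul_le_mul_of_nonneg_right hb (by positivity))
            (by positivity)) (by positivity) (by positivity)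
      _ = D * N := by rw [hD]; ring
  have hnorm : holderNorm m α (periodI ×ˢ periodI) (trigJet e G 0 0) ≤
      ENNReal.ofReal (holderCount m * (D * N)) := by
    refine holderNorm_le (by positivity) (fun k hk x hx => ?_) fun k hk x hx y hy => ?_
    · rw [show k = (k.1, k.2) from rfl, hP.partialDeriv_eq k.1 k.2 hk]
      exact (hHB _ _ hk).1 x hx
    · rw [show k = (k.1, k.2) from rfl, hP.partialDeriv_eq k.1 k.2 hk.le]
      exact (hHB _ _ hk.le).2 x hx y hy
  have hcd : ContDiff ℝ m (trigJet e G 0 0) := hP.contDiff m 0 0 (by omega)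
  refine ⟨hcd, ⟨hcd.contDiffOn, fun k hk => ⟨trigJet e G k.1 k.2,
    (hP.continuous _ _ hk).continuousOn, fun x _ => ?_⟩,
    hnorm.trans_lt ENNReal.ofReal_lt_top⟩, ?_⟩
  · rw [show k = (k.1, k.2) from rfl, hP.partialDeriv_eq k.1 k.2 hk]
  · have := ENNReal.toReal_mono ENNReal.ofReal_ne_top hnorm
    rw [ENNReal.toReal_ofReal (mul_nonneg (holderCount_nonneg m) (by positivity))] at this
    linarith

end

noncomputable section

/-! ### The Fourier coefficients of the logarithmic kernel -/

theorem fourierInt_one (j : ℤ) :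
    fourierInt (fun _ => 1) j = if j = 0 then ((2 * Real.pi : ℝ) : ℂ) else 0 := by
  split_ifs with h
  · subst h
    rw [fourierInt, setIntegral_periodI]
    simp only [neg_zero, expI_zero, mul_one, intervalIntegral.integral_const, Complex.real_smul]
    push_cast
    ring
  · have h1 := fourierInt_deriv (g := fun _ => 1) contDiff_const (fun _ => rfl) j
    have h2 : fourierInt (deriv fun _ : ℝ => (1 : ℂ)) j = 0 := by simp [fourierInt]
    rw [h2] at h1
    have h3 : Complex.I * (j : ℂ) ≠ 0 := mul_ne_zero Complex.I_ne_zero (by exact_mod_cast h)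
    exact (mul_eq_zero.1 h1.symm).resolve_left h3

/-- The kernel `log (√2 |sin (x / 2)|)`. -/
def logKer (x : ℝ) : ℝ := Real.log 2 / 2 + Real.log (Real.sin (x / 2))

theorem measurable_logKer : Measurable logKer := by
  unfold logKer
  fun_prop

theorem periodic_logKer : Function.Periodic logKer (2 * Real.pi) := by
  intro x
  have h : (x + 2 * Real.pi) / 2 = x / 2 + Real.pi := by ring
  rw [logKer, logKer, h, Real.sin_add_pi, Real.log_neg_eq_log]

theorem logKer_neg (x : ℝ) : logKer (-x) = logKer x := by
  rw [logKer, logKer, neg_div, Real.sin_neg, Real.log_neg_eq_log]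

theorem intervalIntegrable_logKer (a b : ℝ) : IntervalIntegrable logKer volume a b := by
  have h := (intervalIntegrable_log_sin (a := a / 2) (b := b / 2)).comp_mul_right (c := 1 / 2)
  have h2 : IntervalIntegrable (fun x => Real.log (Real.sin (x / 2))) volume a b := by
    convert h using 1
    · ext x
      simp only [Function.comp]
      congr 2
      ring
    · ring
    · ring
  exact (Continuous.intervalIntegrable continuous_const a b).add h2

theorem integrableOn_logKer : IntegrableOn (fun x => (logKer x : ℂ)) periodI := by
  rw [integrableOn_periodI_iff, intervalIntegrable_iff]
  exact (intervalIntegrable_iff.1 (intervalIntegrable_logKer _ _)).ofReal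

theorem continuous_sin_mul_logKer : Continuous fun x => Real.sin (x / 2) * logKer x := by
  have h : (fun x => Real.sin (x / 2) * logKer x) = fun x =>
      Real.sin (x / 2) * (Real.log 2 / 2) + Real.sin (x / 2) * Real.log (Real.sin (x / 2)) := by
    ext x; rw [logKer, mul_add]
  rw [h]
  have h2 : Continuous fun x : ℝ => Real.sin (x / 2) := by fun_prop
  exact (h2.mul continuous_const).add (Real.continuous_mul_log.comp h2)

theorem hasDerivAt_logKer {x : ℝ} (h : Real.sin (x / 2) ≠ 0) :
    HasDerivAt logKer (Real.cos (x / 2) / (2 * Real.sin (x / 2))) x := by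
  have h1 : HasDerivAt (fun x => Real.sin (x / 2)) (Real.cos (x / 2) * (1 / 2)) x :=
    ((hasDerivAt_id x).div_const 2).sin
  refine ((h1.log h).const_add _).congr_deriv ?_
  field_simp

theorem countable_sin_half_eq_zero : {x : ℝ | Real.sin (x / 2) = 0}.Countable := by
  refine (countable_range fun n : ℤ => (n : ℝ) * Real.pi * 2).mono ?_
  intro x hx
  obtain ⟨n, hn⟩ := Real.sin_eq_zero_iff.1 hx
  exact ⟨n, by simp only [hn]; ring⟩

theorem expI_neg_natCast (n : ℕ) (x : ℝ) : expI (-(n : ℤ)) x = expI (-1) x ^ n := by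
  rw [expI, expI, ← Complex.exp_nat_mul]
  congr 1
  push_cast
  ring

theorem expI_neg_one (x : ℝ) :
    expI (-1) x = ((Real.cos (x / 2) : ℂ) - Complex.I * Real.sin (x / 2)) ^ 2 := by
  have h : Complex.I * ((-1 : ℤ) : ℂ) * x = ((2 : ℕ) : ℂ) * (((-(x / 2) : ℝ) : ℂ) * Complex.I) := by
    push_cast
    ring
  rw [expI, h, Complex.exp_nat_mul, Complex.exp_mul_I, ← Complex.ofReal_cos, ← Complex.ofReal_sin,
    Real.cos_neg, Real.sin_neg]
  push_cast
  ring

theorem expI_neg_one_sub_one (x : ℝ) :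
    expI (-1) x - 1 = -2 * Complex.I * Real.sin (x / 2) *
      ((Real.cos (x / 2) : ℂ) - Complex.I * Real.sin (x / 2)) := by
  have h : (Real.cos (x / 2) : ℂ) ^ 2 + (Real.sin (x / 2) : ℂ) ^ 2 = 1 := by
    exact_mod_cast Real.cos_sq_add_sin_sq (x / 2)
  rw [expI_neg_one]
  linear_combination h - (Real.sin (x / 2) : ℂ) ^ 2 * Complex.I_sq

theorem one_add_expI_neg_one (x : ℝ) :
    1 + expI (-1) x = 2 * Real.cos (x / 2) *
      ((Real.cos (x / 2) : ℂ) - Complex.I * Real.sin (x / 2)) := by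
  have h : (Real.cos (x / 2) : ℂ) ^ 2 + (Real.sin (x / 2) : ℂ) ^ 2 = 1 := by
    exact_mod_cast Real.cos_sq_add_sin_sq (x / 2)
  rw [expI_neg_one]
  linear_combination (-1 : ℂ) * h + (Real.sin (x / 2) : ℂ) ^ 2 * Complex.I_sq

/-- The antiderivative `log (√2 |sin (x / 2)|) (e^{-ijx} - 1)`. -/
theorem hasDerivAt_logKer_mul (j : ℕ) {x : ℝ} (h : Real.sin (x / 2) ≠ 0) :
    HasDerivAt (fun x => (logKer x : ℂ) * (expI (-(j : ℤ)) x - 1))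
      (-(Complex.I / 2) * ∑ k ∈ Finset.range j, (expI (-(k : ℤ)) x + expI (-((k + 1 : ℕ) : ℤ)) x) +
        -(Complex.I * j) * ((logKer x : ℂ) * expI (-(j : ℤ)) x)) x := by
  have h1 := (hasDerivAt_logKer h).ofReal_comp.mul ((hasDerivAt_expI (-(j : ℤ)) x).sub_const 1)
  refine h1.congr_deriv ?_
  have hs : (Real.sin (x / 2) : ℂ) ≠ 0 := by exact_mod_cast h
  have hgeom : (expI (-1) x - 1) * ∑ k ∈ Finset.range j, expI (-1) x ^ k = expI (-1) x ^ j - 1 :=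
    mul_geom_sum _ _
  have hsum : ∑ k ∈ Finset.range j, (expI (-(k : ℤ)) x + expI (-((k + 1 : ℕ) : ℤ)) x) =
      (1 + expI (-1) x) * ∑ k ∈ Finset.range j, expI (-1) x ^ k := by
    rw [Finset.mul_sum]
    refine Finset.sum_congr rfl fun k _ => ?_
    rw [expI_neg_natCast, expI_neg_natCast]
    ring
  rw [hsum, one_add_expI_neg_one]
  simp only [expI_neg_natCast j]
  rw [← hgeom, expI_neg_one_sub_one]
  simp only [Complex.ofReal_div, Complex.ofReal_mul, Int.cast_neg, Int.cast_natCast,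
    Complex.ofReal_ofNat]
  field_simp

/-- The difference e^{-ijx} - 1 contains a factor sin(x/2), which cancels the logarithmic
singularity. This is the reason for subtracting 1: the function is then an admissible primitive
across the singularity. -/
theorem continuous_logKer_mul (j : ℕ) :
    Continuous fun x => (logKer x : ℂ) * (expI (-(j : ℤ)) x - 1) := by
  have h : (fun x => (logKer x : ℂ) * (expI (-(j : ℤ)) x - 1)) = fun x =>
      ((Real.sin (x / 2) * logKer x : ℝ) : ℂ) * (-2 * Complex.I *
      ((Real.cos (x / 2) : ℂ) - Complex.I * Real.sin (x / 2)) *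
        ∑ k ∈ Finset.range j, expI (-1) x ^ k) := by
    ext x
    rw [expI_neg_natCast, ← mul_geom_sum, expI_neg_one_sub_one]
    push_cast
    ring
  rw [h]
  have := continuous_expI (-1)
  have := continuous_sin_mul_logKer
  exact (Complex.continuous_ofReal.comp this).mul (by fun_prop)

/-- The primitive log(√2|sin(x/2)|)(e^{-ijx} - 1) is periodic, so its derivative integrates to zero.
That derivative is -ij times the wanted integrand plus a trigonometric sum in which only the
constant term k = 0 survives integration. -/
theorem fourierInt_logKer_natCast {j : ℕ} (hj : j ≠ 0) :
    fourierInt (fun x => (logKer x : ℂ)) j = -(Real.pi / j : ℝ) := by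
  have hc : ∀ k : ℕ, IntervalIntegrable (expI (-(k : ℤ))) volume (-Real.pi) Real.pi := fun k =>
    (continuous_expI _).intervalIntegrable _ _
  have hi1 : IntervalIntegrable (fun x => ∑ k ∈ Finset.range j,
      (expI (-(k : ℤ)) x + expI (-((k + 1 : ℕ) : ℤ)) x)) volume (-Real.pi) Real.pi := by
    refine Continuous.intervalIntegrable ?_ _ _
    exact continuous_finsetSum _ fun k _ => (continuous_expI _).add (continuous_expI _)
  have hi2 : IntervalIntegrable (fun x => (logKer x : ℂ) * expI (-(j : ℤ)) x) volume
      (-Real.pi) Real.pi := integrableOn_periodI_iff.1 (integrableOn_logKer.mul_expI _)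
  have h := integral_eq_of_hasDerivAt_off_countable
    (fun x => (logKer x : ℂ) * (expI (-(j : ℤ)) x - 1)) _ (a := -Real.pi) (b := Real.pi)
    countable_sin_half_eq_zero (continuous_logKer_mul j).continuousOn
    (fun x hx => hasDerivAt_logKer_mul j hx.2) ((hi1.const_mul _).add (hi2.const_mul _))
  have hper : logKer Real.pi = logKer (-Real.pi) ∧ expI (-(j : ℤ)) Real.pi = expI (-(j : ℤ)) (-Real.pi) := by
    have e : Real.pi = -Real.pi + 2 * Real.pi := by ring
    exact ⟨(logKer_neg _).symm, by conv_lhs => rw [e, periodic_expI]⟩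
  rw [hper.1, hper.2, sub_self, intervalIntegral.integral_add (hi1.const_mul _) (hi2.const_mul _),
    intervalIntegral.integral_const_mul, intervalIntegral.integral_const_mul,
    intervalIntegral.integral_finsetSum (fun k _ => (hc k).add (hc (k + 1)))] at h
  have h1 : ∀ k : ℕ, ∫ x in (-Real.pi)..Real.pi, expI (-(k : ℤ)) x =
      if k = 0 then ((2 * Real.pi : ℝ) : ℂ) else 0 := by
    intro k
    have := fourierInt_one k
    rw [fourierInt, setIntegral_periodI] at this
    simpa using this
  have h2 : ∑ k ∈ Finset.range j, ∫ x in (-Real.pi)..Real.pi,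
      (expI (-(k : ℤ)) x + expI (-((k + 1 : ℕ) : ℤ)) x) = ((2 * Real.pi : ℝ) : ℂ) := by
    have : ∀ k ∈ Finset.range j, ∫ x in (-Real.pi)..Real.pi,
        (expI (-(k : ℤ)) x + expI (-((k + 1 : ℕ) : ℤ)) x) =
          if k = 0 then ((2 * Real.pi : ℝ) : ℂ) else 0 := by
      intro k _
      rw [intervalIntegral.integral_add (hc k) (hc (k + 1)), h1, h1]
      simp
    rw [Finset.sum_congr rfl this, Finset.sum_ite_eq']
    simp [Nat.pos_of_ne_zero hj]
  rw [h2, ← setIntegral_periodI] at h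
  have hj' : (j : ℂ) ≠ 0 := by exact_mod_cast hj
  have h3 : fourierInt (fun x => (logKer x : ℂ)) j =
    ∫ x in periodI, (logKer x : ℂ) * expI (-(j : ℤ)) x := rfl
  rw [h3]
  push_cast at h ⊢
  have h4 : Complex.I * ((j : ℂ) * (∫ x in periodI, (logKer x : ℂ) * expI (-(j : ℤ)) x) +
      Real.pi) = 0 := by linear_combination (-1 : ℂ) * h
  have h5 := (mul_eq_zero.1 h4).resolve_left Complex.I_ne_zero
  field_simp
  linear_combination h5

theorem fourierInt_neg_of_even {v : ℝ → ℂ} (hv : ∀ x, v (-x) = v x) (j : ℤ) :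
    fourierInt v (-j) = fourierInt v j := by
  rw [fourierInt, fourierInt, setIntegral_periodI, setIntegral_periodI]
  have h := intervalIntegral.integral_comp_neg (a := -Real.pi) (b := Real.pi)
    (fun x => v x * expI (-j) x)
  rw [neg_neg] at h
  rw [← h]
  refine intervalIntegral.integral_congr fun x _ => ?_
  simp only [hv]
  congr 1
  simp [expI]

theorem fourierInt_logKer {j : ℤ} (hj : j ≠ 0) :
    fourierInt (fun x => (logKer x : ℂ)) j = -(Real.pi / |(j : ℝ)| : ℝ) := by
  have he : ∀ x, ((logKer (-x) : ℝ) : ℂ) = logKer x := fun x => by rw [logKer_neg]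
  obtain ⟨n, rfl | rfl⟩ := j.eq_nat_or_neg
  · rw [fourierInt_logKer_natCast (by exact_mod_cast hj)]
    simp
  · rw [fourierInt_neg_of_even he, fourierInt_logKer_natCast (by simpa using hj)]
    simp

/-- The kernel `4 sin² (x / 2) log (√2 |sin (x / 2)|)`. -/
def sinLogKer (x : ℝ) : ℝ := (2 - 2 * Real.cos x) * logKer x

theorem measurable_sinLogKer : Measurable sinLogKer := by
  have := measurable_logKer
  unfold sinLogKer
  fun_prop

theorem periodic_sinLogKer : Function.Periodic sinLogKer (2 * Real.pi) := by
  intro x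
  rw [sinLogKer, sinLogKer, periodic_logKer, Real.cos_periodic]

theorem sinLogKer_neg (x : ℝ) : sinLogKer (-x) = sinLogKer x := by
  rw [sinLogKer, sinLogKer, logKer_neg, Real.cos_neg]

/-- Multiplication by 2 - 2cos x acts on Fourier coefficients as a negative second difference, which
is how the extra decay arises. -/
theorem sinLogKer_eq (x : ℝ) : (sinLogKer x : ℂ) =
    2 * (logKer x : ℂ) - (logKer x : ℂ) * expI 1 x - (logKer x : ℂ) * expI (-1) x := by
  have h : expI 1 x + expI (-1) x = 2 * (Real.cos x : ℂ) := by
    rw [expI, expI, Complex.ofReal_cos, Complex.cos]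
    push_cast
    ring_nf
  rw [sinLogKer]
  push_cast at h ⊢
  linear_combination (logKer x : ℂ) * h

theorem integrableOn_sinLogKer : IntegrableOn (fun x => (sinLogKer x : ℂ)) periodI := by
  simp only [sinLogKer_eq]
  exact ((integrableOn_logKer.const_mul 2).sub (integrableOn_logKer.mul_expI 1)).sub
    (integrableOn_logKer.mul_expI (-1))

theorem fourierInt_sinLogKer (j : ℤ) : fourierInt (fun x => (sinLogKer x : ℂ)) j =
    2 * fourierInt (fun x => (logKer x : ℂ)) j - fourierInt (fun x => (logKer x : ℂ)) (j - 1) -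
      fourierInt (fun x => (logKer x : ℂ)) (j + 1) := by
  simp only [fourierInt]
  have hi : ∀ n, Integrable (fun x => (logKer x : ℂ) * expI n x) (volume.restrict periodI) :=
    fun n => integrableOn_logKer.mul_expI n
  have hi2 : Integrable (fun x => 2 * ((logKer x : ℂ) * expI (-j) x) -
      (logKer x : ℂ) * expI (-(j - 1)) x) (volume.restrict periodI) :=
    ((hi _).const_mul 2).sub (hi _)
  rw [← integral_const_mul, ← integral_sub ((hi _).const_mul 2) (hi _),
    ← integral_sub hi2 (hi _)]
  refine integral_congr_ae (Filter.Eventually.of_forall fun x => ?_)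
  simp only [sinLogKer_eq]
  rw [show -(j - 1) = 1 + -j by ring, show -(j + 1) = -1 + -j by ring, expI_add, expI_add (-1)]
  ring

theorem exists_logKer_bound :
    ∃ A : ℝ, ∀ j : ℤ, ‖fourierInt (fun x => (logKer x : ℂ)) j‖ * jap j ≤ A := by
  refine ⟨max (‖fourierInt (fun x => (logKer x : ℂ)) 0‖ * jap 0) (2 * Real.pi), fun j => ?_⟩
  rcases eq_or_ne j 0 with rfl | hj
  · exact le_max_left _ _
  · refine le_trans ?_ (le_max_right _ _)
    have h1 : (1 : ℝ) ≤ |(j : ℝ)| := by exact_mod_cast Int.one_le_abs hj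
    have h2 : jap j ≤ 2 * |(j : ℝ)| := by
      rw [jap, Real.sqrt_le_iff]
      refine ⟨by positivity, ?_⟩
      rw [mul_pow, sq_abs]
      have := sq_abs (j : ℝ)
      nlinarith
    rw [fourierInt_logKer hj, norm_neg, Complex.norm_real, Real.norm_of_nonneg (by positivity)]
    calc Real.pi / |(j : ℝ)| * jap j ≤ Real.pi / |(j : ℝ)| * (2 * |(j : ℝ)|) :=
          mul_le_mul_of_nonneg_left h2 (by positivity)
      _ = 2 * Real.pi := by field_simp

/-- The second difference of -π/j is of order j⁻³, more than is claimed. The formula needs j - 1 ≠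
0, so j = 0 and j = 1 are covered by the maximum; negative j follow by evenness. -/
theorem exists_sinLogKer_bound :
    ∃ A : ℝ, ∀ j : ℤ, ‖fourierInt (fun x => (sinLogKer x : ℂ)) j‖ * jap j ^ 2 ≤ A := by
  set B : ℤ → ℝ := fun j => ‖fourierInt (fun x => (sinLogKer x : ℂ)) j‖ * jap j ^ 2 with hB
  have he : ∀ x, ((sinLogKer (-x) : ℝ) : ℂ) = sinLogKer x := fun x => by rw [sinLogKer_neg]
  have hnat : ∀ n : ℕ, B n ≤ max (max (B 0) (B 1)) (4 * Real.pi) := by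
    intro n
    match n with
    | 0 => exact (le_max_left _ _).trans (le_max_left _ _)
    | 1 => exact (le_max_right _ _).trans (le_max_left _ _)
    | n + 2 =>
      refine le_trans ?_ (le_max_right _ _)
      have hn : (0 : ℝ) ≤ n := Nat.cast_nonneg n
      have e : fourierInt (fun x => (sinLogKer x : ℂ)) ((n + 2 : ℕ) : ℤ) =
          ((2 * Real.pi / ((n + 1) * (n + 2) * (n + 3)) : ℝ) : ℂ) := by
        rw [fourierInt_sinLogKer, show ((n + 2 : ℕ) : ℤ) - 1 = ((n + 1 : ℕ) : ℤ) by push_cast; ring,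
          show ((n + 2 : ℕ) : ℤ) + 1 = ((n + 3 : ℕ) : ℤ) by push_cast; ring,
          fourierInt_logKer_natCast (by omega), fourierInt_logKer_natCast (by omega),
          fourierInt_logKer_natCast (by omega)]
        have h1 : (n : ℂ) + 1 ≠ 0 := by exact_mod_cast Nat.succ_ne_zero n
        have h2 : (n : ℂ) + 2 ≠ 0 := by exact_mod_cast Nat.succ_ne_zero (n + 1)
        have h3 : (n : ℂ) + 3 ≠ 0 := by exact_mod_cast Nat.succ_ne_zero (n + 2)
        push_cast
        field_simp
        ring
      simp only [hB]
      rw [e, Complex.norm_real, Real.norm_of_nonneg (by positivity), jap_sq, div_mul_eq_mul_div,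
        div_le_iff₀ (by positivity)]
      push_cast
      have : 1 + ((n : ℝ) + 2) ^ 2 ≤ 2 * ((n + 1) * (n + 2) * (n + 3)) := by nlinarith
      nlinarith [Real.pi_pos]
  refine ⟨max (max (B 0) (B 1)) (4 * Real.pi), fun j => ?_⟩
  obtain ⟨n, rfl | rfl⟩ := j.eq_nat_or_neg
  · exact hnat n
  · have hs : B (-(n : ℤ)) = B n := by
      simp only [hB]
      rw [fourierInt_neg_of_even he, jap_sq, jap_sq]
      push_cast
      ring
    exact hs.le.trans (hnat n)

end

noncomputable section

/-! ### The substitution `t = cos θ` -/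

theorem cos_image_Ioo : Real.cos '' Ioo 0 Real.pi = arcI := by
  ext t
  constructor
  · rintro ⟨θ, hθ, rfl⟩
    exact cos_mem_arcI (Real.sin_pos_of_pos_of_lt_pi hθ.1 hθ.2).ne'
  · intro ht
    refine ⟨Real.arccos t, ⟨Real.arccos_pos.2 ht.2, ?_⟩, Real.cos_arccos ht.1.le ht.2.le⟩
    exact (Real.arccos_le_pi t).lt_of_ne fun h => by
      have := Real.arccos_eq_pi.1 h
      linarith [ht.1]

theorem sin_pos_of_mem {θ : ℝ} (h : θ ∈ Ioo 0 Real.pi) : 0 < Real.sin θ :=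
  Real.sin_pos_of_pos_of_lt_pi h.1 h.2

theorem injOn_cos_Ioo : InjOn Real.cos (Ioo 0 Real.pi) :=
  Real.injOn_cos.mono Ioo_subset_Icc_self

theorem integral_arcI (g : ℝ → ℂ) :
    ∫ t in arcI, g t = ∫ θ in Ioo 0 Real.pi, (Real.sin θ : ℂ) * g (Real.cos θ) := by
  rw [← cos_image_Ioo, integral_image_eq_integral_abs_deriv_smul measurableSet_Ioo
    (fun x _ => (Real.hasDerivAt_cos x).hasDerivWithinAt) injOn_cos_Ioo]
  refine setIntegral_congr_fun measurableSet_Ioo fun θ hθ => ?_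
  rw [abs_neg, abs_of_pos (sin_pos_of_mem hθ), Complex.real_smul]

theorem integrableOn_arcI_iff (g : ℝ → ℂ) : IntegrableOn g arcI ↔
    IntegrableOn (fun θ => (Real.sin θ : ℂ) * g (Real.cos θ)) (Ioo 0 Real.pi) := by
  rw [← cos_image_Ioo, integrableOn_image_iff_integrableOn_abs_deriv_smul measurableSet_Ioo
    (fun x _ => (Real.hasDerivAt_cos x).hasDerivWithinAt) injOn_cos_Ioo]
  refine integrableOn_congr_fun (fun θ hθ => ?_) measurableSet_Ioo
  rw [abs_neg, abs_of_pos (sin_pos_of_mem hθ), Complex.real_smul]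

/-- The cosine is differentiable, hence maps null sets to null sets, and it covers the interval. -/
theorem ae_arcI_of_ae_cos {p : ℝ → Prop}
    (h : ∀ᵐ θ ∂volume.restrict (Ioo 0 Real.pi), p (Real.cos θ)) :
    ∀ᵐ t ∂volume.restrict arcI, p t := by
  rw [ae_restrict_iff' measurableSet_Ioo] at h
  rw [ae_restrict_iff' (show MeasurableSet arcI from measurableSet_Ioo)]
  have h0 : volume {θ | ¬ (θ ∈ Ioo 0 Real.pi → p (Real.cos θ))} = 0 := h
  have h1 := addHaar_image_eq_zero_of_differentiableOn_of_addHaar_eq_zero (μ := volume)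
    (f := Real.cos) (Real.differentiable_cos.differentiableOn) h0
  refine measure_mono_null ?_ h1
  intro t ht
  have ht' : t ∈ arcI ∧ ¬ p t := by simpa using ht
  have ha := ht'.1
  rw [← cos_image_Ioo] at ha
  obtain ⟨θ, hθ, rfl⟩ := ha
  exact ⟨θ, fun hc => ht'.2 (hc hθ), rfl⟩

theorem integrableOn_periodI_iff_halves {g : ℝ → ℂ} : IntegrableOn g periodI ↔
    IntegrableOn g (Ioo 0 Real.pi) ∧ IntegrableOn (fun θ => g (-θ)) (Ioo 0 Real.pi) := by
  have hπ := Real.pi_pos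
  have e : ∀ f : ℝ → ℂ, IntegrableOn f (Ioo 0 Real.pi) ↔ IntervalIntegrable f volume 0 Real.pi :=
    fun f => (intervalIntegrable_iff_integrableOn_Ioo_of_le hπ.le).symm
  rw [e, e, integrableOn_periodI_iff]
  have e2 : IntervalIntegrable (fun θ => g (-θ)) volume 0 Real.pi ↔
      IntervalIntegrable g volume (-Real.pi) 0 := by
    rw [IntervalIntegrable.iff_comp_neg]
    simp only [neg_neg, neg_zero]
    exact ⟨fun h => h.symm, fun h => h.symm⟩
  rw [e2]
  constructor
  · intro h
    exact ⟨h.mono_set (by rw [uIcc_of_le hπ.le, uIcc_of_le (by linarith)]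
                          exact Icc_subset_Icc (by linarith) le_rfl),
      h.mono_set (by rw [uIcc_of_le (by linarith), uIcc_of_le (by linarith)]
                     exact Icc_subset_Icc le_rfl hπ.le)⟩
  · rintro ⟨h1, h2⟩
    exact h2.trans h1

theorem integral_periodI_eq_halves {g : ℝ → ℂ} (hg : IntegrableOn g periodI) :
    ∫ θ in periodI, g θ = ∫ θ in Ioo 0 Real.pi, (g θ + g (-θ)) := by
  have hπ := Real.pi_pos
  obtain ⟨h1, h2⟩ := integrableOn_periodI_iff_halves.1 hg
  have e : ∀ f : ℝ → ℂ, ∫ θ in Ioo 0 Real.pi, f θ = ∫ θ in (0 : ℝ)..Real.pi, f θ := fun f => by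
    rw [intervalIntegral.integral_of_le hπ.le, integral_Ioc_eq_integral_Ioo]
  rw [integral_add h1 h2, e, e, setIntegral_periodI, intervalIntegral.integral_comp_neg, neg_zero,
    add_comm]
  have hi := integrableOn_periodI_iff.1 hg
  refine (intervalIntegral.integral_add_adjacent_intervals (hi.mono_set ?_) (hi.mono_set ?_)).symm
  · rw [uIcc_of_le (by linarith), uIcc_of_le (by linarith)]
    exact Icc_subset_Icc le_rfl hπ.le
  · rw [uIcc_of_le hπ.le, uIcc_of_le (by linarith)]
    exact Icc_subset_Icc (by linarith) le_rfl

theorem expI_add_expI_neg (n : ℤ) (x : ℝ) :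
    expI (-n) x + expI (-n) (-x) = 2 * (Real.cos (n * x) : ℂ) := by
  rw [expI, expI, Complex.ofReal_cos, Complex.cos]
  push_cast
  ring_nf

theorem fourierInt_of_even {g : ℝ → ℂ} (hg : IntegrableOn g periodI) (he : ∀ θ, g (-θ) = g θ)
    (n : ℤ) : fourierInt g n = 2 * ∫ θ in Ioo 0 Real.pi, g θ * (Real.cos (n * θ) : ℂ) := by
  rw [fourierInt, integral_periodI_eq_halves (hg.mul_expI _), ← integral_const_mul]
  refine setIntegral_congr_fun measurableSet_Ioo fun θ _ => ?_
  simp only [he]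
  rw [← mul_add, expI_add_expI_neg]
  ring

/-- The factor that normalizes the Chebyshev polynomials of the first kind. -/
def chebNorm (n : ℕ) : ℝ :=
  if n = 0 then Real.sqrt (1 / Real.pi) else Real.sqrt (2 / Real.pi)

theorem chebNorm_pos (n : ℕ) : 0 < chebNorm n := by
  have := Real.pi_pos
  unfold chebNorm
  split_ifs <;> positivity

theorem chebNorm_ge (n : ℕ) : 1 / 2 ≤ chebNorm n := by
  have h1 := Real.pi_pos
  have h2 := Real.pi_le_four
  have h3 : (1 : ℝ) / 2 ≤ Real.sqrt (1 / Real.pi) := by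
    refine Real.le_sqrt_of_sq_le ?_
    rw [le_div_iff₀ h1]
    linarith
  unfold chebNorm
  split_ifs
  · exact h3
  · refine h3.trans (Real.sqrt_le_sqrt ?_)
    gcongr
    norm_num

theorem chebNorm_le (n : ℕ) : chebNorm n ≤ 2 := by
  have h1 := Real.pi_gt_three
  unfold chebNorm
  split_ifs
  · refine Real.sqrt_le_iff.2 ⟨by norm_num, ?_⟩
    rw [div_le_iff₀ (by linarith)]
    linarith
  · refine Real.sqrt_le_iff.2 ⟨by norm_num, ?_⟩
    rw [div_le_iff₀ (by linarith)]
    linarith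

theorem chebT_cos (n : ℕ) (θ : ℝ) : chebT n (Real.cos θ) = chebNorm n * Real.cos (n * θ) := by
  rw [chebT, Polynomial.Chebyshev.T_real_cos]
  simp [chebNorm]

theorem chebWeight_cos {θ : ℝ} (h : θ ∈ Ioo 0 Real.pi) :
    chebWeight (Real.cos θ) = Real.sin θ := by
  rw [chebWeight, ← Real.abs_sin_eq_sqrt_one_sub_cos_sq, abs_of_pos (sin_pos_of_mem h)]

theorem cos_natAbs_mul (n : ℤ) (θ : ℝ) : Real.cos ((n.natAbs : ℝ) * θ) = Real.cos (n * θ) := by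
  obtain ⟨k, rfl | rfl⟩ := n.eq_nat_or_neg
  · simp
  · simp

/-- The even periodic function `u(cos φ) |sin φ|`. -/
def evenLift (u : ℝ → ℂ) (φ : ℝ) : ℂ := ((|Real.sin φ| : ℝ) : ℂ) * u (Real.cos φ)

theorem evenLift_neg (u : ℝ → ℂ) (φ : ℝ) : evenLift u (-φ) = evenLift u φ := by
  simp [evenLift]

theorem evenLift_of_mem (u : ℝ → ℂ) {φ : ℝ} (h : φ ∈ Ioo 0 Real.pi) :
    evenLift u φ = (Real.sin φ : ℂ) * u (Real.cos φ) := by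
  rw [evenLift, abs_of_pos (sin_pos_of_mem h)]

theorem integrableOn_evenLift {u : ℝ → ℂ} (hu : IntegrableOn u arcI) :
    IntegrableOn (evenLift u) periodI := by
  have h1 : IntegrableOn (evenLift u) (Ioo 0 Real.pi) :=
    (integrableOn_congr_fun (fun φ hφ => evenLift_of_mem u hφ) measurableSet_Ioo).2
      ((integrableOn_arcI_iff u).1 hu)
  refine integrableOn_periodI_iff_halves.2 ⟨h1, ?_⟩
  simpa only [evenLift_neg] using h1

/-- The factor |sin φ| of the lift is exactly the Jacobian of the substitution, and T_n(cos θ) = cos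
nθ; the 2 counts the two halves of the period. -/
theorem fourierInt_evenLift {u : ℝ → ℂ} (hu : IntegrableOn u arcI) (n : ℤ) :
    fourierInt (evenLift u) n =
      ((2 / chebNorm n.natAbs : ℝ) : ℂ) * ∫ t in arcI, u t * famT n.natAbs t := by
  rw [fourierInt_of_even (integrableOn_evenLift hu) (evenLift_neg u), integral_arcI,
    ← integral_const_mul, ← integral_const_mul]
  refine setIntegral_congr_fun measurableSet_Ioo fun θ hθ => ?_
  simp only [famT]
  rw [chebT_cos, cos_natAbs_mul, evenLift_of_mem u hθ]
  have := (chebNorm_pos n.natAbs).ne'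
  have hc : (chebNorm n.natAbs : ℂ) ≠ 0 := by exact_mod_cast this
  simp only [Complex.ofReal_div, Complex.ofReal_mul, Complex.ofReal_ofNat]
  field_simp

/-- Here the weight w⁻¹ cancels the Jacobian, so the image needs no factor |sin θ|. An identity
almost everywhere is enough, since the integral operator is only known to converge for almost every
θ. -/
theorem coeff_famW_of_even {h w : ℝ → ℂ} (hh : IntegrableOn h periodI) (he : ∀ θ, h (-θ) = h θ)
    (hw : ∀ᵐ θ ∂volume.restrict (Ioo 0 Real.pi), w (Real.cos θ) = h θ) (k : ℕ) :
    IntegrableOn (fun t => w t * famW k t) arcI ∧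
    ∫ t in arcI, w t * famW k t = ((chebNorm k / 2 : ℝ) : ℂ) * fourierInt h k := by
  have e : (fun θ => (Real.sin θ : ℂ) * (w (Real.cos θ) * famW k (Real.cos θ)))
      =ᵐ[volume.restrict (Ioo 0 Real.pi)]
      fun θ => (chebNorm k : ℂ) * (h θ * (Real.cos (k * θ) : ℂ)) := by
    filter_upwards [hw, ae_restrict_mem measurableSet_Ioo] with θ hwθ hθ
    have hs : (Real.sin θ : ℂ) ≠ 0 := by exact_mod_cast (sin_pos_of_mem hθ).ne'
    rw [hwθ, famW, chebT_cos, chebWeight_cos hθ]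
    simp only [Complex.ofReal_mul, Complex.ofReal_inv]
    field_simp
  constructor
  · rw [integrableOn_arcI_iff, IntegrableOn, integrable_congr e]
    refine Integrable.const_mul ?_ _
    refine Integrable.mul_bdd (c := 1) (integrableOn_periodI_iff_halves.1 hh).1 ?_ ?_
    · exact (by fun_prop : Continuous fun θ : ℝ => ((Real.cos (k * θ) : ℝ) : ℂ)).aestronglyMeasurable
    · refine Filter.Eventually.of_forall fun θ => ?_
      rw [Complex.norm_real]
      exact Real.abs_cos_le_one _
  · rw [integral_arcI, integral_congr_ae e, integral_const_mul,
      fourierInt_of_even hh he]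
    push_cast
    ring

/-! ### Linear independence -/

/-- Dedekind's independence of characters; distinct frequencies are told apart by the derivative at
0. -/
theorem linearIndependent_expI : LinearIndependent ℂ expI := by
  let F : ℤ → (Multiplicative ℝ →* ℂ) := fun n =>
    { toFun := fun x => expI n x.toAdd
      map_one' := by simp [expI]
      map_mul' := fun x y => by rw [toAdd_mul, expI_add_arg] }
  have hF : Function.Injective F := by
    intro n m h
    have h1 : expI n = expI m := by
      ext x
      exact DFunLike.congr_fun h (Multiplicative.ofAdd x)
    have h2 := (hasDerivAt_expI n 0).unique (h1 ▸ hasDerivAt_expI m 0)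
    rw [h1] at h2
    have h3 : expI m 0 ≠ 0 := by simp [expI]
    have h4 := mul_left_cancel₀ Complex.I_ne_zero (mul_right_cancel₀ h3 h2)
    exact_mod_cast h4
  exact (linearIndependent_monoidHom (Multiplicative ℝ) ℂ).comp F hF

theorem linearIndependent_famH : LinearIndependent ℂ famH := by
  have h0 : ((Real.sqrt (2 * Real.pi) : ℝ) : ℂ)⁻¹ ≠ 0 := by
    have : Real.sqrt (2 * Real.pi) ≠ 0 := (Real.sqrt_pos.2 (by positivity)).ne'
    exact inv_ne_zero (by exact_mod_cast this)
  have h1 := (linearIndependent_expI.comp (fun n : ℤ => -n) neg_injective).units_smul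
    (fun _ => Units.mk0 _ h0)
  have e : famH = (fun _ : ℤ => Units.mk0 _ h0) • (expI ∘ fun n : ℤ => -n) := by
    ext n x
    rw [famH_eq]
    simp [Units.smul_def, div_eq_inv_mul]
  rw [e]
  exact h1

theorem linearIndependent_famW : LinearIndependent ℂ famW := by
  let S : Polynomial.Sequence ℂ :=
    { elems' := fun n => Polynomial.Chebyshev.T ℂ n
      degree_eq' := fun n => by simp [Polynomial.Chebyshev.degree_T] }
  have hS : LinearIndependent ℂ (fun n : ℕ => Polynomial.Chebyshev.T ℂ n) := S.linearIndependent
  rw [linearIndependent_iff'] at hS ⊢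
  intro s g hg i hi
  -- On (-1, 1) the common factor w⁻¹ is nonzero, so the relation becomes a polynomial vanishing at
  -- infinitely many points; Chebyshev polynomials are independent by degree.
  have h1 : ∑ n ∈ s, (g n * (chebNorm n : ℂ)) • Polynomial.Chebyshev.T ℂ n = 0 := by
    refine Polynomial.eq_zero_of_infinite_isRoot _ ?_
    refine Set.Infinite.mono (s := (fun t : ℝ => (t : ℂ)) '' arcI) ?_
      ((Ioo_infinite (by norm_num : (-1 : ℝ) < 1)).image Complex.ofReal_injective.injOn)
    rintro _ ⟨t, ht, rfl⟩
    have h2 := congrFun hg t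
    have hw : 0 < chebWeight t := Real.sqrt_pos.2 (by nlinarith [ht.1, ht.2])
    have hw' : (chebWeight t : ℂ) ≠ 0 := by exact_mod_cast hw.ne'
    simp only [Finset.sum_apply, Pi.smul_apply, Pi.zero_apply, smul_eq_mul, famW, chebT] at h2
    show Polynomial.eval _ _ = 0
    rw [Polynomial.eval_finsetSum]
    have h3 : ∀ n ∈ s, g n * (((if n = 0 then Real.sqrt (1 / Real.pi) else Real.sqrt (2 / Real.pi)) *
        (Polynomial.Chebyshev.T ℝ n).eval t * (chebWeight t)⁻¹ : ℝ) : ℂ) =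
        (((g n * (chebNorm n : ℂ)) • Polynomial.Chebyshev.T ℂ n).eval (t : ℂ)) *
          (chebWeight t : ℂ)⁻¹ := by
      intro n _
      rw [Polynomial.eval_smul, smul_eq_mul, ← Polynomial.Chebyshev.complex_ofReal_eval_T,
        Complex.ofReal_mul, Complex.ofReal_mul, Complex.ofReal_inv, chebNorm]
      ring
    rw [Finset.sum_congr rfl h3, ← Finset.sum_mul] at h2
    exact (mul_eq_zero.1 h2).resolve_right (inv_ne_zero hw')
  have h4 := hS s _ h1 i hi
  have h5 : (chebNorm i : ℂ) ≠ 0 := by exact_mod_cast (chebNorm_pos i).ne'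
  exact (mul_eq_zero.1 h4).resolve_right h5

end

noncomputable section

/-! ### Operators with kernels `a(θ - φ) Φ(θ, φ)` -/

/-- `Φ` is the sum of an absolutely convergent double Fourier series, with a bound for a weighted
`ℓ²`-norm of the coefficients. -/
def HasFourierBound (τ W : ℝ) (Φ : ℝ × ℝ → ℂ) : Prop :=
  0 ≤ W ∧ Continuous Φ ∧ ∃ σ : ℤ × ℤ → ℂ,
    (∀ x, HasSum (fun p : ℤ × ℤ => σ p * (expI p.1 x.1 * expI p.2 x.2)) (Φ x)) ∧
    (Summable fun p => (latticeWeight p ^ τ * ‖σ p‖) ^ 2) ∧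
    ∑' p, (latticeWeight p ^ τ * ‖σ p‖) ^ 2 ≤ W ^ 2

/-- `a` is periodic and integrable over a period, with Fourier coefficients of order `-1`. -/
structure IsConvKernel (a : ℝ → ℂ) (A : ℝ) : Prop where
  measurable : Measurable a
  periodic : Function.Periodic a (2 * Real.pi)
  integrable : IntegrableOn a periodI
  bound : ∀ j, ‖fourierInt a j‖ * jap j ≤ A

theorem exists_periodic_operator (s : ℝ) {τ : ℝ} (hτ : excessOrder s + 1 < τ) :
    ∃ C : ℝ, 0 ≤ C ∧ ∀ (Φ : ℝ × ℝ → ℂ) (W : ℝ), HasFourierBound τ W Φ →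
      ∀ (a : ℝ → ℂ) (A : ℝ), IsConvKernel a A →
      ∃ K : EllTwo ℤ →L[ℂ] EllTwo ℤ, ‖K‖ ≤ C * A * W ∧
        (Summable (fun j => (‖fourierInt a j‖ * jap j) ^ 2) → IsCompactOperator K) ∧
        ∀ v, IntegrableOn v periodI → ∀ c : EllTwo ℤ,
          (∀ n, fourierInt v n = ((jap n ^ (-s) : ℝ) : ℂ) * c n) →
          (∀ᵐ θ ∂volume.restrict periodI,
            IntegrableOn (fun φ => a (θ - φ) * Φ (θ, φ) * v φ) periodI) ∧
          IntegrableOn (fun θ => ∫ φ in periodI, a (θ - φ) * Φ (θ, φ) * v φ) periodI ∧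
          ∀ k, K c k = ((jap k ^ (s + 1) : ℝ) : ℂ) *
            fourierInt (fun θ => ∫ φ in periodI, a (θ - φ) * Φ (θ, φ) * v φ) k := by
  obtain ⟨C, hC, H⟩ := exists_matrix_operator s τ hτ
  refine ⟨C, hC, ?_⟩
  rintro Φ W ⟨hW, hΦc, σ, hΦ, hσ1, hσ2⟩ a A ha
  obtain ⟨hσ, K, hK, hKc, hKf⟩ := H σ (fourierInt a) A W hW ha.bound hσ1 hσ2
  refine ⟨K, hK, hKc, fun v hv c hc => ?_⟩
  obtain ⟨h1, h2, h3⟩ := fourierInt_integral_operator ha.measurable ha.periodic ha.integrable hv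
    hσ hΦc hΦ
  refine ⟨h1, h2, fun k => ?_⟩
  rw [hKf c (∫ x in periodI, ‖v x‖) (fun n => ?_) k, h3]
  · simp only [hc]
  · have := norm_fourierInt_le v n
    rw [hc, norm_mul, Complex.norm_real,
      Real.norm_of_nonneg (Real.rpow_nonneg (jap_pos n).le _)] at this
    exact this

theorem exists_H_operator (s : ℝ) {τ : ℝ} (hτ : excessOrder s + 1 < τ) :
    ∃ C : ℝ, 0 ≤ C ∧ ∀ (Φ : ℝ × ℝ → ℂ) (W : ℝ), HasFourierBound τ W Φ →
      ∀ (a : ℝ → ℂ) (A : ℝ), IsConvKernel a A →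
      ∃ T : SpaceH s →L[ℂ] SpaceH (s + 1),
        IsIntegralOp periodI (fun θ φ => a (θ - φ) * Φ (θ, φ)) T ∧
        (Summable (fun j => (‖fourierInt a j‖ * jap j) ^ 2) → IsCompactOperator T) ∧
        ‖T‖ ≤ C * A * W := by
  obtain ⟨C, hC, H⟩ := exists_periodic_operator s hτ
  refine ⟨C, hC, fun Φ W hΦ a A ha => ?_⟩
  obtain ⟨K, hK, hKc, hKf⟩ := H Φ W hΦ a A ha
  obtain ⟨T, hT, hTn, hTc⟩ := exists_sobolev_operator (b := famH) linearIndependent_famH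
    (fun n : ℤ => (n : ℝ)) (fun n : ℤ => (n : ℝ)) s (s + 1) K
  refine ⟨T, fun u U hu hU => ?_, fun h => hTc (hKc h), hTn.trans hK⟩
  set q : ℂ := ((Real.sqrt (2 * Real.pi) : ℝ) : ℂ) with hq
  have hq0 : q ≠ 0 := by
    have : Real.sqrt (2 * Real.pi) ≠ 0 := (Real.sqrt_pos.2 (by positivity)).ne'
    rw [hq]
    exact_mod_cast this
  have hfam : ∀ (v : ℝ → ℂ) (n : ℤ), ∫ x in periodI, v x * famH n x = fourierInt v n / q := by
    intro v n
    rw [fourierInt, ← integral_div]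
    simp only [famH_eq, mul_div_assoc, hq]
  have hw : ∀ (n : ℤ) (r : ℝ), (1 + (n : ℝ) ^ 2) ^ (r / 2) = jap n ^ r := fun n r => (jap_rpow n r).symm
  -- The factor `q` = √(2π) passes from normalized coefficients to unnormalized Fourier integrals;
  -- by linearity it cancels against the same factor in the image.
  obtain ⟨h1, h2, h3⟩ := hKf u hu (q • sobolevIsometry famH (fun n : ℤ => (n : ℝ)) s U) (by
    intro n
    rw [lp.coeFn_smul, Pi.smul_apply, sobolevIsometry_apply, (hU.coeff_eq n).2, hfam, hw,
      Real.rpow_neg (jap_pos n).le, smul_eq_mul]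
    have h0 : ((jap n ^ s : ℝ) : ℂ) ≠ 0 := by
      exact_mod_cast (Real.rpow_pos_of_pos (jap_pos n) s).ne'
    push_cast
    field_simp)
  refine ⟨h1, represents_of_basis fun k => ⟨?_, ?_⟩⟩
  · have := h2.mul_expI (-k)
    simp only [famH_eq, ← mul_div_assoc]
    exact this.div_const _
  · rw [hfam]
    have h4 := hT U k
    have h5 := h3 k
    rw [map_smul, lp.coeFn_smul, Pi.smul_apply, smul_eq_mul, ← h4, hw] at h5
    have h0 : ((jap k ^ (s + 1) : ℝ) : ℂ) ≠ 0 := by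
      exact_mod_cast (Real.rpow_pos_of_pos (jap_pos k) (s + 1)).ne'
    rw [eq_div_iff hq0]
    refine mul_left_cancel₀ h0 ?_
    rw [← h5]
    ring

/-- In coordinates this is the passage from u to its even lift. The map n ↦ |n| is injective on n ≥
0 and on n < 0 separately, hence two weighted compositions, each of norm at most 4. -/
theorem exists_even_extension :
    ∃ E : EllTwo ℕ →L[ℂ] EllTwo ℤ,
      (∀ c n, E c n = ((2 / chebNorm n.natAbs : ℝ) : ℂ) * c n.natAbs) ∧ ‖E‖ ≤ 8 := by
  have hb : ∀ n : ℕ, ‖((2 / chebNorm n : ℝ) : ℂ)‖ ≤ 4 := by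
    intro n
    have h1 := chebNorm_pos n
    have h2 := chebNorm_ge n
    rw [Complex.norm_real, Real.norm_of_nonneg (by positivity), div_le_iff₀ h1]
    linarith
  obtain ⟨E₁, h1, n1⟩ := EllTwo.exists_weightedComp
    (fun n : ℤ => if 0 ≤ n then ((2 / chebNorm n.natAbs : ℝ) : ℂ) else 0) Int.natAbs (by
      intro x hx y hy h
      have hx' : 0 ≤ x := by by_contra h'; simp [h'] at hx
      have hy' : 0 ≤ y := by by_contra h'; simp [h'] at hy
      omega) 4 (by norm_num) (fun n => by
        split_ifs
        · exact hb _
        · simp)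
  obtain ⟨E₂, h2, n2⟩ := EllTwo.exists_weightedComp
    (fun n : ℤ => if 0 ≤ n then 0 else ((2 / chebNorm n.natAbs : ℝ) : ℂ)) Int.natAbs (by
      intro x hx y hy h
      have hx' : ¬ 0 ≤ x := by simp at hx; omega
      have hy' : ¬ 0 ≤ y := by simp at hy; omega
      omega) 4 (by norm_num) (fun n => by
        split_ifs
        · simp
        · exact hb _)
  refine ⟨E₁ + E₂, fun c n => ?_, (norm_add_le _ _).trans (by linarith)⟩
  rw [add_apply, lp.coeFn_add, Pi.add_apply, h1, h2]
  split_ifs <;> simp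

theorem exists_even_restriction :
    ∃ P : EllTwo ℤ →L[ℂ] EllTwo ℕ,
      (∀ c (k : ℕ), P c k = ((chebNorm k / 2 : ℝ) : ℂ) * c k) ∧ ‖P‖ ≤ 1 := by
  refine EllTwo.exists_weightedComp (fun k : ℕ => ((chebNorm k / 2 : ℝ) : ℂ)) (fun k : ℕ => (k : ℤ))
    (fun x _ y _ h => by simpa using h) 1 zero_le_one fun k => ?_
  have h1 := chebNorm_pos k
  have h2 := chebNorm_le k
  rw [Complex.norm_real, Real.norm_of_nonneg (by positivity)]
  linarith

theorem setIntegral_periodI_comp_neg (g : ℝ → ℂ) :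
    ∫ x in periodI, g (-x) = ∫ x in periodI, g x := by
  rw [setIntegral_periodI, setIntegral_periodI, intervalIntegral.integral_comp_neg, neg_neg]

/-- The operator is the periodic one between even extension and restriction to k ≥ 0. The symmetries
of Φ and a make the image even, and folding the φ-integral to (0, π) adds the contributions of φ and
-φ, which is the assumed form of κ. The diagonal, where the splitting of the logarithm can fail, is
null. -/
theorem exists_T_operator (s : ℝ) {τ : ℝ} (hτ : excessOrder s + 1 < τ) :
    ∃ C : ℝ, 0 ≤ C ∧ ∀ (Φ : ℝ × ℝ → ℂ) (W : ℝ), HasFourierBound τ W Φ →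
      (∀ θ φ, Φ (-θ, -φ) = Φ (θ, φ)) →
      ∀ (a : ℝ → ℂ) (A : ℝ), IsConvKernel a A → (∀ x, a (-x) = a x) →
      ∀ κ : ℝ → ℝ → ℂ, (∀ θ ∈ Ioo 0 Real.pi, ∀ φ ∈ Ioo 0 Real.pi, θ ≠ φ →
        κ (Real.cos θ) (Real.cos φ) = a (θ - φ) * Φ (θ, φ) + a (θ + φ) * Φ (θ, -φ)) →
      ∃ T : SpaceT s →L[ℂ] SpaceW (s + 1),
        IsIntegralOp arcI κ T ∧
        (Summable (fun j => (‖fourierInt a j‖ * jap j) ^ 2) → IsCompactOperator T) ∧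
        ‖T‖ ≤ C * A * W := by
  obtain ⟨C, hC, H⟩ := exists_periodic_operator s hτ
  obtain ⟨E, hE, hEn⟩ := exists_even_extension
  obtain ⟨P, hP, hPn⟩ := exists_even_restriction
  refine ⟨8 * C, by positivity, fun Φ W hΦ hΦe a A ha hae κ hκ => ?_⟩
  obtain ⟨K, hK, hKc, hKf⟩ := H Φ W hΦ a A ha
  obtain ⟨T, hT, hTn, hTc⟩ := exists_sobolev_operator (b := famT) linearIndependent_famW
    (fun n : ℕ => (n : ℝ)) (fun n : ℕ => (n : ℝ)) s (s + 1) (P.comp (K.comp E))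
  have hnorm : ‖P.comp (K.comp E)‖ ≤ 8 * C * A * W := by
    calc ‖P.comp (K.comp E)‖ ≤ ‖P‖ * (‖K‖ * ‖E‖) :=
          (P.opNorm_comp_le _).trans
            (mul_le_mul_of_nonneg_left (K.opNorm_comp_le E) (norm_nonneg P))
      _ ≤ 1 * (‖K‖ * 8) := mul_le_mul hPn
          (mul_le_mul_of_nonneg_left hEn (norm_nonneg K)) (by positivity) zero_le_one
      _ ≤ 1 * ((C * A * W) * 8) := by linarith
      _ = 8 * C * A * W := by ring
  refine ⟨T, fun u U hu hU => ?_, fun h => hTc ?_, hTn.trans hnorm⟩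
  swap
  · exact ((hKc h).comp_clm E).clm_comp P
  have hw : ∀ (n : ℤ) (r : ℝ), (1 + (n : ℝ) ^ 2) ^ (r / 2) = jap n ^ r :=
    fun n r => (jap_rpow n r).symm
  have hwN : ∀ (n : ℤ) (r : ℝ), (1 + (n.natAbs : ℝ) ^ 2) ^ (r / 2) = jap n ^ r := by
    intro n r
    rw [← hw]
    congr 2
    have : ((n.natAbs : ℝ)) = |(n : ℝ)| := by
      rw [Nat.cast_natAbs]; push_cast; rfl
    rw [this, sq_abs]
  obtain ⟨h1, h2, h3⟩ := hKf (evenLift u) (integrableOn_evenLift hu)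
    (E (sobolevIsometry famT (fun n : ℕ => (n : ℝ)) s U)) (by
    intro n
    rw [hE, sobolevIsometry_apply, fourierInt_evenLift hu, (hU.coeff_eq _).2, hwN,
      Real.rpow_neg (jap_pos n).le]
    have h0 : ((jap n ^ s : ℝ) : ℂ) ≠ 0 := by
      exact_mod_cast (Real.rpow_pos_of_pos (jap_pos n) s).ne'
    rw [Complex.ofReal_inv]
    field_simp)
  set h : ℝ → ℂ := fun θ => ∫ φ in periodI, a (θ - φ) * Φ (θ, φ) * evenLift u φ with hh
  have hhe : ∀ θ, h (-θ) = h θ := by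
    intro θ
    simp only [hh]
    rw [← setIntegral_periodI_comp_neg]
    congr 1
    ext φ
    rw [hΦe, evenLift_neg, show -θ - -φ = -(θ - φ) by ring, hae]
  have hsub : Ioo 0 Real.pi ⊆ periodI := Ioo_subset_Ioo (by linarith [Real.pi_pos]) le_rfl
  have h1' := ae_restrict_of_ae_restrict_of_subset hsub h1
  have hκe : ∀ θ ∈ Ioo 0 Real.pi,
      (fun φ => (Real.sin φ : ℂ) * (κ (Real.cos θ) (Real.cos φ) * u (Real.cos φ)))
      =ᵐ[volume.restrict (Ioo 0 Real.pi)]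
      fun φ => a (θ - φ) * Φ (θ, φ) * evenLift u φ + a (θ - -φ) * Φ (θ, -φ) * evenLift u (-φ) := by
    intro θ hθ
    have hne : ∀ᵐ φ ∂volume.restrict (Ioo 0 Real.pi), φ ≠ θ :=
      ae_restrict_of_ae (Measure.ae_ne volume θ)
    filter_upwards [hne, ae_restrict_mem measurableSet_Ioo] with φ hφ hφ'
    rw [hκ θ hθ φ hφ' hφ.symm, evenLift_neg, evenLift_of_mem u hφ', sub_neg_eq_add]
    ring
  constructor
  · refine ae_arcI_of_ae_cos ?_
    filter_upwards [h1', ae_restrict_mem measurableSet_Ioo] with θ hi hθ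
    obtain ⟨i1, i2⟩ := integrableOn_periodI_iff_halves.1 hi
    rw [integrableOn_arcI_iff, IntegrableOn, integrable_congr (hκe θ hθ)]
    exact i1.add i2
  · refine represents_of_basis fun k => ?_
    have hwh : ∀ᵐ θ ∂volume.restrict (Ioo 0 Real.pi),
        (fun t => ∫ τ in arcI, κ t τ * u τ) (Real.cos θ) = h θ := by
      filter_upwards [h1', ae_restrict_mem measurableSet_Ioo] with θ hi hθ
      simp only [hh]
      rw [integral_arcI, integral_congr_ae (hκe θ hθ), integral_periodI_eq_halves hi]
    obtain ⟨j1, j2⟩ := coeff_famW_of_even (w := fun t => ∫ τ in arcI, κ t τ * u τ) h2 hhe hwh k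
    refine ⟨j1, ?_⟩
    rw [j2]
    have h4 := hT U k
    have h5 := h3 k
    have hwk := hw (k : ℤ) (s + 1)
    rw [Int.cast_natCast] at hwk
    rw [hwk, ContinuousLinearMap.comp_apply, ContinuousLinearMap.comp_apply, hP, h5] at h4
    have h0 : ((jap (k : ℤ) ^ (s + 1) : ℝ) : ℂ) ≠ 0 := by
      exact_mod_cast (Real.rpow_pos_of_pos (jap_pos k) (s + 1)).ne'
    refine mul_left_cancel₀ h0 ?_
    rw [h4]
    ring

end

noncomputable section

/-! ### Double Fourier series of Hölder continuous functions -/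

theorem HasFourierBound.const_mul {τ W : ℝ} {Φ : ℝ × ℝ → ℂ} (h : HasFourierBound τ W Φ) (z : ℂ) :
    HasFourierBound τ (‖z‖ * W) fun x => z * Φ x := by
  obtain ⟨hW, hc, σ, h1, h2, h3⟩ := h
  have e : (fun p => (latticeWeight p ^ τ * ‖z * σ p‖) ^ 2) =
      fun p => ‖z‖ ^ 2 * (latticeWeight p ^ τ * ‖σ p‖) ^ 2 := by
    ext p
    rw [norm_mul]
    ring
  refine ⟨by positivity, by fun_prop, fun p => z * σ p, fun x => ?_, ?_, ?_⟩
  · have := (h1 x).mul_left z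
    simpa only [mul_assoc] using this
  · rw [e]
    exact h2.mul_left _
  · rw [e, tsum_mul_left, mul_pow]
    exact mul_le_mul_of_nonneg_left h3 (by positivity)

theorem HasFourierBound.add {τ W V : ℝ} {Φ Ψ : ℝ × ℝ → ℂ} (hΦ : HasFourierBound τ W Φ)
    (hΨ : HasFourierBound τ V Ψ) : HasFourierBound τ (2 * (W + V)) fun x => Φ x + Ψ x := by
  obtain ⟨hW, hc, σ, h1, h2, h3⟩ := hΦ
  obtain ⟨hV, hc', σ', h1', h2', h3'⟩ := hΨ
  have hle : ∀ p, (latticeWeight p ^ τ * ‖σ p + σ' p‖) ^ 2 ≤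
      2 * (latticeWeight p ^ τ * ‖σ p‖) ^ 2 + 2 * (latticeWeight p ^ τ * ‖σ' p‖) ^ 2 := by
    intro p
    have hl : 0 ≤ latticeWeight p ^ τ := Real.rpow_nonneg (latticeWeight_pos p).le τ
    have h4 : latticeWeight p ^ τ * ‖σ p + σ' p‖ ≤
        latticeWeight p ^ τ * ‖σ p‖ + latticeWeight p ^ τ * ‖σ' p‖ := by
      rw [← mul_add]
      exact mul_le_mul_of_nonneg_left (norm_add_le _ _) hl
    have h5 := pow_le_pow_left₀ (by positivity) h4 2
    nlinarith [sq_nonneg (latticeWeight p ^ τ * ‖σ p‖ - latticeWeight p ^ τ * ‖σ' p‖)]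
  have hs := (h2.mul_left 2).add (h2'.mul_left 2)
  have hs' : Summable fun p => (latticeWeight p ^ τ * ‖σ p + σ' p‖) ^ 2 :=
    Summable.of_nonneg_of_le (fun p => by positivity) hle hs
  refine ⟨by positivity, by fun_prop, fun p => σ p + σ' p, fun x => ?_, hs', ?_⟩
  · have := (h1 x).add (h1' x)
    simpa only [add_mul] using this
  · refine (hs'.tsum_le_tsum hle hs).trans ?_
    rw [(h2.mul_left 2).tsum_add (h2'.mul_left 2), tsum_mul_left, tsum_mul_left]
    nlinarith [mul_nonneg hW hV]

theorem HasFourierBound.mono {τ W V : ℝ} {Φ : ℝ × ℝ → ℂ} (h : HasFourierBound τ W Φ)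
    (hWV : W ≤ V) : HasFourierBound τ V Φ := by
  obtain ⟨hW, hc, σ, h1, h2, h3⟩ := h
  exact ⟨hW.trans hWV, hc, σ, h1, h2, h3.trans (pow_le_pow_left₀ hW hWV 2)⟩

theorem summable_of_latticeWeight {τ : ℝ} (hτ : 1 < τ) {σ : ℤ × ℤ → ℂ}
    (h : Summable fun p => (latticeWeight p ^ τ * ‖σ p‖) ^ 2) : Summable σ := by
  -- Only the summability of the symbol is wanted from the matrix estimate, so it is applied with s
  -- = 0 and zero convolution coefficients.
  obtain ⟨C, _, H⟩ := exists_matrix_operator 0 τ (by simpa [excessOrder] using hτ)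
  have h0 : 0 ≤ ∑' p, (latticeWeight p ^ τ * ‖σ p‖) ^ 2 := tsum_nonneg fun p => by positivity
  exact (H σ 0 0 _ (Real.sqrt_nonneg _) (by simp) h (Real.sq_sqrt h0).ge).1

theorem planeDist_fst (x x' y : ℝ) : planeDist (x, y) (x', y) = |x - x'| := by
  simp [planeDist, Real.sqrt_sq_eq_abs]

theorem planeDist_snd (x y y' : ℝ) : planeDist (x, y) (x, y') = |y - y'| := by
  simp [planeDist, Real.sqrt_sq_eq_abs]

theorem exists_hasFourierBound (m : ℕ) {α τ : ℝ} (hτ1 : 1 < τ) (hτ : τ < m + α) :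
    ∃ C : ℝ, 0 ≤ C ∧ ∀ Φ : ℝ × ℝ → ℂ, ContDiff ℝ m Φ →
      (∀ y, Function.Periodic (fun x => Φ (x, y)) (2 * Real.pi)) →
      (∀ x, Function.Periodic (fun y => Φ (x, y)) (2 * Real.pi)) →
      InHolder m α (periodI ×ˢ periodI) Φ →
      HasFourierBound τ (C * (holderNorm m α (periodI ×ˢ periodI) Φ).toReal) Φ := by
  obtain ⟨C, hC, H⟩ := summable_fourierInt₂ m (by linarith) hτ
  refine ⟨‖((2 * Real.pi : ℝ) : ℂ)⁻¹ ^ 2‖ * C, by positivity, fun Φ hd hp1 hp2 hΦ => ?_⟩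
  set N := (holderNorm m α (periodI ×ˢ periodI) Φ).toReal with hN
  have hN0 : 0 ≤ N := ENNReal.toReal_nonneg
  have e1 : ∀ x y, iteratedDeriv m (fun t => Φ (t, y)) x = partialDeriv (m, 0) Φ (x, y) := by
    intro x y; simp [partialDeriv]
  have e2 : ∀ x y, iteratedDeriv m (fun t => Φ (x, t)) y = partialDeriv (0, m) Φ (x, y) := by
    intro x y; simp [partialDeriv]
  have e0 : ∀ x, Φ x = partialDeriv (0, 0) Φ x := by
    intro x; simp [partialDeriv]
  obtain ⟨h1, h2⟩ := H Φ N hN0 hd.continuous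
    (fun y => hd.comp (contDiff_id.prodMk contDiff_const))
    (fun x => hd.comp (contDiff_const.prodMk contDiff_id)) hp1 hp2
    (fun x hx y hy => by
      rw [e0]; exact norm_partialDeriv_le hΦ.2.2 (by simp) ⟨hx, hy⟩)
    (fun y hy x hx => by
      rw [e1]; exact norm_partialDeriv_le hΦ.2.2 (by simp) ⟨hx, hy⟩)
    (fun x hx y hy => by
      rw [e2]; exact norm_partialDeriv_le hΦ.2.2 (by simp) ⟨hx, hy⟩)
    (fun hα y hy x hx x' hx' => by
      rw [e1, e1, ← planeDist_fst x x' y]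
      exact norm_partialDeriv_sub_le hΦ.2.2 hα (by simp) ⟨hx, hy⟩ ⟨hx', hy⟩)
    (fun hα x hx y hy y' hy' => by
      rw [e2, e2, ← planeDist_snd x y y']
      exact norm_partialDeriv_sub_le hΦ.2.2 hα (by simp) ⟨hx, hy⟩ ⟨hx, hy'⟩)
  have e : (fun p => (latticeWeight p ^ τ * ‖((2 * Real.pi : ℝ) : ℂ)⁻¹ ^ 2 * fourierInt₂ Φ p‖) ^ 2) =
      fun p => ‖((2 * Real.pi : ℝ) : ℂ)⁻¹ ^ 2‖ ^ 2 * (latticeWeight p ^ τ * ‖fourierInt₂ Φ p‖) ^ 2 := by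
    ext p
    rw [norm_mul]
    ring
  refine ⟨by positivity, hd.continuous, fun p => ((2 * Real.pi : ℝ) : ℂ)⁻¹ ^ 2 * fourierInt₂ Φ p,
    fun x => hasSum_fourierInt₂ hd.continuous hp1 hp2 (summable_of_latticeWeight hτ1 h1) x, ?_, ?_⟩
  · rw [e]
    exact h1.mul_left _
  · rw [e, tsum_mul_left, mul_assoc, mul_pow]
    exact mul_le_mul_of_nonneg_left h2 (by positivity)

/-! ### The kernels of the operators -/

theorem isConvKernel_one : IsConvKernel (fun _ => 1) (2 * Real.pi) where
  measurable := measurable_const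
  periodic _ := rfl
  integrable := integrableOn_periodI_iff.2 (continuous_const.intervalIntegrable _ _)
  bound j := by
    rw [fourierInt_one]
    split_ifs with h
    · subst h
      have : jap 0 = 1 := by simp [jap]
      rw [this, Complex.norm_real, Real.norm_of_nonneg (by positivity), mul_one]
    · simp [Real.pi_pos.le]

theorem summable_one_kernel :
    Summable fun j : ℤ => (‖fourierInt (fun _ => 1) j‖ * jap j) ^ 2 := by
  refine summable_of_ne_finset_zero (s := {0}) fun j hj => ?_
  rw [fourierInt_one, if_neg (by simpa using hj)]
  simp

theorem exists_isConvKernel_logKer : ∃ A, IsConvKernel (fun x => (logKer x : ℂ)) A := by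
  obtain ⟨A, hA⟩ := exists_logKer_bound
  exact ⟨A, Complex.measurable_ofReal.comp measurable_logKer,
    fun x => by simp only [periodic_logKer x], integrableOn_logKer, hA⟩

/-- The coefficients are O(⟨j⟩⁻²), one order better than boundedness requires; times ⟨j⟩ they are
square summable, which is the compactness criterion. -/
theorem exists_isConvKernel_sinLogKer :
    ∃ A, IsConvKernel (fun x => (sinLogKer x : ℂ)) A ∧
      Summable fun j : ℤ => (‖fourierInt (fun x => (sinLogKer x : ℂ)) j‖ * jap j) ^ 2 := by
  obtain ⟨A, hA⟩ := exists_sinLogKer_bound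
  have hA' : ∀ j : ℤ, ‖fourierInt (fun x => (sinLogKer x : ℂ)) j‖ * jap j ≤ A * (jap j)⁻¹ := by
    intro j
    rw [← div_eq_mul_inv, le_div_iff₀ (jap_pos j), mul_assoc, ← sq]
    exact hA j
  have hA0 : 0 ≤ A := le_trans (by positivity) (hA 0)
  refine ⟨A, ⟨Complex.measurable_ofReal.comp measurable_sinLogKer,
    fun x => by simp only [periodic_sinLogKer x], integrableOn_sinLogKer, fun j => ?_⟩, ?_⟩
  · refine (hA' j).trans ?_
    have := inv_le_one_of_one_le₀ (one_le_jap j)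
    nlinarith
  · have hs := (summable_jap_rpow (r := 2) (by norm_num)).mul_left (A ^ 2)
    refine Summable.of_nonneg_of_le (fun j => by positivity) (fun j => ?_) hs
    have h1 := pow_le_pow_left₀ (by have := (jap_pos j).le; positivity) (hA' j) 2
    rw [mul_pow A, inv_pow] at h1
    rw [Real.rpow_neg (jap_pos j).le]
    have e : jap j ^ (2 : ℝ) = jap j ^ 2 := Real.rpow_natCast (jap j) 2
    rw [e]
    exact h1

theorem sigmaFun_of_mem {f : ℝ × ℝ → ℂ} (hf : ContinuousOn f (arcI ×ˢ arcI)) {θ φ : ℝ}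
    (hθ : Real.sin θ ≠ 0) (hφ : Real.sin φ ≠ 0) :
    sigmaFun f (θ, φ) = f (Real.cos θ, Real.cos φ) := by
  have hx : (Real.cos θ, Real.cos φ) ∈ arcI ×ˢ arcI := ⟨cos_mem_arcI hθ, cos_mem_arcI hφ⟩
  exact extendFrom_eq (subset_closure hx) (hf _ hx)

theorem sigmaFun_neg_snd (f : ℝ × ℝ → ℂ) (θ φ : ℝ) : sigmaFun f (θ, -φ) = sigmaFun f (θ, φ) := by
  simp [sigmaFun]

theorem sigmaFun_neg_fst (f : ℝ × ℝ → ℂ) (θ φ : ℝ) : sigmaFun f (-θ, φ) = sigmaFun f (θ, φ) := by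
  simp [sigmaFun]

theorem cos_sub_cos_eq (θ φ : ℝ) : Real.cos θ - Real.cos φ =
    -2 * Real.sin ((θ + φ) / 2) * Real.sin ((θ - φ) / 2) := Real.cos_sub_cos θ φ

/-- The logarithm of the product 2|sin((θ+φ)/2)||sin((θ-φ)/2)| splits because both sines are
nonzero; sharing log 2 equally between them is why `logKer` carries (log 2)/2. -/
theorem log_abs_cos_sub_cos {θ φ : ℝ} (hθ : θ ∈ Ioo 0 Real.pi) (hφ : φ ∈ Ioo 0 Real.pi)
    (h : θ ≠ φ) : Real.log |Real.cos θ - Real.cos φ| = logKer (θ - φ) + logKer (θ + φ) := by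
  have h1 : Real.sin ((θ + φ) / 2) ≠ 0 :=
    (Real.sin_pos_of_pos_of_lt_pi (by linarith [hθ.1, hφ.1]) (by linarith [hθ.2, hφ.2])).ne'
  have h2 : Real.sin ((θ - φ) / 2) ≠ 0 := by
    intro h0
    have := (Real.sin_eq_zero_iff_of_lt_of_lt (by linarith [hθ.1, hφ.2, Real.pi_pos])
      (by linarith [hθ.2, hφ.1, Real.pi_pos])).1 h0
    exact h (by linarith)
  rw [Real.log_abs, cos_sub_cos_eq, Real.log_mul (by simpa using h1) h2,
    Real.log_mul (by norm_num) h1, Real.log_neg_eq_log, logKer, logKer]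
  ring

end

/-! ### Bounds for the lifted symbols, and the kernels in angular variables. -/

noncomputable section

open scoped ContDiff in
theorem exists_trig_mul_bound (m : ℕ) {α τ : ℝ} (hα : α ∈ Icc (0 : ℝ) 1) (hτ1 : 1 < τ)
    (hτ : τ < m + α) {e : ℝ → ℝ} (he : ContDiff ℝ ∞ e) (hp : Function.Periodic e (2 * Real.pi)) :
    ∃ D : ℝ, 0 ≤ D ∧ ∀ f : ℝ × ℝ → ℂ, InHolder m α (arcI ×ˢ arcI) f →
      InHolder m α (periodI ×ˢ periodI) (fun x => (e x.1 : ℂ) * ((e x.2 : ℂ) * sigmaFun f x)) ∧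
      HasFourierBound τ (D * (holderNorm m α (periodI ×ˢ periodI)
        (fun x => (e x.1 : ℂ) * ((e x.2 : ℂ) * sigmaFun f x))).toReal)
        (fun x => (e x.1 : ℂ) * ((e x.2 : ℂ) * sigmaFun f x)) ∧
      HasFourierBound τ (D * (holderNorm m α (arcI ×ˢ arcI) f).toReal)
        (fun x => (e x.1 : ℂ) * ((e x.2 : ℂ) * sigmaFun f x)) := by
  obtain ⟨C, hC, H⟩ := exists_inHolder_mul_sigmaFun m hα he
  obtain ⟨F, hF, HF⟩ := exists_hasFourierBound m hτ1 hτ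
  have hD : F ≤ max F (F * C) := le_max_left _ _
  have hD' : F * C ≤ max F (F * C) := le_max_right _ _
  refine ⟨max F (F * C), hF.trans hD, fun f hf => ?_⟩
  obtain ⟨h1, h2, h3⟩ := H f hf
  have h4 := HF _ h1
    (fun y x => by simp only [sigmaFun, hp x, Real.cos_periodic x])
    (fun x y => by simp only [sigmaFun, hp y, Real.cos_periodic y]) h2
  refine ⟨h2, h4.mono (mul_le_mul_of_nonneg_right hD ENNReal.toReal_nonneg), h4.mono ?_⟩
  refine (mul_le_mul_of_nonneg_left h3 hF).trans ?_
  rw [← mul_assoc]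
  exact mul_le_mul_of_nonneg_right hD' ENNReal.toReal_nonneg

/-- The factor `sin² ((θ + φ) / 2) f(cos θ, cos φ)` of the kernel of `S_f`. -/
def sinSigmaFun (f : ℝ × ℝ → ℂ) (x : ℝ × ℝ) : ℂ :=
  ((Real.sin ((x.1 + x.2) / 2) ^ 2 : ℝ) : ℂ) * sigmaFun f x

theorem exists_sigma_bounds (m : ℕ) {α τ : ℝ} (hα : α ∈ Icc (0 : ℝ) 1) (hτ1 : 1 < τ)
    (hτ : τ < m + α) :
    ∃ D : ℝ, 0 ≤ D ∧ ∀ f : ℝ × ℝ → ℂ, InHolder m α (arcI ×ˢ arcI) f →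
      InHolder m α (periodI ×ˢ periodI) (sigmaFun f) ∧
      HasFourierBound τ (D * (holderNorm m α (periodI ×ˢ periodI) (sigmaFun f)).toReal)
        (sigmaFun f) ∧
      InHolder m α (periodI ×ˢ periodI) (phiFun f) ∧
      HasFourierBound τ (D * (holderNorm m α (periodI ×ˢ periodI) (phiFun f)).toReal)
        (phiFun f) ∧
      HasFourierBound τ (D * (holderNorm m α (arcI ×ˢ arcI) f).toReal) (sigmaFun f) ∧
      HasFourierBound τ (D * (holderNorm m α (arcI ×ˢ arcI) f).toReal) (sinSigmaFun f) := by
  obtain ⟨D₁, hD₁, H₁⟩ := exists_trig_mul_bound m hα hτ1 hτ (e := fun _ => 1) contDiff_const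
    (fun _ => rfl)
  obtain ⟨D₂, hD₂, H₂⟩ := exists_trig_mul_bound m hα hτ1 hτ Real.contDiff_sin Real.sin_periodic
  obtain ⟨D₃, hD₃, H₃⟩ := exists_trig_mul_bound m hα hτ1 hτ Real.contDiff_cos Real.cos_periodic
  refine ⟨2 * (D₁ + D₂ + D₃), by positivity, fun f hf => ?_⟩
  obtain ⟨a1, a2, a3⟩ := H₁ f hf
  obtain ⟨b1, b2, b3⟩ := H₂ f hf
  obtain ⟨-, -, c3⟩ := H₃ f hf
  have eσ : (fun x : ℝ × ℝ => (((1 : ℝ)) : ℂ) * ((((1 : ℝ)) : ℂ) * sigmaFun f x)) = sigmaFun f := by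
    ext x; simp
  have eφ : (fun x : ℝ × ℝ => (Real.sin x.1 : ℂ) * ((Real.sin x.2 : ℂ) * sigmaFun f x)) =
      phiFun f := by
    ext x; rw [phiFun]; ring
  rw [eσ] at a1 a2 a3
  rw [eφ] at b1 b2 b3
  have hle : ∀ {D : ℝ}, D ≤ 2 * (D₁ + D₂ + D₃) → ∀ {N : ℝ≥0∞},
      D * N.toReal ≤ 2 * (D₁ + D₂ + D₃) * N.toReal := fun h =>
    mul_le_mul_of_nonneg_right h ENNReal.toReal_nonneg
  refine ⟨a1, a2.mono (hle (by linarith)), b1, b2.mono (hle (by linarith)),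
    a3.mono (hle (by linarith)), ?_⟩
  -- By sin²((θ+φ)/2) = (1 - cos θ cos φ + sin θ sin φ)/2 the symbol of `S_f` is a combination of
  -- three products e(θ)e(φ)σ with e = 1, cos, sin.
  have hS := ((a3.const_mul (1 / 2)).add (c3.const_mul (-(1 / 2)))).add (b3.const_mul (1 / 2))
  have eS : (fun x : ℝ × ℝ => 1 / 2 * sigmaFun f x +
      -(1 / 2) * ((Real.cos x.1 : ℂ) * ((Real.cos x.2 : ℂ) * sigmaFun f x)) +
      1 / 2 * phiFun f x) = sinSigmaFun f := by
    ext x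
    have h : Real.sin ((x.1 + x.2) / 2) ^ 2 =
        1 / 2 - Real.cos x.1 * Real.cos x.2 / 2 + Real.sin x.1 * Real.sin x.2 / 2 := by
      rw [Real.sin_sq_eq_half_sub, mul_div_cancel₀ _ (by norm_num : (2 : ℝ) ≠ 0), Real.cos_add]
      ring
    rw [sinSigmaFun, h, phiFun]
    push_cast
    ring
  rw [eS] at hS
  refine hS.mono (le_of_le_of_eq ?_ (by ring : 2 * ((D₁ * (holderNorm m α (arcI ×ˢ arcI) f).toReal) +
    (D₂ * (holderNorm m α (arcI ×ˢ arcI) f).toReal) +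
    (D₃ * (holderNorm m α (arcI ×ˢ arcI) f).toReal)) = _))
  have hN : 0 ≤ (holderNorm m α (arcI ×ˢ arcI) f).toReal := ENNReal.toReal_nonneg
  have n1 : ‖(1 / 2 : ℂ)‖ = 1 / 2 := by simp
  have n2 : ‖(-(1 / 2) : ℂ)‖ = 1 / 2 := by simp
  rw [n1, n2]
  nlinarith [mul_nonneg hD₁ hN, mul_nonneg hD₂ hN, mul_nonneg hD₃ hN]

theorem exists_T_and_U_operator (s : ℝ) {τ : ℝ} (hτ : excessOrder s + 1 < τ) :
    ∃ C : ℝ, 0 ≤ C ∧ ∀ (Φ : ℝ × ℝ → ℂ) (W : ℝ), HasFourierBound τ W Φ →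
      (∀ θ φ, Φ (-θ, -φ) = Φ (θ, φ)) →
      ∀ (a : ℝ → ℂ) (A : ℝ), IsConvKernel a A → (∀ x, a (-x) = a x) →
      ∀ κ : ℝ → ℝ → ℂ, (∀ θ ∈ Ioo 0 Real.pi, ∀ φ ∈ Ioo 0 Real.pi, θ ≠ φ →
        κ (Real.cos θ) (Real.cos φ) = a (θ - φ) * Φ (θ, φ) + a (θ + φ) * Φ (θ, -φ)) →
      (∃ T : SpaceT s →L[ℂ] SpaceW (s + 1),
        IsIntegralOp arcI κ T ∧
        (Summable (fun j => (‖fourierInt a j‖ * jap j) ^ 2) → IsCompactOperator T) ∧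
        ‖T‖ ≤ C * A * W) ∧
      ∃ T : SpaceU s →L[ℂ] SpaceY (s + 1),
        IsIntegralOp arcI κ T ∧
        (Summable (fun j => (‖fourierInt a j‖ * jap j) ^ 2) → IsCompactOperator T) ∧
        ‖T‖ ≤ C * A * W := by
  obtain ⟨C, hC, H⟩ := exists_T_operator s hτ
  obtain ⟨B, hB, HU⟩ := exists_U_operator_of_T_operator s (s + 1)
  refine ⟨(1 + B) * C, by positivity, fun Φ W hΦ hΦe a A ha hae κ hκ => ?_⟩
  obtain ⟨T, h1, h2, h3⟩ := H Φ W hΦ hΦe a A ha hae κ hκ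
  obtain ⟨T', n', c', k'⟩ := HU T
  have h0 : 0 ≤ C * A * W := (norm_nonneg T).trans h3
  refine ⟨⟨T, h1, h2, ?_⟩, T', k' κ h1, fun h => c' (h2 h), ?_⟩
  · nlinarith
  · have := mul_le_mul_of_nonneg_left h3 hB
    nlinarith

theorem enorm_le_mul_of_norm_le {E F : Type*} [SeminormedAddCommGroup E] [NormedSpace ℂ E]
    [SeminormedAddCommGroup F] [NormedSpace ℂ F] {T : E →L[ℂ] F} {c : ℝ} {N : ℝ≥0∞} (hN : N < ⊤)
    {C : ℝ≥0} (hc : c ≤ C) (h : ‖T‖ ≤ c * N.toReal) : ‖T‖ₑ ≤ C * N := by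
  have h1 : ‖T‖ ≤ C * N.toReal := h.trans (mul_le_mul_of_nonneg_right hc ENNReal.toReal_nonneg)
  calc ‖T‖ₑ = ENNReal.ofReal ‖T‖ := (ofReal_norm T).symm
    _ ≤ ENNReal.ofReal (C * N.toReal) := ENNReal.ofReal_le_ofReal h1
    _ = C * N := by
      rw [ENNReal.ofReal_mul C.coe_nonneg, ENNReal.ofReal_coe_nnreal, ENNReal.ofReal_toReal hN.ne]

/-- Either alternative forces m + α > 1, and it exceeds s + 1 and -s as well. -/
theorem excessOrder_lt {m : ℕ} {α s : ℝ}
    (hs : (-(1 / 2) < s ∧ s + 3 / 2 < m + α) ∨ (s ≤ -(1 / 2) ∧ -s + 1 / 2 < m + α)) :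
    excessOrder s + 1 < m + α := by
  have h : excessOrder s < m + α - 1 := by
    rw [excessOrder, max_lt_iff, max_lt_iff]
    rcases hs with ⟨h1, h2⟩ | ⟨h1, h2⟩
    · exact ⟨⟨by linarith, by linarith⟩, by linarith⟩
    · exact ⟨⟨by linarith, by linarith⟩, by linarith⟩
  linarith

theorem kerR_cos {f : ℝ × ℝ → ℂ} (hf : ContinuousOn f (arcI ×ˢ arcI)) {θ φ : ℝ}
    (hθ : θ ∈ Ioo 0 Real.pi) (hφ : φ ∈ Ioo 0 Real.pi) :
    kerR f (Real.cos θ) (Real.cos φ) =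
      1 * (1 / 2 * sigmaFun f (θ, φ)) + 1 * (1 / 2 * sigmaFun f (θ, -φ)) := by
  rw [sigmaFun_neg_snd, sigmaFun_of_mem hf (sin_pos_of_mem hθ).ne' (sin_pos_of_mem hφ).ne', kerR]
  ring

theorem kerL_cos {f : ℝ × ℝ → ℂ} (hf : ContinuousOn f (arcI ×ˢ arcI)) {θ φ : ℝ}
    (hθ : θ ∈ Ioo 0 Real.pi) (hφ : φ ∈ Ioo 0 Real.pi) (h : θ ≠ φ) :
    kerL f (Real.cos θ) (Real.cos φ) =
      (logKer (θ - φ) : ℂ) * sigmaFun f (θ, φ) + (logKer (θ + φ) : ℂ) * sigmaFun f (θ, -φ) := by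
  rw [sigmaFun_neg_snd, sigmaFun_of_mem hf (sin_pos_of_mem hθ).ne' (sin_pos_of_mem hφ).ne', kerL,
    log_abs_cos_sub_cos hθ hφ h, Complex.ofReal_add]
  ring

/-- The square (t-τ)² equals 4 sin²((θ+φ)/2) sin²((θ-φ)/2). In each logarithmic term the sine of the
same argument goes into the convolution kernel, where it improves the decay, and the other one into
the symbol. -/
theorem kerS_cos {f : ℝ × ℝ → ℂ} (hf : ContinuousOn f (arcI ×ˢ arcI)) {θ φ : ℝ}
    (hθ : θ ∈ Ioo 0 Real.pi) (hφ : φ ∈ Ioo 0 Real.pi) (h : θ ≠ φ) :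
    kerS f (Real.cos θ) (Real.cos φ) =
      (sinLogKer (θ - φ) : ℂ) * sinSigmaFun f (θ, φ) +
        (sinLogKer (θ + φ) : ℂ) * sinSigmaFun f (θ, -φ) := by
  have hc : ∀ x : ℝ, 2 - 2 * Real.cos x = 4 * Real.sin (x / 2) ^ 2 := by
    intro x
    rw [Real.sin_sq_eq_half_sub, mul_div_cancel₀ _ (by norm_num : (2 : ℝ) ≠ 0)]
    ring
  rw [sinSigmaFun, sinSigmaFun, sigmaFun_neg_snd,
    sigmaFun_of_mem hf (sin_pos_of_mem hθ).ne' (sin_pos_of_mem hφ).ne', kerS,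
    log_abs_cos_sub_cos hθ hφ h, cos_sub_cos_eq, sinLogKer, sinLogKer, hc, hc, ← sub_eq_add_neg]
  simp only [Complex.ofReal_add, Complex.ofReal_mul, Complex.ofReal_pow, Complex.ofReal_neg,
    Complex.ofReal_ofNat]
  ring

end

/-! ### The theorem, assembled from the periodic, T/W and U/Y operators. -/

theorem lemma4p1 (m : ℕ) (α s : ℝ) (hα : α ∈ Set.Icc (0 : ℝ) 1)
    (hs : (-(1 / 2) < s ∧ s + 3 / 2 < m + α) ∨ (s ≤ -(1 / 2) ∧ -s + 1 / 2 < m + α)) :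
    ∃ C : ℝ≥0, ∀ f : ℝ × ℝ → ℂ, InHolder m α (arcI ×ˢ arcI) f →
      -- the periodic operators
      (InHolder m α (periodI ×ˢ periodI) (sigmaFun f) ∧
        ∃ A : SpaceH s →L[ℂ] SpaceH (s + 1),
          IsIntegralOp periodI (kerRN f) A ∧ IsCompactOperator A ∧
          ‖A‖ₑ ≤ C * holderNorm m α (periodI ×ˢ periodI) (sigmaFun f)) ∧
      (InHolder m α (periodI ×ˢ periodI) (phiFun f) ∧
        ∃ A : SpaceH s →L[ℂ] SpaceH (s + 1),
          IsIntegralOp periodI (kerRZ f) A ∧ IsCompactOperator A ∧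
          ‖A‖ₑ ≤ C * holderNorm m α (periodI ×ˢ periodI) (phiFun f)) ∧
      -- the operator with kernel `f`
      (∃ A : SpaceT s →L[ℂ] SpaceW (s + 1),
          IsIntegralOp arcI (kerR f) A ∧ IsCompactOperator A ∧
          ‖A‖ₑ ≤ C * holderNorm m α (arcI ×ˢ arcI) f) ∧
      (∃ A : SpaceU s →L[ℂ] SpaceY (s + 1),
          IsIntegralOp arcI (kerR f) A ∧ IsCompactOperator A ∧
          ‖A‖ₑ ≤ C * holderNorm m α (arcI ×ˢ arcI) f) ∧
      -- the operator with kernel `log |t - τ| f`, bounded but in general not compact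
      (∃ A : SpaceT s →L[ℂ] SpaceW (s + 1),
          IsIntegralOp arcI (kerL f) A ∧
          ‖A‖ₑ ≤ C * holderNorm m α (arcI ×ˢ arcI) f) ∧
      (∃ A : SpaceU s →L[ℂ] SpaceY (s + 1),
          IsIntegralOp arcI (kerL f) A ∧
          ‖A‖ₑ ≤ C * holderNorm m α (arcI ×ˢ arcI) f) ∧
      -- the operator with kernel `(t - τ)² log |t - τ| f`
      (∃ A : SpaceT s →L[ℂ] SpaceW (s + 1),
          IsIntegralOp arcI (kerS f) A ∧ IsCompactOperator A ∧
          ‖A‖ₑ ≤ C * holderNorm m α (arcI ×ˢ arcI) f) ∧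
      (∃ A : SpaceU s →L[ℂ] SpaceY (s + 1),
          IsIntegralOp arcI (kerS f) A ∧ IsCompactOperator A ∧
          ‖A‖ₑ ≤ C * holderNorm m α (arcI ×ˢ arcI) f) := by
  -- The number τ lies between what the matrix estimate needs and what the smoothness of f gives; it
  -- depends only on m, α, s, and so does the final constant.
  obtain ⟨τ, hτ1, hτ2⟩ := exists_between (excessOrder_lt hs)
  have hτ : 1 < τ := by
    have : 0 ≤ excessOrder s := (le_max_right s 0).trans (le_max_left _ _)
    linarith
  obtain ⟨D, hD, HD⟩ := exists_sigma_bounds m hα hτ hτ2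
  obtain ⟨CH, hCH, HH⟩ := exists_H_operator s hτ1
  obtain ⟨CT, hCT, HT⟩ := exists_T_and_U_operator s hτ1
  obtain ⟨AL, hAL⟩ := exists_isConvKernel_logKer
  obtain ⟨AS, hAS, hSS⟩ := exists_isConvKernel_sinLogKer
  have nonneg : ∀ {a : ℝ → ℂ} {A : ℝ}, IsConvKernel a A → 0 ≤ A := fun h =>
    (mul_nonneg (norm_nonneg _) (jap_pos 0).le).trans (h.bound 0)
  have hAL0 := nonneg hAL
  have hAS0 := nonneg hAS
  set c : ℝ := CH * (2 * Real.pi) * D + CT * (2 * Real.pi + AL + AS) * D with hc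
  have p0 : 0 ≤ CH * (2 * Real.pi) * D := by positivity
  have p1 : 0 ≤ CT * (2 * Real.pi) * D := by positivity
  have p2 : 0 ≤ CT * AL * D := by positivity
  have p3 : 0 ≤ CT * AS * D := by positivity
  have hcc : c = CH * (2 * Real.pi) * D + CT * (2 * Real.pi) * D + CT * AL * D + CT * AS * D := by
    rw [hc]; ring
  have hhalf : ‖(1 / 2 : ℂ)‖ = 1 / 2 := by simp
  refine ⟨Real.toNNReal c, fun f hf => ?_⟩
  have hC : c ≤ Real.toNNReal c := Real.le_coe_toNNReal c
  obtain ⟨s1, s2, f1, f2, g1, g2⟩ := HD f hf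
  have hfc := hf.1.continuousOn
  obtain ⟨T₁, i₁, k₁, n₁⟩ := HH _ _ (s2.const_mul (1 / 2)) _ _ isConvKernel_one
  obtain ⟨T₂, i₂, k₂, n₂⟩ := HH _ _ (f2.const_mul (1 / 2)) _ _ isConvKernel_one
  obtain ⟨⟨T₃, i₃, k₃, n₃⟩, T₄, i₄, k₄, n₄⟩ := HT _ _ (g1.const_mul (1 / 2))
    (fun θ φ => by simp only [sigmaFun_neg_fst, sigmaFun_neg_snd]) _ _ isConvKernel_one
    (fun _ => rfl) (kerR f) (fun θ hθ φ hφ _ => kerR_cos hfc hθ hφ)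
  -- The compactness clause is dropped: for the logarithm the products ‖a j‖⟨j⟩ tend to π, so they
  -- are not square summable.
  obtain ⟨⟨T₅, i₅, -, n₅⟩, T₆, i₆, -, n₆⟩ := HT _ _ g1
    (fun θ φ => by simp only [sigmaFun_neg_fst, sigmaFun_neg_snd]) _ _ hAL
    (fun x => by rw [logKer_neg]) (kerL f) (fun θ hθ φ hφ h => kerL_cos hfc hθ hφ h)
  obtain ⟨⟨T₇, i₇, k₇, n₇⟩, T₈, i₈, k₈, n₈⟩ := HT _ _ g2
    (fun θ φ => by
      simp only [sinSigmaFun, sigmaFun_neg_fst, sigmaFun_neg_snd]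
      rw [show (-θ + -φ) / 2 = -((θ + φ) / 2) by ring, Real.sin_neg, neg_sq]) _ _ hAS
    (fun x => by rw [sinLogKer_neg]) (kerS f) (fun θ hθ φ hφ h => kerS_cos hfc hθ hφ h)
  have eN : (fun θ φ : ℝ => 1 * (1 / 2 * sigmaFun f (θ, φ))) = kerRN f := by
    ext θ φ; rw [one_mul, kerRN]
  have eZ : (fun θ φ : ℝ => 1 * (1 / 2 * phiFun f (θ, φ))) = kerRZ f := by
    ext θ φ; rw [one_mul, kerRZ]
  rw [hhalf] at n₁ n₂ n₃ n₄
  refine ⟨⟨s1, T₁, eN ▸ i₁, k₁ summable_one_kernel,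
      enorm_le_mul_of_norm_le s1.2.2 ((by linarith : _ ≤ c).trans hC)
        (n₁.trans_eq (by ring : _ = CH * (2 * Real.pi) * D / 2 * _))⟩,
    ⟨f1, T₂, eZ ▸ i₂, k₂ summable_one_kernel,
      enorm_le_mul_of_norm_le f1.2.2 ((by linarith : _ ≤ c).trans hC)
        (n₂.trans_eq (by ring : _ = CH * (2 * Real.pi) * D / 2 * _))⟩,
    ⟨T₃, i₃, k₃ summable_one_kernel,
      enorm_le_mul_of_norm_le hf.2.2 ((by linarith : _ ≤ c).trans hC)
        (n₃.trans_eq (by ring : _ = CT * (2 * Real.pi) * D / 2 * _))⟩,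
    ⟨T₄, i₄, k₄ summable_one_kernel,
      enorm_le_mul_of_norm_le hf.2.2 ((by linarith : _ ≤ c).trans hC)
        (n₄.trans_eq (by ring : _ = CT * (2 * Real.pi) * D / 2 * _))⟩,
    ⟨T₅, i₅, enorm_le_mul_of_norm_le hf.2.2 ((by linarith : _ ≤ c).trans hC)
        (n₅.trans_eq (by ring : _ = CT * AL * D * _))⟩,
    ⟨T₆, i₆, enorm_le_mul_of_norm_le hf.2.2 ((by linarith : _ ≤ c).trans hC)
        (n₆.trans_eq (by ring : _ = CT * AL * D * _))⟩,
    ⟨T₇, i₇, k₇ hSS, enorm_le_mul_of_norm_le hf.2.2 ((by linarith : _ ≤ c).trans hC)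
        (n₇.trans_eq (by ring : _ = CT * AS * D * _))⟩,
    ⟨T₈, i₈, k₈ hSS, enorm_le_mul_of_norm_le hf.2.2 ((by linarith : _ ≤ c).trans hC)
        (n₈.trans_eq (by ring : _ = CT * AS * D * _))⟩⟩
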